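/- Let $n\ge 2$ and $\mu>n-1$. Let $\Omega\subset\mathbb R^n$ be a domain (a non-empty connected open set), let $K\colon\Omega\to[1,\infty)$ and $\Sigma\colon\Omega\to[0,\infty)$ be measurable functions, and let $f\in W^{1,n}_{\mathrm{loc}}(\Omega,\mathbb R^n)$ satisfy $$|Df(x)|^n\le K(x)\,J_f(x)+\Sigma(x)\qquad\text{for a.e. }x\in\Omega,\tag{1}$$ where $Df$ is the weak derivative, $|\cdot|$ is the operator norm and $J_f=\det Df$. Assume that $$K\in L^\infty_{\mathrm{loc}}(\Omega)\qquad\text{and}\qquad \Sigma\log^\mu(e+\Sigma)\in L^1_{\mathrm{loc}}(\Omega).\tag{2}$$ For $g\colon\Omega\to\mathbb R^n$, $x_0\in\Omega$ and $r>0$ write $\omega_g(x_0,r)=\sup\{|g(x_0)-g(x)|: x\in\Omega,\ |x-x_0|\le r\}$. (a) The map $f$ has a continuous representative, that is, there is a continuous map $g\colon\Omega\to\mathbb R^n$ with $f=g$ a.e. in $\Omega$. Moreover, for every $x_0\in\Omega$ there is a constant $C$ such that $$\omega_g(x_0,r)\le C\,\log^{-(\mu-n+1)/n}(1/r)\qquad\text{for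 all sufficiently small } r>0.$$ (b) The exponent $(\mu-n+1)/n$ is sharp: for all $n\ge2$, $\mu>n-1$ and every $\beta>(\mu-n+1)/n$ there are $\Omega$, $K$, $\Sigma$ and a continuous $f$ as above, satisfying (1) and (2), and a point $x_0\in\Omega$, such that for no constant $C$ does the estimate $\omega_f(x_0,r)\le C\log^{-\beta}(1/r)$ hold for all sufficiently small $r>0$. -/

import Mathlib

open MeasureTheory Set Filter Topology
open scoped ContDiff

namespace GenDistortion

/-- Euclidean space `ℝⁿ`, with its Euclidean norm and Lebesgue measure. -/
abbrev E (n : ℕ) : Type := EuclideanSpace ℝ (Fin n)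

/-- `f ∈ L^p_loc(Ω)`: `f` is in `L^p` on every compact subset of `Ω`. -/
def MemLpLoc {n : ℕ} {F : Type*} [NormedAddCommGroup F]
    (f : E n → F) (p : ENNReal) (Ω : Set (E n)) : Prop :=
  ∀ k : Set (E n), k ⊆ Ω → IsCompact k → MemLp f p (volume.restrict k)

/-- `G` is a weak (distributional) derivative of the locally integrable map `f` on the open
set `Ω`: `∫ (∂_v φ) f = - ∫ φ (G v)` for all test functions `φ ∈ C_c^∞(Ω)` and all
directions `v`. -/
def HasWeakFDerivOn {n m : ℕ} (Ω : Set (E n)) (f : E n → E m)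
    (G : E n → (E n →L[ℝ] E m)) : Prop :=
  LocallyIntegrableOn f Ω ∧ LocallyIntegrableOn G Ω ∧
    ∀ φ : E n → ℝ, ContDiff ℝ ∞ φ → HasCompactSupport φ → tsupport φ ⊆ Ω →
      ∀ v : E n, ∫ x, (fderiv ℝ φ x v) • f x = - ∫ x, φ x • G x v

/-- `f ∈ W^{1,p}_loc(Ω, ℝᵐ)`, with weak derivative `Df`. -/
structure MemW1Loc {n m : ℕ} (p : ENNReal) (Ω : Set (E n)) (f : E n → E m)
    (Df : E n → (E n →L[ℝ] E m)) : Prop where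
  weakDeriv : HasWeakFDerivOn Ω f Df
  memLp : MemLpLoc f p Ω
  memLp_deriv : MemLpLoc Df p Ω

/-- The set of linear maps (matrices) `A` with `|A|ⁿ ≤ K det A + S`, where `|A|` is the operator
norm with respect to the Euclidean norm. -/
def distortionSet (n : ℕ) (K S : ℝ) : Set (E n →L[ℝ] E n) :=
  {A | ‖A‖ ^ n ≤ K * A.det + S}

/-- `Ω ⊆ ℝⁿ` is a domain, `f ∈ W^{1,n}_loc(Ω, ℝⁿ)` has weak derivative `Df`, the functions
`K : Ω → [1, ∞)` and `S : Ω → [0, ∞)` are measurable, `|Df|ⁿ ≤ K J_f + S` a.e. in `Ω`,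
`K ∈ L^∞_loc(Ω)` and `S log^μ(e + S) ∈ L^1_loc(Ω)`. -/
structure IsZygmundSolution (n : ℕ) (μ : ℝ) (Ω : Set (E n)) (f : E n → E n)
    (Df : E n → (E n →L[ℝ] E n)) (K S : E n → ℝ) : Prop where
  isOpen : IsOpen Ω
  isConnected : IsConnected Ω
  sobolev : MemW1Loc (n : ENNReal) Ω f Df
  K_meas : AEMeasurable K (volume.restrict Ω)
  one_le_K : ∀ x ∈ Ω, 1 ≤ K x
  S_meas : AEMeasurable S (volume.restrict Ω)
  S_nonneg : ∀ x ∈ Ω, 0 ≤ S x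
  inclusion : ∀ᵐ x ∂(volume.restrict Ω), Df x ∈ distortionSet n (K x) (S x)
  K_locBdd : MemLpLoc K ⊤ Ω
  S_zygmund : LocallyIntegrableOn (fun x => S x * Real.log (Real.exp 1 + S x) ^ μ) Ω

/-- The local modulus of continuity
`ω_f(x₀, r) = sup {|f(x₀) - f(x)| : x ∈ Ω, |x - x₀| ≤ r}`, with values in `[0, ∞]`. -/
noncomputable def modCont {n m : ℕ} (Ω : Set (E n)) (f : E n → E m) (x₀ : E n) (r : ℝ) : ENNReal :=
  ⨆ x ∈ {x : E n | x ∈ Ω ∧ ‖x - x₀‖ ≤ r}, ENNReal.ofReal ‖f x₀ - f x‖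

/-- `ω_f(x₀, r) ≤ C log^{-a}(1/r)` for some constant `C` and all sufficiently small `r > 0`. -/
def HasLogModulusAt {n m : ℕ} (Ω : Set (E n)) (f : E n → E m) (x₀ : E n) (a : ℝ) : Prop :=
  ∃ C : ℝ, ∀ᶠ r in 𝓝[>] (0 : ℝ),
    modCont Ω f x₀ r ≤ ENNReal.ofReal (C * Real.log (1 / r) ^ (-a))

end GenDistortion

/-!
Existence. The engine is that `∫ det Dh = 0` for compactly supported `h`. For `s` large,
`x ↦ s x + h x` is a diffeomorphism that equals `s x` outside a ball, so that
`∫ det (s + Dh) = s ^ n * vol` over that ball; as `det A` is a fixed linear combination of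
finitely many values `det (s i + A)`, by interpolation of the characteristic polynomial, the
integral of `det Dh` is the same as for `h = 0` (`integral_det_fderiv_eq_zero`). Applied to
`η (f - c)` with a cut-off function `η` between the cubes of half side lengths `r` and `4 r`, this
shows that `∫ η ^ n det Df` only sees the annulus between these cubes, and the Poincaré inequality
there, for a suitable `c`, bounds it by the energy `∫ |Df| ^ n` of the annulus
(`exists_integral_cutoff_pow_mul_det_le_of_memW1Loc`). Together with the distortion inequality
this is the hole-filling estimate `exists_hole_filling`: with `u r` the energy in the cube of half
side length `r`,

  `u r ≤ C (u (4 r) - u r) + C ∫ S` over the cube of half side length `4 r`.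

Hence `u r ≤ θ u (4 r) + C ∫ S` with `θ < 1`. The Zygmund condition makes `∫ S` over a cube of
size `2 ^ (-k)` at most a multiple of `k ^ (-μ)`, and iteration gives the same decay for the
energy, uniformly over nearby centres (`IsZygmundSolution.exists_energy_decay`).

By the Poincaré inequality, the jump between the mean values of `f` over consecutive dyadic annuli
is bounded by the energy in these annuli to the power `1 / n`. Hölder's inequality over the block
`[k, 2 k]` of scales bounds the total jump there by `k ^ ((n - 1) / n) * (k ^ (-μ)) ^ (1 / n)`,
that is, `k ^ (-(μ - n + 1) / n)` (`norm_sub_le_of_block`), and these bounds are summable over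
`k, 2 k, 4 k, …`. Using energy increments in annuli of bounded overlap, rather than the decay of
each annulus separately, is what yields this exponent. The limits of the mean values therefore
exist at every point, define the continuous representative and have the asserted modulus of
continuity.

All estimates are proved for `C¹` maps and transferred to Sobolev maps by mollification
(`exists_smooth_approx`); no form of the Sobolev embedding is needed. The Poincaré inequality
holds on each convex slab beyond a face of the inner cube, and is chained through overlapping
slabs.

Sharpness. For `γ` between `(μ - n + 1) / n` and `β`, the map `x ↦ log^{-γ}(1 + 1/|x|²) e` with a
fixed unit vector `e` has a derivative of rank one, hence no Jacobian, so that it is a solution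
with `K = 1` and `S` comparable to `|Df| ^ n`. The Zygmund condition amounts to
`n (γ + 1) - μ > 1` (`isZygmundSolution_logMap`), while the modulus of continuity at the origin is
of order `log^{-γ}(1/r)` (`not_hasLogModulusAt_logMap`).
-/

namespace GenDistortion

open scoped ENNReal NNReal

/-! ### The integral of a Jacobian determinant -/

/-- The determinant of `A` is a fixed linear combination of the determinants of `v i + A`: the
latter are values of the characteristic polynomial of `-A`, from which Lagrange interpolation
recovers the value at zero. -/
theorem det_eq_sum_weights {n : ℕ} {v : ℕ → ℝ} (hv : Function.Injective v) :
    ∃ w : ℕ → ℝ, ∀ A : E n →L[ℝ] E n,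
      A.det = ∑ i ∈ Finset.range (n + 1), w i * (v i • ContinuousLinearMap.id ℝ (E n) + A).det := by
  refine ⟨fun i => (Lagrange.basis (Finset.range (n + 1)) v i).eval 0, fun A => ?_⟩
  have key : ∀ s : ℝ, ((-A : E n →L[ℝ] E n) : E n →ₗ[ℝ] E n).charpoly.eval s
      = (s • ContinuousLinearMap.id ℝ (E n) + A).det := by
    intro s
    rw [LinearMap.eval_charpoly, ContinuousLinearMap.det]
    congr 1
    ext x
    simp
  have hdeg : ((-A : E n →L[ℝ] E n) : E n →ₗ[ℝ] E n).charpoly.degree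
      < (Finset.range (n + 1)).card := by
    rw [Polynomial.degree_eq_natDegree (LinearMap.charpoly_monic _).ne_zero,
      LinearMap.charpoly_natDegree]
    simp
    exact_mod_cast Nat.lt_succ_self n
  have h := Lagrange.eq_interpolate (s := Finset.range (n + 1)) (v := v) hv.injOn hdeg
  have h0 := congrArg (Polynomial.eval 0) h
  rw [key 0, Lagrange.interpolate_apply, Polynomial.eval_finsetSum] at h0
  rw [show (0 : ℝ) • ContinuousLinearMap.id ℝ (E n) + A = A by ext; simp] at h0
  rw [h0]
  refine Finset.sum_congr rfl fun i _ => ?_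
  rw [Polynomial.eval_mul, Polynomial.eval_C, key, mul_comm]

/-- The determinant of `s + A` with `‖A‖ < s` is positive: it does not vanish along the segment from
`s` to `s + A`. -/
theorem det_smul_id_add_pos {n : ℕ} (A : E n →L[ℝ] E n) {s : ℝ} (hs : ‖A‖ < s) :
    0 < (s • ContinuousLinearMap.id ℝ (E n) + A).det := by
  have hs0 : 0 < s := (norm_nonneg A).trans_lt hs
  have hne : ∀ t ∈ Icc (0 : ℝ) 1, (s • ContinuousLinearMap.id ℝ (E n) + t • A).det ≠ 0 := by
    intro t ht h0
    obtain ⟨x, hx, hx0⟩ := (Submodule.ne_bot_iff _).1 (LinearMap.bot_lt_ker_of_det_eq_zero h0).ne'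
    have hx1 : s • x + t • A x = 0 := by simpa using hx
    have h1 : s • x = -(t • A x) := eq_neg_of_add_eq_zero_left hx1
    have h2 : s * ‖x‖ = t * ‖A x‖ := by
      have := congrArg norm h1
      rwa [norm_neg, norm_smul, norm_smul, Real.norm_of_nonneg hs0.le,
        Real.norm_of_nonneg ht.1] at this
    have h3 := A.le_opNorm x
    have h4 : 0 < ‖x‖ := norm_pos_iff.2 hx0
    nlinarith [ht.1, ht.2, norm_nonneg (A x), mul_lt_mul_of_pos_right hs h4]
  have hc : Continuous fun t : ℝ => (s • ContinuousLinearMap.id ℝ (E n) + t • A).det :=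
    ContinuousLinearMap.continuous_det.comp (by fun_prop)
  by_contra hneg
  have h0 : 0 < (s • ContinuousLinearMap.id ℝ (E n) + (0 : ℝ) • A).det := by
    rw [show s • ContinuousLinearMap.id ℝ (E n) + (0 : ℝ) • A = s • ContinuousLinearMap.id ℝ (E n)
      by ext; simp, ContinuousLinearMap.det]
    simp [LinearMap.det_smul, hs0]
  have h1 : (s • ContinuousLinearMap.id ℝ (E n) + (1 : ℝ) • A).det ≤ 0 := by simpa using hneg
  obtain ⟨t, ht, ht0⟩ := intermediate_value_Icc' (zero_le_one' ℝ) hc.continuousOn ⟨h1, h0.le⟩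
  exact hne t ht ht0

/-- Pushing forward by the diffeomorphism `x ↦ s x + h x`, for `s` larger than the Lipschitz
constant of the perturbation `h`. -/
theorem integral_det_smul_id_add_fderiv {n : ℕ} {h : E n → E n} (hh : ContDiff ℝ 1 h)
    {L : NNReal} (hL : LipschitzWith L h) {R : ℝ} (hR : ∀ x, R < ‖x‖ → h x = 0) {s : ℝ}
    (hs : (L : ℝ) < s) :
    ∫ x in Metric.closedBall (0 : E n) R, (s • ContinuousLinearMap.id ℝ (E n) + fderiv ℝ h x).det
      = s ^ n * volume.real (Metric.closedBall (0 : E n) R) := by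
  have hs0 : 0 < s := L.coe_nonneg.trans_lt hs
  set F : E n → E n := fun x => s • x + h x with hF
  have hd : ∀ x, HasFDerivAt F (s • ContinuousLinearMap.id ℝ (E n) + fderiv ℝ h x) x := fun x =>
    ((hasFDerivAt_id x).const_smul s).add ((hh.differentiable one_ne_zero) x).hasFDerivAt
  let e : E n ≃L[ℝ] E n := ContinuousLinearEquiv.smulLeft (Units.mk0 s hs0.ne')
  -- a perturbation of the dilation with Lipschitz constant less than `s` is surjective
  have happ : ApproximatesLinearOn F (e : E n →L[ℝ] E n) univ L := by
    rw [ApproximatesLinearOn.approximatesLinearOn_iff_lipschitzOnWith, lipschitzOnWith_univ]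
    have hFh : F - (e : E n →L[ℝ] E n) = h := by
      funext x
      change s • x + h x - s • x = h x
      simp
    rw [hFh]
    exact hL
  have hinj : Function.Injective F := by
    intro x y hxy
    have h1 : s • (x - y) = h y - h x := by
      have : s • x + h x = s • y + h y := hxy
      rw [smul_sub, sub_eq_sub_iff_add_eq_add, this, add_comm]
    have h2 := congrArg norm h1
    rw [norm_smul, Real.norm_of_nonneg hs0.le] at h2
    have h3 := hL.norm_sub_le y x
    rw [norm_sub_rev y x] at h3
    by_contra hne
    have h4 : 0 < ‖x - y‖ := norm_pos_iff.2 (sub_ne_zero.2 hne)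
    nlinarith [mul_lt_mul_of_pos_right hs h4]
  have hsurj : Function.Surjective F := by
    rcases subsingleton_or_nontrivial (E n) with hsub | hnt
    · exact fun y => ⟨y, Subsingleton.elim _ _⟩
    refine happ.surjective (Or.inr ?_)
    have hnorm : ‖(e.symm : E n →L[ℝ] E n)‖₊ ≤ s.toNNReal⁻¹ := by
      refine ContinuousLinearMap.opNNNorm_le_bound _ _ fun x => ?_
      have : (e.symm : E n →L[ℝ] E n) x = s⁻¹ • x := by
        rw [ContinuousLinearEquiv.coe_coe, ContinuousLinearEquiv.symm_apply_eq]
        change x = s • s⁻¹ • x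
        rw [smul_inv_smul₀ hs0.ne']
      rw [this, ← NNReal.coe_le_coe]
      simp [norm_smul, abs_of_pos hs0, hs0.le]
    have hpos : 0 < ‖(e.symm : E n →L[ℝ] E n)‖₊ := e.nnnorm_symm_pos
    have hs' : L < s.toNNReal := by
      rwa [Real.lt_toNNReal_iff_coe_lt]
    refine hs'.trans_le ?_
    rwa [le_inv_comm₀ (Real.toNNReal_pos.2 hs0) hpos]
  -- `F` is bijective and agrees with the dilation outside the ball, hence has the same image of it
  have himg : F '' Metric.closedBall (0 : E n) R
      = (fun x => s • x) '' Metric.closedBall (0 : E n) R := by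
    have hout : ∀ x, x ∉ Metric.closedBall (0 : E n) R → F x = s • x := by
      intro x hx
      have : h x = 0 := hR x (by simpa using hx)
      simp [hF, this]
    have hsm : Function.Bijective (fun x : E n => s • x) := e.bijective
    have h1 : F '' (Metric.closedBall (0 : E n) R)ᶜ
        = (fun x => s • x) '' (Metric.closedBall (0 : E n) R)ᶜ :=
      image_congr fun x hx => hout x hx
    rw [image_compl_eq ⟨hinj, hsurj⟩, image_compl_eq hsm] at h1
    exact compl_injective h1
  have hcv := integral_image_eq_integral_abs_det_fderiv_smul volume
    (Metric.isClosed_closedBall (x := (0 : E n)) (ε := R)).measurableSet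
    (fun x _ => (hd x).hasFDerivWithinAt) hinj.injOn (fun _ => (1 : ℝ))
  have hpos : ∀ x, 0 < (s • ContinuousLinearMap.id ℝ (E n) + fderiv ℝ h x).det := fun x =>
    det_smul_id_add_pos _ ((norm_fderiv_le_of_lipschitz ℝ hL).trans_lt hs)
  simp only [abs_of_pos (hpos _), smul_eq_mul, mul_one] at hcv
  rw [← hcv, himg]
  simp only [integral_const, smul_eq_mul, mul_one, MeasurableSet.univ, measureReal_restrict_apply,
    univ_inter]
  rw [image_smul, Measure.real, Measure.addHaar_smul]
  simp [Measure.real, abs_of_pos (pow_pos hs0 _), ENNReal.toReal_ofReal (pow_pos hs0 _).le]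

/-- The Jacobian determinant of a compactly supported map has integral zero. -/
theorem integral_det_fderiv_eq_zero {n : ℕ} (hn : n ≠ 0) {h : E n → E n} (hh : ContDiff ℝ 1 h)
    (hc : HasCompactSupport h) : ∫ x, (fderiv ℝ h x).det = 0 := by
  obtain ⟨L, hL⟩ := hh.lipschitzWith_of_hasCompactSupport hc one_ne_zero
  obtain ⟨R, hR⟩ := hc.isCompact.isBounded.subset_closedBall (0 : E n)
  have hR0 : ∀ x, R < ‖x‖ → h x = 0 := fun x hx => by
    by_contra h0
    have := hR (subset_tsupport _ h0)
    simp at this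
    linarith
  have hRd : ∀ x, x ∉ Metric.closedBall (0 : E n) R → (fderiv ℝ h x).det = 0 := fun x hx => by
    have : fderiv ℝ h x = 0 := by
      by_contra h0
      exact hx (hR (support_fderiv_subset ℝ h0))
    rw [this]
    have : Nonempty (Fin n) := ⟨⟨0, Nat.pos_of_ne_zero hn⟩⟩
    simp [ContinuousLinearMap.det]
  rw [← setIntegral_eq_integral_of_forall_compl_eq_zero hRd]
  -- nodes larger than the Lipschitz constant of `h`, so that each node gives a diffeomorphism
  obtain ⟨w, hw⟩ := det_eq_sum_weights (n := n) (v := fun i : ℕ => (L : ℝ) + 1 + i)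
    (fun i j hij => by simpa using hij)
  have hcont : ∀ s : ℝ, Continuous fun x =>
      (s • ContinuousLinearMap.id ℝ (E n) + fderiv ℝ h x).det := fun s =>
    ContinuousLinearMap.continuous_det.comp
      (continuous_const.add (hh.continuous_fderiv one_ne_zero))
  have hK := isCompact_closedBall (0 : E n) R
  simp_rw [fun x => hw (fderiv ℝ h x)]
  rw [integral_finsetSum _ fun i _ =>
    ((hcont _).continuousOn.integrableOn_compact hK).const_mul _]
  -- for `A = 0` the interpolation formula says that the weighted sum of the volumes vanishes
  have h0 := hw 0
  have hdet : ∀ s : ℝ, (s • ContinuousLinearMap.id ℝ (E n) + 0).det = s ^ n := fun s => by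
    simp [ContinuousLinearMap.det, LinearMap.det_smul]
  simp_rw [hdet] at h0
  have hz : (0 : E n →L[ℝ] E n).det = 0 := by
    simp [ContinuousLinearMap.det, LinearMap.det_zero, hn]
  rw [hz] at h0
  have : ∀ i : ℕ, (L : ℝ) < L + 1 + i := fun i => by have := i.cast_nonneg (α := ℝ); linarith
  calc _ = ∑ i ∈ Finset.range (n + 1), w i * ((L + 1 + i : ℝ) ^ n *
        volume.real (Metric.closedBall (0 : E n) R)) := by
        refine Finset.sum_congr rfl fun i _ => ?_
        rw [integral_const_mul, integral_det_smul_id_add_fderiv hh hL hR0 (this i)]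
    _ = (∑ i ∈ Finset.range (n + 1), w i * (L + 1 + i : ℝ) ^ n) *
        volume.real (Metric.closedBall (0 : E n) R) := by
        rw [Finset.sum_mul]; exact Finset.sum_congr rfl fun i _ => by ring
    _ = 0 := by rw [← h0, zero_mul]

theorem exists_abs_det_le (n : ℕ) :
    ∃ C : ℝ, 0 ≤ C ∧ ∀ A : E n →L[ℝ] E n, |A.det| ≤ C * ‖A‖ ^ n := by
  obtain ⟨C, hC⟩ := (isCompact_closedBall (0 : E n →L[ℝ] E n) 1).exists_bound_of_continuousOn
    (f := fun A : E n →L[ℝ] E n => A.det) ContinuousLinearMap.continuous_det.continuousOn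
  have hC0 : 0 ≤ C := (norm_nonneg _).trans (hC 0 (by simp))
  refine ⟨C, hC0, fun A => ?_⟩
  have hdet : ∀ t : ℝ, ∀ B : E n →L[ℝ] E n, (t • B).det = t ^ n * B.det := fun t B => by
    simp [ContinuousLinearMap.det, LinearMap.det_smul]
  rcases eq_or_ne A 0 with rfl | hA
  · rcases Nat.eq_zero_or_pos n with rfl | hn
    · simpa using hC 0 (by simp)
    · have := hdet 0 0
      rw [show (0 : ℝ) • (0 : E n →L[ℝ] E n) = 0 by ext; simp, zero_pow hn.ne', zero_mul] at this
      rw [this, abs_zero]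
      positivity
  · have hA' : ‖A‖ ≠ 0 := norm_ne_zero_iff.2 hA
    have h1 := hC (‖A‖⁻¹ • A) (by simp [norm_smul, hA'])
    rw [Real.norm_eq_abs, hdet, abs_mul, abs_of_nonneg (by positivity), inv_pow] at h1
    rwa [inv_mul_le_iff₀ (by positivity), mul_comm] at h1

/-- The Caccioppoli inequality: since `det D(η (F - c))` has integral zero, the integral of
`η ^ n det DF` only sees the set where `η` is not locally constant. -/
theorem exists_integral_pow_mul_det_le {n : ℕ} (hn : n ≠ 0) (M : ℝ) :
    ∃ C : ℝ, 0 ≤ C ∧ ∀ (η : E n → ℝ) (A : Set (E n)), ContDiff ℝ 1 η → HasCompactSupport η →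
      (∀ x, |η x| ≤ 1) → (∀ x, ‖fderiv ℝ η x‖ ≤ M) → MeasurableSet A → Bornology.IsBounded A →
      (∀ x ∉ A, fderiv ℝ η x = 0) → ∀ (F : E n → E n) (c : E n), ContDiff ℝ 1 F →
      ∫ x, η x ^ n * (fderiv ℝ F x).det
        ≤ C * ((∫ x in A, ‖fderiv ℝ F x‖ ^ n) + ∫ x in A, ‖F x - c‖ ^ n) := by
  obtain ⟨C, hC0, hC⟩ := exists_abs_det_le n
  refine ⟨C * (1 + 2 ^ (n - 1) * (1 + |M| ^ n)), by positivity, ?_⟩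
  intro η A hη hηc hη1 hηM hA hAb hηA F c hF
  set h : E n → E n := fun x => η x • (F x - c) with hh
  have hFc : ContDiff ℝ 1 fun x => F x - c := hF.sub contDiff_const
  have hhd : ContDiff ℝ 1 h := hη.smul hFc
  have hhc : HasCompactSupport h := hηc.smul_right
  have hD : ∀ x, fderiv ℝ h x = η x • fderiv ℝ F x + (fderiv ℝ η x).smulRight (F x - c) := by
    intro x
    have h1 : HasFDerivAt h _ x := ((hη.differentiable one_ne_zero) x).hasFDerivAt.smul
      ((hFc.differentiable one_ne_zero) x).hasFDerivAt
    rw [h1.fderiv, fderiv_sub_const]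
  have hdet : ∀ t : ℝ, ∀ B : E n →L[ℝ] E n, (t • B).det = t ^ n * B.det := fun t B => by
    simp [ContinuousLinearMap.det, LinearMap.det_smul]
  have hcF : Continuous fun x => fderiv ℝ F x := hF.continuous_fderiv one_ne_zero
  have hch : Continuous fun x => (fderiv ℝ h x).det :=
    ContinuousLinearMap.continuous_det.comp (hhd.continuous_fderiv one_ne_zero)
  have hcη : Continuous fun x => η x ^ n * (fderiv ℝ F x).det :=
    (hη.continuous.pow n).mul (ContinuousLinearMap.continuous_det.comp hcF)
  have hz : (0 : E n →L[ℝ] E n).det = 0 := by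
    simp [ContinuousLinearMap.det, LinearMap.det_zero, hn]
  have hi1 : Integrable fun x => η x ^ n * (fderiv ℝ F x).det := by
    refine hcη.integrable_of_hasCompactSupport ?_
    refine HasCompactSupport.mul_right ?_
    exact hηc.comp_left (g := fun t : ℝ => t ^ n) (zero_pow hn)
  have hi2 : Integrable fun x => (fderiv ℝ h x).det :=
    hch.integrable_of_hasCompactSupport
      ((hhc.fderiv ℝ).comp_left (g := fun B : E n →L[ℝ] E n => B.det) hz)
  have hint : ∀ {G : E n → ℝ}, Continuous G → IntegrableOn G A := fun hG =>
    (hG.continuousOn.integrableOn_compact hAb.isCompact_closure).mono_set subset_closure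
  have hi3 : IntegrableOn (fun x => ‖fderiv ℝ F x‖ ^ n) A := hint (hcF.norm.pow n)
  have hi4 : IntegrableOn (fun x => ‖F x - c‖ ^ n) A := hint (hFc.continuous.norm.pow n)
  have hout : ∀ x ∉ A, η x ^ n * (fderiv ℝ F x).det - (fderiv ℝ h x).det = 0 := fun x hx => by
    rw [hD, hηA x hx, ← hdet]
    simp
  calc ∫ x, η x ^ n * (fderiv ℝ F x).det
      = ∫ x, (η x ^ n * (fderiv ℝ F x).det - (fderiv ℝ h x).det) := by
        rw [integral_sub hi1 hi2, integral_det_fderiv_eq_zero hn hhd hhc, sub_zero]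
    _ = ∫ x in A, (η x ^ n * (fderiv ℝ F x).det - (fderiv ℝ h x).det) :=
        (setIntegral_eq_integral_of_forall_compl_eq_zero hout).symm
    _ ≤ ∫ x in A, C * (1 + 2 ^ (n - 1) * (1 + |M| ^ n)) *
          (‖fderiv ℝ F x‖ ^ n + ‖F x - c‖ ^ n) := by
        refine integral_mono (hi1.sub hi2).integrableOn ((hi3.add hi4).const_mul _) fun x => ?_
        have b1 : η x ^ n * (fderiv ℝ F x).det ≤ C * ‖fderiv ℝ F x‖ ^ n := by
          refine (le_abs_self _).trans ?_
          rw [abs_mul, abs_pow]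
          calc |η x| ^ n * |(fderiv ℝ F x).det| ≤ 1 * (C * ‖fderiv ℝ F x‖ ^ n) :=
                mul_le_mul (pow_le_one₀ (abs_nonneg _) (hη1 x)) (hC _) (abs_nonneg _) zero_le_one
            _ = _ := one_mul _
        have b2 : ‖fderiv ℝ h x‖ ≤ ‖fderiv ℝ F x‖ + |M| * ‖F x - c‖ := by
          rw [hD]
          refine (norm_add_le _ _).trans (add_le_add ?_ ?_)
          · rw [norm_smul]
            exact mul_le_of_le_one_left (norm_nonneg _) (hη1 x)
          · rw [ContinuousLinearMap.norm_smulRight_apply]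
            gcongr
            exact (hηM x).trans (le_abs_self M)
        have b3 : -(fderiv ℝ h x).det ≤
            C * (2 ^ (n - 1) * (‖fderiv ℝ F x‖ ^ n + (|M| * ‖F x - c‖) ^ n)) := by
          refine (neg_le_abs _).trans ((hC _).trans ?_)
          gcongr
          exact (pow_le_pow_left₀ (norm_nonneg _) b2 n).trans
            (add_pow_le (norm_nonneg _) (by positivity) n)
        have e1 : 0 ≤ ‖fderiv ℝ F x‖ ^ n := by positivity
        have e2 : 0 ≤ ‖F x - c‖ ^ n := by positivity
        have e3 : 0 ≤ |M| ^ n := by positivity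
        have e4 : 0 ≤ C * ‖F x - c‖ ^ n := mul_nonneg hC0 e2
        have e5 : 0 ≤ C * (2 ^ (n - 1) * ‖F x - c‖ ^ n) := by positivity
        have e6 : 0 ≤ C * (2 ^ (n - 1) * (|M| ^ n * ‖fderiv ℝ F x‖ ^ n)) := by positivity
        rw [mul_pow] at b3
        simp only
        linarith
    _ = _ := by rw [integral_const_mul, integral_add hi3 hi4]

/-! ### A Poincaré inequality by chaining -/

theorem ennreal_add_pow_le (a b : ℝ≥0∞) (p : ℕ) : (a + b) ^ p ≤ 2 ^ p * (a ^ p + b ^ p) := by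
  have h1 : a + b ≤ 2 * max a b := by
    rw [two_mul]; exact add_le_add (le_max_left _ _) (le_max_right _ _)
  calc (a + b) ^ p ≤ (2 * max a b) ^ p := by gcongr
    _ = 2 ^ p * (max a b) ^ p := mul_pow _ _ _
    _ ≤ 2 ^ p * (a ^ p + b ^ p) := by
      gcongr
      rcases max_choice a b with h | h <;> rw [h]
      · exact le_self_add
      · exact le_add_self

theorem enorm_sub_pow_le {G : Type*} [NormedAddCommGroup G] (a b c : G) (p : ℕ) :
    ‖a - b‖ₑ ^ p ≤ 2 ^ p * (‖a - c‖ₑ ^ p + ‖c - b‖ₑ ^ p) := by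
  have h : ‖a - b‖ₑ ≤ ‖a - c‖ₑ + ‖c - b‖ₑ := by
    rw [← sub_add_sub_cancel a c b]; exact enorm_add_le (a - c) (c - b)
  calc ‖a - b‖ₑ ^ p ≤ (‖a - c‖ₑ + ‖c - b‖ₑ) ^ p := by gcongr
    _ ≤ _ := ennreal_add_pow_le _ _ _

/-- Jensen's inequality for `t ↦ t ^ p` on a probability space. -/
theorem lintegral_enorm_pow_le {α G : Type*} [MeasurableSpace α] [NormedAddCommGroup G]
    (ν : Measure α) [IsProbabilityMeasure ν] {g : α → G} (hg : AEStronglyMeasurable g ν)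
    {p : ℕ} (hp : p ≠ 0) : (∫⁻ x, ‖g x‖ₑ ∂ν) ^ p ≤ ∫⁻ x, ‖g x‖ₑ ^ p ∂ν := by
  have hp1 : (1 : ℝ) ≤ p := by exact_mod_cast Nat.one_le_iff_ne_zero.2 hp
  have h := eLpNorm'_le_eLpNorm'_of_exponent_le zero_lt_one hp1 ν hg
  simp only [eLpNorm', ENNReal.rpow_one, one_div, inv_one, ENNReal.rpow_natCast] at h
  calc (∫⁻ x, ‖g x‖ₑ ∂ν) ^ p ≤ ((∫⁻ x, ‖g x‖ₑ ^ p ∂ν) ^ (p : ℝ)⁻¹) ^ p := by gcongr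
    _ = _ := by rw [← ENNReal.rpow_natCast, ← ENNReal.rpow_mul,
                  inv_mul_cancel₀ (by positivity), ENNReal.rpow_one]

theorem lintegral_comp_add_smul {n : ℕ} (g : E n → ℝ≥0∞) (hg : Measurable g) (x₀ : E n) {t : ℝ}
    (ht : t ≠ 0) :
    ∫⁻ y, g (x₀ + t • y) = ENNReal.ofReal |(t ^ n)⁻¹| * ∫⁻ y, g y := by
  have h1 : Measurable fun y => g (x₀ + y) := hg.comp (measurable_const_add x₀)
  rw [← lintegral_map (f := fun y => g (x₀ + y)) (g := fun y : E n => t • y) h1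
    (measurable_const_smul t), Measure.map_addHaar_smul volume ht, lintegral_smul_measure,
    lintegral_add_left_eq_self]
  simp

/-- The `p`-th power mean oscillation of `F` between two sets. -/
noncomputable def oscIntegral {n : ℕ} (p : ℕ) (F : E n → E n) (U V : Set (E n)) : ℝ≥0∞ :=
  ∫⁻ x in U, ∫⁻ y in V, ‖F x - F y‖ₑ ^ p

/-- The fundamental theorem of calculus along a segment, with Jensen's inequality. -/
theorem enorm_sub_pow_le_lintegral_segment {n p : ℕ} (hp : p ≠ 0) {F : E n → E n}
    (hF : ContDiff ℝ 1 F) (x y : E n) :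
    ‖F x - F y‖ₑ ^ p ≤ ‖x - y‖ₑ ^ p *
      ∫⁻ t in Ioc (0 : ℝ) 1, ‖fderiv ℝ F ((1 - t) • x + t • y)‖ₑ ^ p := by
  have hcF := hF.continuous_fderiv one_ne_zero
  have hpath : ∀ t : ℝ, HasDerivAt (fun t : ℝ => (1 - t) • x + t • y) (y - x) t := fun t => by
    have h1 : HasDerivAt (fun t : ℝ => x + t • (y - x)) ((1 : ℝ) • (y - x)) t :=
      ((hasDerivAt_id t).smul_const (y - x)).const_add x
    rw [one_smul] at h1
    convert h1 using 1
    funext s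
    module
  have hd : ∀ t : ℝ, HasDerivAt (fun t : ℝ => F ((1 - t) • x + t • y))
      (fderiv ℝ F ((1 - t) • x + t • y) (y - x)) t := fun t =>
    ((hF.differentiable one_ne_zero) _).hasFDerivAt.comp_hasDerivAt t (hpath t)
  have hc : Continuous fun t : ℝ => fderiv ℝ F ((1 - t) • x + t • y) :=
    hcF.comp (by fun_prop)
  have hi := intervalIntegral.integral_eq_sub_of_hasDerivAt (a := 0) (b := 1) (fun t _ => hd t)
    ((hc.clm_apply continuous_const).intervalIntegrable 0 1)
  rw [intervalIntegral.integral_of_le zero_le_one] at hi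
  simp only [sub_self, zero_smul, one_smul, zero_add, sub_zero, add_zero] at hi
  have h1 : ‖F x - F y‖ₑ ≤ ‖x - y‖ₑ * ∫⁻ t in Ioc (0 : ℝ) 1,
      ‖fderiv ℝ F ((1 - t) • x + t • y)‖ₑ := by
    rw [← enorm_neg, neg_sub, ← hi, ← lintegral_const_mul' _ _ enorm_ne_top]
    refine (enorm_integral_le_lintegral_enorm _).trans (lintegral_mono fun t => ?_)
    rw [mul_comm, ← enorm_neg (x - y), neg_sub]
    exact ContinuousLinearMap.le_opENorm _ _
  have : IsProbabilityMeasure (volume.restrict (Ioc (0 : ℝ) 1)) := ⟨by simp⟩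
  calc ‖F x - F y‖ₑ ^ p ≤ (‖x - y‖ₑ * ∫⁻ t in Ioc (0 : ℝ) 1,
      ‖fderiv ℝ F ((1 - t) • x + t • y)‖ₑ) ^ p := by gcongr
    _ ≤ _ := by
      rw [mul_pow]
      gcongr
      exact lintegral_enorm_pow_le _ hc.aestronglyMeasurable hp

/-- A change of variables by a homothety of ratio at least `1 / 2`, which costs at most the factor
`2 ^ n`. -/
theorem setLIntegral_comp_add_smul_le {n : ℕ} {U : Set (E n)} (hU : MeasurableSet U)
    {g : E n → ℝ≥0∞} (hg : Measurable g) {x₀ : E n} {t : ℝ} (ht : 1 / 2 ≤ t)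
    (hmaps : ∀ y ∈ U, x₀ + t • y ∈ U) :
    ∫⁻ y in U, g (x₀ + t • y) ≤ 2 ^ n * ∫⁻ y in U, g y := by
  have ht0 : 0 < t := by linarith
  calc ∫⁻ y in U, g (x₀ + t • y) ≤ ∫⁻ y, U.indicator g (x₀ + t • y) := by
        rw [← lintegral_indicator hU]
        refine lintegral_mono fun y => ?_
        by_cases hy : y ∈ U
        · rw [indicator_of_mem hy, indicator_of_mem (hmaps y hy)]
        · rw [indicator_of_notMem hy]; exact zero_le
    _ = ENNReal.ofReal |(t ^ n)⁻¹| * ∫⁻ y in U, g y := by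
        rw [lintegral_comp_add_smul _ (hg.indicator hU) _ ht0.ne', lintegral_indicator hU]
    _ ≤ _ := by
        gcongr
        rw [abs_of_pos (by positivity), ← inv_pow,
          show (2 : ℝ≥0∞) ^ n = ENNReal.ofReal (2 ^ n) by
            rw [ENNReal.ofReal_pow (by norm_num)]; simp]
        refine ENNReal.ofReal_le_ofReal (pow_le_pow_left₀ (by positivity) ?_ n)
        rw [inv_le_comm₀ ht0 two_pos]
        linarith

/-- The Poincaré inequality on a convex set, by integration over the segments joining its points. -/
theorem oscIntegral_self_le_of_convex {n p : ℕ} (hp : p ≠ 0) {U : Set (E n)} (hU : Convex ℝ U)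
    (hUm : MeasurableSet U) {d : ℝ≥0} (hd : ∀ x ∈ U, ∀ y ∈ U, ‖x - y‖ₑ ≤ d) {F : E n → E n}
    (hF : ContDiff ℝ 1 F) :
    oscIntegral p F U U ≤ d ^ p * (2 ^ n * (volume U * ∫⁻ x in U, ‖fderiv ℝ F x‖ₑ ^ p)) := by
  have hcF := hF.continuous_fderiv one_ne_zero
  set g : E n → ℝ≥0∞ := fun x => ‖fderiv ℝ F x‖ₑ ^ p with hg
  have hgm : Measurable g := (hcF.enorm.measurable).pow_const p
  have hm3 : Measurable fun q : (E n × E n) × ℝ => g ((1 - q.2) • q.1.1 + q.2 • q.1.2) :=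
    hgm.comp (by fun_prop)
  have hseg : ∀ t ∈ Ioc (0 : ℝ) 1, ∀ x ∈ U, ∀ y ∈ U, (1 - t) • x + t • y ∈ U :=
    fun t ht x hx y hy =>
    hU hx hy (by linarith [ht.2]) ht.1.le (by ring)
  have key : ∀ t ∈ Ioc (0 : ℝ) 1,
      ∫⁻ x in U, ∫⁻ y in U, g ((1 - t) • x + t • y) ≤ 2 ^ n * (volume U * ∫⁻ x in U, g x) := by
    intro t ht
    have hm2 : Measurable fun q : E n × E n => g ((1 - t) • q.1 + t • q.2) :=
      hgm.comp (by fun_prop)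
    have hcst : ∫⁻ _ in U, (2 ^ n * ∫⁻ y in U, g y) = 2 ^ n * (volume U * ∫⁻ x in U, g x) := by
      rw [setLIntegral_const]; ring
    -- in the variable whose coefficient is at least `1 / 2`, the map to the segment point is
    -- a homothety
    rcases le_total (1 / 2) t with h | h
    · rw [← hcst]
      refine setLIntegral_mono' hUm fun x hx => ?_
      exact setLIntegral_comp_add_smul_le hUm hgm h fun y hy => hseg t ht x hx y hy
    · rw [lintegral_lintegral_swap hm2.aemeasurable, ← hcst]
      refine setLIntegral_mono' hUm fun y hy => ?_
      simp_rw [add_comm _ (t • y)]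
      refine setLIntegral_comp_add_smul_le hUm hgm (by linarith) fun x hx => ?_
      rw [add_comm]
      exact hseg t ht x hx y hy
  calc oscIntegral p F U U
      ≤ ∫⁻ x in U, ∫⁻ y in U, d ^ p * ∫⁻ t in Ioc (0 : ℝ) 1, g ((1 - t) • x + t • y) := by
        refine setLIntegral_mono' hUm fun x hx => setLIntegral_mono' hUm fun y hy => ?_
        refine (enorm_sub_pow_le_lintegral_segment hp hF x y).trans ?_
        gcongr
        exact hd x hx y hy
    _ = d ^ p * ∫⁻ x in U, ∫⁻ y in U, ∫⁻ t in Ioc (0 : ℝ) 1, g ((1 - t) • x + t • y) := by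
        have : (d : ℝ≥0∞) ^ p ≠ ⊤ := by finiteness
        rw [← lintegral_const_mul' _ _ this]
        congr with x
        rw [← lintegral_const_mul' _ _ this]
    _ = d ^ p * ∫⁻ t in Ioc (0 : ℝ) 1, ∫⁻ x in U, ∫⁻ y in U, g ((1 - t) • x + t • y) := by
        congr 1
        have h1 : ∀ x, ∫⁻ y in U, ∫⁻ t in Ioc (0 : ℝ) 1, g ((1 - t) • x + t • y)
            = ∫⁻ t in Ioc (0 : ℝ) 1, ∫⁻ y in U, g ((1 - t) • x + t • y) := fun x =>
          lintegral_lintegral_swap (Measurable.aemeasurable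
            (hgm.comp (by fun_prop : Measurable fun q : E n × ℝ => (1 - q.2) • x + q.2 • q.1)))
        simp_rw [h1]
        refine lintegral_lintegral_swap (Measurable.aemeasurable ?_)
        exact Measurable.lintegral_prod_right' (f := fun q : (E n × ℝ) × E n =>
          g ((1 - q.1.2) • q.1.1 + q.1.2 • q.2)) (hgm.comp (by fun_prop))
    _ ≤ d ^ p * ∫⁻ t in Ioc (0 : ℝ) 1, 2 ^ n * (volume U * ∫⁻ x in U, g x) := by
        exact mul_le_mul' le_rfl (setLIntegral_mono' measurableSet_Ioc key)
    _ = _ := by simp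

theorem oscIntegral_mono {n p : ℕ} (F : E n → E n) {U V U' V' : Set (E n)} (hU : U ⊆ U')
    (hV : V ⊆ V') : oscIntegral p F U V ≤ oscIntegral p F U' V' := by
  refine (lintegral_mono fun x => ?_).trans (lintegral_mono_set hU)
  exact lintegral_mono_set hV

/-- Oscillation integrals chain through an intermediate set of positive measure. -/
theorem volume_mul_oscIntegral_le {n p : ℕ} {F : E n → E n} (hF : Continuous F)
    (U V W : Set (E n)) :
    volume W * oscIntegral p F U V ≤
      2 ^ p * (volume V * oscIntegral p F U W + volume U * oscIntegral p F W V) := by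
  have hm : Measurable fun q : E n × E n => ‖F q.1 - F q.2‖ₑ ^ p :=
    ((hF.comp continuous_fst).sub (hF.comp continuous_snd)).enorm.measurable.pow_const p
  have hm1 : ∀ x, Measurable fun y => ‖F x - F y‖ₑ ^ p := fun x =>
    (continuous_const.sub hF).enorm.measurable.pow_const p
  have hm2 : ∀ x, Measurable fun y => ‖F y - F x‖ₑ ^ p := fun x =>
    (hF.sub continuous_const).enorm.measurable.pow_const p
  have hmi : ∀ S : Set (E n), Measurable fun x => ∫⁻ y in S, ‖F x - F y‖ₑ ^ p := fun S =>
    hm.lintegral_prod_right'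
  have hswap : ∫⁻ y in V, ∫⁻ z in W, ‖F z - F y‖ₑ ^ p = oscIntegral p F W V :=
    lintegral_lintegral_swap (f := fun y z => ‖F z - F y‖ₑ ^ p)
      (hm.comp measurable_swap).aemeasurable
  have h1 : volume W * oscIntegral p F U V
      = ∫⁻ x in U, ∫⁻ y in V, ∫⁻ _ in W, ‖F x - F y‖ₑ ^ p := by
    rw [oscIntegral, ← lintegral_const_mul _ (hmi V)]
    refine lintegral_congr fun x => ?_
    rw [← lintegral_const_mul _ (hm1 x)]
    refine lintegral_congr fun y => ?_
    rw [setLIntegral_const, mul_comm]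
  have h2 : ∀ x y, ∫⁻ _ in W, ‖F x - F y‖ₑ ^ p ≤
      2 ^ p * ((∫⁻ z in W, ‖F x - F z‖ₑ ^ p) + ∫⁻ z in W, ‖F z - F y‖ₑ ^ p) := fun x y => by
    rw [← lintegral_add_left (hm1 x), ← lintegral_const_mul' _ _ (by finiteness)]
    exact lintegral_mono fun z => enorm_sub_pow_le _ _ _ _
  have h3 : ∀ x, ∫⁻ y in V, 2 ^ p * ((∫⁻ z in W, ‖F x - F z‖ₑ ^ p)
      + ∫⁻ z in W, ‖F z - F y‖ₑ ^ p)
      = 2 ^ p * (volume V * (∫⁻ z in W, ‖F x - F z‖ₑ ^ p) + oscIntegral p F W V) := fun x => by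
    rw [lintegral_const_mul' _ _ (by finiteness), lintegral_add_left measurable_const,
      setLIntegral_const, mul_comm (volume V), hswap]
  have h4 : ∫⁻ x in U, 2 ^ p * (volume V * (∫⁻ z in W, ‖F x - F z‖ₑ ^ p) + oscIntegral p F W V)
      = 2 ^ p * (volume V * oscIntegral p F U W + volume U * oscIntegral p F W V) := by
    rw [lintegral_const_mul' _ _ (by finiteness), lintegral_add_right _ measurable_const,
      setLIntegral_const, lintegral_const_mul _ (hmi W), mul_comm (volume U)]
    rfl
  rw [h1, ← h4]
  refine lintegral_mono fun x => ?_
  rw [← h3 x]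
  exact lintegral_mono fun y => h2 x y

/-! ### The Poincaré inequality on cubical annuli -/

/-- The open cube (ball of the maximum norm) with centre `a` and half side length `r`. -/
def cube {n : ℕ} (a : E n) (r : ℝ) : Set (E n) := {x | ∀ i, |x i - a i| < r}

/-- The cubical annulus of outer and inner half side lengths `4 r` and `r`. -/
def annulus {n : ℕ} (a : E n) (r : ℝ) : Set (E n) := cube a (4 * r) \ cube a r

/-- The part of the unit cubical annulus that lies beyond the face `s * x i = 1`. -/
def slab {n : ℕ} (i : Fin n) (s : ℝ) : Set (E n) := {x | x ∈ cube 0 4 ∧ 1 ≤ s * x i}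

theorem isOpen_cube {n : ℕ} (a : E n) (r : ℝ) : IsOpen (cube a r) := by
  have : cube a r = ⋂ i, {x : E n | |x i - a i| < r} := by ext; simp [cube]
  rw [this]
  exact isOpen_iInter_of_finite fun i => isOpen_lt (by fun_prop) continuous_const

theorem measurableSet_cube {n : ℕ} (a : E n) (r : ℝ) : MeasurableSet (cube a r) :=
  (isOpen_cube a r).measurableSet

theorem measurableSet_annulus {n : ℕ} (a : E n) (r : ℝ) : MeasurableSet (annulus a r) :=
  (measurableSet_cube _ _).diff (measurableSet_cube _ _)

theorem cube_mono {n : ℕ} (a : E n) {r s : ℝ} (h : r ≤ s) : cube a r ⊆ cube a s :=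
  fun _ hx i => (hx i).trans_le h

theorem ball_subset_cube {n : ℕ} (a : E n) (r : ℝ) : Metric.ball a r ⊆ cube a r := by
  intro x hx i
  rw [mem_ball_iff_norm] at hx
  exact (PiLp.norm_apply_le (x - a) i).trans_lt hx

theorem cube_subset_closedBall {n : ℕ} (a : E n) {r : ℝ} (hr : 0 ≤ r) :
    cube a r ⊆ Metric.closedBall a (√n * r) := by
  intro x hx
  rw [mem_closedBall_iff_norm, EuclideanSpace.norm_eq]
  have h : ∑ i, ‖(x - a) i‖ ^ 2 ≤ n * r ^ 2 := by
    calc ∑ i, ‖(x - a) i‖ ^ 2 ≤ ∑ _i : Fin n, r ^ 2 :=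
          Finset.sum_le_sum fun i _ => pow_le_pow_left₀ (norm_nonneg _) (hx i).le 2
      _ = n * r ^ 2 := by simp
  calc √(∑ i, ‖(x - a) i‖ ^ 2) ≤ √(n * r ^ 2) := Real.sqrt_le_sqrt h
    _ = √n * r := by rw [Real.sqrt_mul (Nat.cast_nonneg n), Real.sqrt_sq hr]

theorem isBounded_cube {n : ℕ} (a : E n) (r : ℝ) : Bornology.IsBounded (cube a r) :=
  (Metric.isBounded_closedBall.subset (cube_subset_closedBall a (abs_nonneg r))).subset
    (cube_mono a (le_abs_self r))

theorem convex_slab {n : ℕ} (i : Fin n) (s : ℝ) : Convex ℝ (slab i s) := by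
  intro x hx y hy a b ha hb hab
  refine ⟨fun j => ?_, ?_⟩
  · have h1 := abs_lt.1 (hx.1 j)
    have h2 := abs_lt.1 (hy.1 j)
    simp only [PiLp.zero_apply, sub_zero, PiLp.add_apply, PiLp.smul_apply, smul_eq_mul] at h1 h2 ⊢
    rw [abs_lt]
    rcases ha.eq_or_lt with rfl | ha'
    · have : b = 1 := by linarith
      subst this; constructor <;> linarith
    · have hb' : b = 1 - a := by linarith
      subst hb'
      constructor <;> nlinarith
  · have h1 := hx.2
    have h2 := hy.2
    simp only [PiLp.add_apply, PiLp.smul_apply, smul_eq_mul]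
    have hb' : b = 1 - a := by linarith
    subst hb'
    nlinarith

theorem measurableSet_slab {n : ℕ} (i : Fin n) (s : ℝ) : MeasurableSet (slab i s) :=
  (measurableSet_cube 0 4).inter
    (isClosed_le continuous_const (by fun_prop : Continuous fun x : E n => s * x i)).measurableSet

theorem slab_subset_annulus {n : ℕ} (i : Fin n) {s : ℝ} (hs : |s| ≤ 1) :
    slab i s ⊆ annulus 0 1 := by
  intro x hx
  refine ⟨by simpa using hx.1, fun h => ?_⟩
  have h1 := h i
  simp only [PiLp.zero_apply, sub_zero] at h1
  have h2 : s * x i ≤ |s| * |x i| := (le_abs_self _).trans (abs_mul _ _).le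
  have h3 := hx.2
  nlinarith [abs_nonneg (x i), abs_nonneg s]

theorem annulus_subset_iUnion_slab {n : ℕ} :
    annulus (0 : E n) 1 ⊆ ⋃ q : Fin n × Bool, slab q.1 (if q.2 then 1 else -1) := by
  intro x hx
  have h1 : ¬ ∀ i, |x i - (0 : E n) i| < 1 := hx.2
  push Not at h1
  obtain ⟨i, hi⟩ := h1
  have h4 : x ∈ cube (0 : E n) 4 := by simpa using hx.1
  simp only [PiLp.zero_apply, sub_zero] at hi
  rw [mem_iUnion]
  rcases le_abs.1 hi with h | h
  · exact ⟨(i, true), h4, by simpa using h⟩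
  · exact ⟨(i, false), h4, by simpa using h⟩

theorem volume_cube_lt_top {n : ℕ} (a : E n) (r : ℝ) : volume (cube a r) < ⊤ :=
  (isBounded_cube a r).measure_lt_top

theorem volume_slab_lt_top {n : ℕ} (i : Fin n) (s : ℝ) : volume (slab i s) < ⊤ :=
  (measure_mono fun _ h => h.1).trans_lt (volume_cube_lt_top 0 4)

theorem volume_slab_inter_slab_pos {n : ℕ} {i j : Fin n} {s t : ℝ} (hs : |s| = 1) (ht : |t| = 1)
    (hij : i ≠ j) : volume (slab i s ∩ slab j t) ≠ 0 := by
  set O : Set (E n) := cube 0 4 ∩ ({x | 1 < s * x i} ∩ {x | 1 < t * x j}) with hO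
  have hOo : IsOpen O := (isOpen_cube 0 4).inter
    ((isOpen_lt continuous_const (by fun_prop)).inter (isOpen_lt continuous_const (by fun_prop)))
  have hne : O.Nonempty := by
    have hs2 : s * s = 1 := by rw [← abs_mul_abs_self, hs, one_mul]
    have ht2 : t * t = 1 := by rw [← abs_mul_abs_self, ht, one_mul]
    refine ⟨WithLp.toLp 2 fun k => if k = i then 2 * s else if k = j then 2 * t else 0,
      fun k => ?_, ?_, ?_⟩
    · simp only [PiLp.zero_apply, sub_zero]
      split_ifs <;> simp [abs_mul, hs, ht] <;> norm_num
    · simp only [mem_ofPred_eq, if_true]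
      nlinarith
    · simp only [mem_ofPred_eq, if_true, if_neg hij.symm]
      nlinarith
  refine ne_of_gt ((hOo.measure_pos volume hne).trans_le (measure_mono ?_))
  exact fun x hx => ⟨⟨hx.1, hx.2.1.le⟩, ⟨hx.1, hx.2.2.le⟩⟩

/-- The oscillation of `C¹` maps between `U` and `V` is controlled by the energy on `A`. -/
def OscControlled {n : ℕ} (p : ℕ) (A U V : Set (E n)) : Prop :=
  ∃ C : ℝ≥0, ∀ F : E n → E n, ContDiff ℝ 1 F →
    oscIntegral p F U V ≤ C * ∫⁻ x in A, ‖fderiv ℝ F x‖ₑ ^ p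

theorem OscControlled.mono {n p : ℕ} {A U V U' V' : Set (E n)} (h : OscControlled p A U' V')
    (hU : U ⊆ U') (hV : V ⊆ V') : OscControlled p A U V := by
  obtain ⟨C, hC⟩ := h
  exact ⟨C, fun F hF => (oscIntegral_mono F hU hV).trans (hC F hF)⟩

theorem OscControlled.trans {n p : ℕ} {A U V W : Set (E n)} (h₁ : OscControlled p A U W)
    (h₂ : OscControlled p A W V) (hU : volume U ≠ ⊤) (hV : volume V ≠ ⊤) (hW : volume W ≠ 0)
    (hW' : volume W ≠ ⊤) : OscControlled p A U V := by
  obtain ⟨C₁, h₁⟩ := h₁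
  obtain ⟨C₂, h₂⟩ := h₂
  set K : ℝ≥0∞ := (volume W)⁻¹ * (2 ^ p * (volume V * C₁ + volume U * C₂)) with hK
  have hKt : K ≠ ⊤ := by finiteness
  refine ⟨K.toNNReal, fun F hF => ?_⟩
  rw [ENNReal.coe_toNNReal hKt]
  set G := ∫⁻ x in A, ‖fderiv ℝ F x‖ₑ ^ p
  calc oscIntegral p F U V = (volume W)⁻¹ * (volume W * oscIntegral p F U V) := by
        rw [← mul_assoc, ENNReal.inv_mul_cancel hW hW', one_mul]
    _ ≤ (volume W)⁻¹ * (2 ^ p * (volume V * (C₁ * G) + volume U * (C₂ * G))) := by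
        refine mul_le_mul' le_rfl ((volume_mul_oscIntegral_le hF.continuous U V W).trans ?_)
        gcongr
        · exact h₁ F hF
        · exact h₂ F hF
    _ = K * G := by rw [hK]; ring

theorem OscControlled.iUnion {n p : ℕ} {ι : Type*} [Fintype ι] {A : Set (E n)} {U : ι → Set (E n)}
    (h : ∀ i j, OscControlled p A (U i) (U j)) : OscControlled p A (⋃ i, U i) (⋃ i, U i) := by
  choose C hC using h
  refine ⟨∑ i, ∑ j, C i j, fun F hF => ?_⟩
  have h1 : ∀ x, ∫⁻ y in ⋃ j, U j, ‖F x - F y‖ₑ ^ p ≤ ∑ j, ∫⁻ y in U j, ‖F x - F y‖ₑ ^ p :=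
    fun x => (lintegral_iUnion_le U _).trans_eq (tsum_fintype _)
  have hm : ∀ j, Measurable fun x => ∫⁻ y in U j, ‖F x - F y‖ₑ ^ p := fun j =>
    Measurable.lintegral_prod_right' (f := fun q : E n × E n => ‖F q.1 - F q.2‖ₑ ^ p)
      (((hF.continuous.comp continuous_fst).sub
        (hF.continuous.comp continuous_snd)).enorm.measurable.pow_const p)
  calc oscIntegral p F (⋃ i, U i) (⋃ i, U i)
      ≤ ∑ i, ∫⁻ x in U i, ∑ j, ∫⁻ y in U j, ‖F x - F y‖ₑ ^ p :=
        (lintegral_mono h1).trans ((lintegral_iUnion_le U _).trans_eq (tsum_fintype _))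
    _ = ∑ i, ∑ j, oscIntegral p F (U i) (U j) := by
        refine Finset.sum_congr rfl fun i _ => ?_
        rw [lintegral_finsetSum _ fun j _ => hm j]
        rfl
    _ ≤ ∑ i, ∑ j, C i j * ∫⁻ x in A, ‖fderiv ℝ F x‖ₑ ^ p :=
        Finset.sum_le_sum fun i _ => Finset.sum_le_sum fun j _ => hC i j F hF
    _ = _ := by
        push_cast
        simp_rw [Finset.sum_mul]

theorem oscControlled_slab_self {n p : ℕ} (hp : p ≠ 0) (i : Fin n) {s : ℝ} (hs : |s| = 1) :
    OscControlled p (annulus 0 1) (slab i s) (slab i s) := by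
  obtain ⟨R, hR⟩ := (Metric.isBounded_iff_nndist.1 (isBounded_cube (0 : E n) 4))
  have hv : volume (slab i s) ≠ ⊤ := (volume_slab_lt_top i s).ne
  refine ⟨R ^ p * (2 ^ n * (volume (slab i s)).toNNReal), fun F hF => ?_⟩
  have hd : ∀ x ∈ slab i s, ∀ y ∈ slab i s, ‖x - y‖ₑ ≤ R := fun x hx y hy => by
    have := hR hx.1 hy.1
    rw [nndist_eq_nnnorm] at this
    exact_mod_cast this
  refine (oscIntegral_self_le_of_convex hp (convex_slab i s) (measurableSet_slab i s)
    hd hF).trans ?_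
  push_cast
  rw [ENNReal.coe_toNNReal hv, mul_assoc, mul_assoc]
  gcongr
  exact slab_subset_annulus i hs.le

theorem oscControlled_slab {n p : ℕ} (hn : 2 ≤ n) (hp : p ≠ 0) (i j : Fin n) {s t : ℝ}
    (hs : |s| = 1) (ht : |t| = 1) : OscControlled p (annulus 0 1) (slab i s) (slab j t) := by
  have hne : ∀ {i j : Fin n} {s t : ℝ}, |s| = 1 → |t| = 1 → i ≠ j →
      OscControlled p (annulus 0 1) (slab i s) (slab j t) := fun {i j s t} hs ht hij =>
    ((oscControlled_slab_self hp i hs).mono subset_rfl inter_subset_left).trans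
      ((oscControlled_slab_self hp j ht).mono inter_subset_right subset_rfl)
      (volume_slab_lt_top _ _).ne (volume_slab_lt_top _ _).ne
      (volume_slab_inter_slab_pos hs ht hij)
      ((measure_mono inter_subset_left).trans_lt (volume_slab_lt_top i s)).ne
  rcases eq_or_ne i j with rfl | hij
  · -- slabs over opposite faces are linked through a slab over a neighbouring face
    have : Nontrivial (Fin n) := Fin.nontrivial_iff_two_le.2 hn
    obtain ⟨k, hk⟩ := exists_ne i
    refine (hne hs abs_one hk.symm).trans (hne abs_one ht hk) (volume_slab_lt_top _ _).ne
      (volume_slab_lt_top _ _).ne (fun h0 => ?_) (volume_slab_lt_top k 1).ne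
    exact volume_slab_inter_slab_pos abs_one hs hk (measure_mono_null inter_subset_left h0)
  · exact hne hs ht hij

/-- The annulus is covered by the slabs beyond the faces of the inner cube, between any two of which
the oscillation is controlled. -/
theorem oscControlled_annulus {n p : ℕ} (hn : 2 ≤ n) (hp : p ≠ 0) :
    OscControlled p (annulus (0 : E n) 1) (annulus 0 1) (annulus 0 1) := by
  have h1 : ∀ q : Bool, |(if q then 1 else -1 : ℝ)| = 1 := fun q => by cases q <;> simp
  exact (OscControlled.iUnion fun q q' : Fin n × Bool =>
    oscControlled_slab hn hp q.1 q'.1 (h1 q.2) (h1 q'.2)).mono annulus_subset_iUnion_slab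
      annulus_subset_iUnion_slab

theorem add_smul_mem_cube_iff {n : ℕ} {a x : E n} {r s : ℝ} (hr : 0 < r) :
    a + r • x ∈ cube a (s * r) ↔ x ∈ cube 0 s := by
  refine forall_congr' fun i => ?_
  simp only [PiLp.add_apply, PiLp.smul_apply, smul_eq_mul, add_sub_cancel_left, PiLp.zero_apply,
    sub_zero, abs_mul, abs_of_pos hr]
  rw [mul_comm s r, mul_lt_mul_iff_right₀ hr]

theorem add_smul_mem_annulus_iff {n : ℕ} {a x : E n} {r : ℝ} (hr : 0 < r) :
    a + r • x ∈ annulus a r ↔ x ∈ annulus 0 1 := by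
  have h1 := add_smul_mem_cube_iff (a := a) (x := x) (s := 4) hr
  have h2 := add_smul_mem_cube_iff (a := a) (x := x) (s := 1) hr
  rw [one_mul] at h2
  simp only [annulus, Set.mem_sdiff, h1, h2, mul_one]

theorem setLIntegral_annulus_scale {n : ℕ} {g : E n → ℝ≥0∞} (hg : Measurable g) (a : E n) {r : ℝ}
    (hr : 0 < r) :
    ∫⁻ x in annulus a r, g x = ENNReal.ofReal (r ^ n) * ∫⁻ x in annulus 0 1, g (a + r • x) := by
  have h := lintegral_comp_add_smul ((annulus a r).indicator g)
    (hg.indicator (measurableSet_annulus a r)) a hr.ne'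
  rw [lintegral_indicator (measurableSet_annulus a r)] at h
  rw [← lintegral_indicator (measurableSet_annulus 0 1)]
  have h2 : (annulus 0 1).indicator (fun x => g (a + r • x))
      = fun x => (annulus a r).indicator g (a + r • x) := by
    funext x
    by_cases hx : x ∈ annulus (0 : E n) 1
    · rw [indicator_of_mem hx, indicator_of_mem ((add_smul_mem_annulus_iff hr).2 hx)]
    · rw [indicator_of_notMem hx,
        indicator_of_notMem fun h => hx ((add_smul_mem_annulus_iff hr).1 h)]
  rw [h2, h, ← mul_assoc, ← ENNReal.ofReal_mul (by positivity), abs_of_pos (by positivity),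
    mul_inv_cancel₀ (by positivity), ENNReal.ofReal_one, one_mul]

theorem fderiv_comp_add_smul {n : ℕ} {F : E n → E n} (hF : ContDiff ℝ 1 F) (a : E n) (r : ℝ)
    (x : E n) : fderiv ℝ (fun x => F (a + r • x)) x = r • fderiv ℝ F (a + r • x) := by
  have h1 : HasFDerivAt (fun x : E n => a + r • x) (r • ContinuousLinearMap.id ℝ (E n)) x :=
    ((hasFDerivAt_id x).const_smul r).const_add a
  have h2 : HasFDerivAt (fun x : E n => F (a + r • x)) _ x :=
    (((hF.differentiable one_ne_zero) (a + r • x)).hasFDerivAt).comp x h1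
  rw [h2.fderiv]
  ext v
  simp

/-- The Poincaré inequality in the cubical annuli, with a scale-invariant constant. -/
theorem exists_oscIntegral_annulus_le {n : ℕ} (hn : 2 ≤ n) :
    ∃ C : ℝ≥0, ∀ F : E n → E n, ContDiff ℝ 1 F → ∀ (a : E n) (r : ℝ), 0 < r →
      oscIntegral n F (annulus a r) (annulus a r)
        ≤ C * (ENNReal.ofReal (r ^ n) ^ 2 * ∫⁻ x in annulus a r, ‖fderiv ℝ F x‖ₑ ^ n) := by
  obtain ⟨C, hC⟩ := oscControlled_annulus hn (p := n) (by lia)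
  refine ⟨C, fun F hF a r hr => ?_⟩
  have hFs : ContDiff ℝ 1 fun x => F (a + r • x) := hF.comp (by fun_prop)
  have hcF := hF.continuous_fderiv one_ne_zero
  have h := hC _ hFs
  have hm1 : ∀ x, Measurable fun y => ‖F x - F y‖ₑ ^ n := fun x =>
    (continuous_const.sub hF.continuous).enorm.measurable.pow_const n
  have hm2 : Measurable fun x => ∫⁻ y in annulus a r, ‖F x - F y‖ₑ ^ n :=
    Measurable.lintegral_prod_right' (f := fun q : E n × E n => ‖F q.1 - F q.2‖ₑ ^ n)
      (((hF.continuous.comp continuous_fst).sub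
        (hF.continuous.comp continuous_snd)).enorm.measurable.pow_const n)
  have e1 : oscIntegral n F (annulus a r) (annulus a r)
      = ENNReal.ofReal (r ^ n) ^ 2 *
        oscIntegral n (fun x => F (a + r • x)) (annulus 0 1) (annulus 0 1) := by
    rw [oscIntegral, setLIntegral_annulus_scale hm2 a hr, oscIntegral, sq, mul_assoc]
    congr 1
    rw [← lintegral_const_mul' _ _ ENNReal.ofReal_ne_top]
    exact lintegral_congr fun x => setLIntegral_annulus_scale (hm1 _) a hr
  have e2 : ∫⁻ x in annulus a r, ‖fderiv ℝ F x‖ₑ ^ n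
      = ∫⁻ x in annulus 0 1, ‖fderiv ℝ (fun x => F (a + r • x)) x‖ₑ ^ n := by
    rw [setLIntegral_annulus_scale (hcF.enorm.measurable.pow_const n) a hr,
      ← lintegral_const_mul' _ _ ENNReal.ofReal_ne_top]
    refine lintegral_congr fun x => ?_
    rw [fderiv_comp_add_smul hF, enorm_smul, mul_pow, Real.enorm_of_nonneg hr.le,
      ENNReal.ofReal_pow hr.le]
  rw [e1, e2, mul_left_comm]
  gcongr

/-! ### A Caccioppoli inequality for smooth maps -/

/-- A smooth cut-off function between the cubes of half side lengths `1` and `4`: a product of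
one-dimensional bumps, which equal `1` on `[-1, 1]` and are supported in `[-3, 3]`. -/
noncomputable def cutoff {n : ℕ} (x : E n) : ℝ :=
  ∏ i, (⟨1, 3, one_pos, by norm_num⟩ : ContDiffBump (0 : ℝ)) (x i)

theorem contDiff_cutoff {n : ℕ} : ContDiff ℝ ∞ (cutoff : E n → ℝ) :=
  contDiff_prod fun i _ => (ContDiffBump.contDiff _).comp (by fun_prop)

theorem cutoff_nonneg {n : ℕ} (x : E n) : 0 ≤ cutoff x :=
  Finset.prod_nonneg fun _ _ => ContDiffBump.nonneg _

theorem cutoff_le_one {n : ℕ} (x : E n) : cutoff x ≤ 1 :=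
  Finset.prod_le_one (fun _ _ => ContDiffBump.nonneg _) fun _ _ => ContDiffBump.le_one _

theorem cutoff_eq_one {n : ℕ} {x : E n} (hx : x ∈ cube 0 1) : cutoff x = 1 := by
  refine Finset.prod_eq_one fun i _ => ContDiffBump.one_of_mem_closedBall _ ?_
  have := hx i
  rw [mem_closedBall_zero_iff, Real.norm_eq_abs]
  simpa using this.le

theorem tsupport_cutoff_subset {n : ℕ} : tsupport (cutoff : E n → ℝ) ⊆ {x | ∀ i, |x i| ≤ 3} := by
  refine closure_minimal (fun x hx i => ?_) ?_
  · by_contra h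
    refine hx (Finset.prod_eq_zero (Finset.mem_univ i) (ContDiffBump.zero_of_le_dist _ ?_))
    rw [dist_zero_right, Real.norm_eq_abs]
    exact (not_le.1 h).le
  · simp only [ofPred_forall]
    exact isClosed_iInter fun i => isClosed_le (by fun_prop) continuous_const

theorem tsupport_cutoff_subset_cube {n : ℕ} : tsupport (cutoff : E n → ℝ) ⊆ cube 0 4 := by
  intro x hx i
  have := tsupport_cutoff_subset hx i
  simp only [PiLp.zero_apply, sub_zero]
  linarith

theorem hasCompactSupport_cutoff {n : ℕ} : HasCompactSupport (cutoff : E n → ℝ) :=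
  Metric.isCompact_of_isClosed_isBounded (isClosed_tsupport _)
    ((isBounded_cube 0 4).subset tsupport_cutoff_subset_cube)

theorem fderiv_cutoff_eq_zero {n : ℕ} {x : E n} (hx : x ∉ annulus (0 : E n) 1) :
    fderiv ℝ (cutoff : E n → ℝ) x = 0 := by
  by_cases h : x ∈ cube 0 1
  · have : (cutoff : E n → ℝ) =ᶠ[𝓝 x] fun _ => 1 := by
      filter_upwards [(isOpen_cube 0 1).mem_nhds h] with y hy using cutoff_eq_one hy
    rw [this.fderiv_eq, fderiv_const_apply]
  · by_contra h0
    refine hx ⟨?_, h⟩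
    rw [mul_one]
    exact tsupport_cutoff_subset_cube (support_fderiv_subset ℝ h0)

theorem annulus_subset_cube {n : ℕ} (a : E n) (r : ℝ) : annulus a r ⊆ cube a (4 * r) :=
  fun _ h => h.1

theorem isBounded_annulus {n : ℕ} (a : E n) (r : ℝ) : Bornology.IsBounded (annulus a r) :=
  (isBounded_cube a (4 * r)).subset (annulus_subset_cube a r)

theorem volume_annulus_lt_top {n : ℕ} (a : E n) (r : ℝ) : volume (annulus a r) < ⊤ :=
  (isBounded_annulus a r).measure_lt_top

theorem volume_annulus_unit_pos {n : ℕ} (hn : n ≠ 0) : volume (annulus (0 : E n) 1) ≠ 0 := by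
  set i : Fin n := ⟨0, Nat.pos_of_ne_zero hn⟩
  set O : Set (E n) := cube 0 4 ∩ {x | 1 < x i}
  have hOo : IsOpen O := (isOpen_cube 0 4).inter (isOpen_lt continuous_const (by fun_prop))
  have hne : O.Nonempty := by
    refine ⟨WithLp.toLp 2 fun _ => 2, fun k => ?_, ?_⟩
    · simp; norm_num
    · simp
  refine ne_of_gt ((hOo.measure_pos volume hne).trans_le (measure_mono fun x hx => ?_))
  refine slab_subset_annulus i (s := 1) (by simp) ⟨hx.1, ?_⟩
  simpa using hx.2.le

theorem volume_annulus {n : ℕ} (a : E n) {r : ℝ} (hr : 0 < r) :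
    volume (annulus a r) = ENNReal.ofReal (r ^ n) * volume (annulus (0 : E n) 1) := by
  simpa using setLIntegral_annulus_scale (g := fun _ => 1) measurable_const a hr

theorem ofReal_integral_norm_pow {α G : Type*} [MeasurableSpace α] [NormedAddCommGroup G]
    {ν : Measure α} {g : α → G} {p : ℕ} (hg : Integrable (fun x => ‖g x‖ ^ p) ν) :
    ENNReal.ofReal (∫ x, ‖g x‖ ^ p ∂ν) = ∫⁻ x, ‖g x‖ₑ ^ p ∂ν := by
  rw [ofReal_integral_eq_lintegral_ofReal hg (Eventually.of_forall fun x => by positivity)]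
  refine lintegral_congr fun x => ?_
  rw [ENNReal.ofReal_pow (norm_nonneg _), ofReal_norm]

/-- Some value `c` of `f` satisfies this inequality: the right-hand side is the average of the
left-hand side over the choices `c = f y` with `y ∈ A`. -/
theorem exists_volume_mul_lintegral_sub_le {n p : ℕ} {f : E n → E n} {A : Set (E n)}
    (hf : AEStronglyMeasurable f (volume.restrict A)) (hA0 : volume A ≠ 0) (hA : volume A ≠ ⊤) :
    ∃ c : E n, volume A * ∫⁻ x in A, ‖f x - c‖ₑ ^ p ≤ oscIntegral p f A A := by
  have hm : AEMeasurable (fun q : E n × E n => ‖f q.1 - f q.2‖ₑ ^ p)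
      ((volume.restrict A).prod (volume.restrict A)) :=
    ((hf.comp_fst.sub hf.comp_snd).enorm).pow_const p
  obtain ⟨y, -, hy⟩ := exists_le_setLAverage hA0 hA hm.lintegral_prod_right'
  refine ⟨f y, ?_⟩
  rw [setLAverage_eq, ENNReal.le_div_iff_mul_le (Or.inl hA0) (Or.inl hA), mul_comm] at hy
  refine le_trans (le_of_eq ?_) hy
  congr 1
  refine lintegral_congr fun x => ?_
  rw [← enorm_neg, neg_sub]

/-- The Caccioppoli inequality in an annulus, with the zero order term absorbed by the Poincaré
inequality. -/
theorem exists_integral_cutoff_pow_mul_det_le {n : ℕ} (hn : 2 ≤ n) :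
    ∃ C : ℝ, 0 ≤ C ∧ ∀ F : E n → E n, ContDiff ℝ 1 F → ∀ (a : E n) (r : ℝ), 0 < r →
      ∫ x, cutoff (r⁻¹ • (x - a)) ^ n * (fderiv ℝ F x).det
        ≤ C * ∫ x in annulus a r, ‖fderiv ℝ F x‖ ^ n := by
  have hn0 : n ≠ 0 := by lia
  have hη1 : ContDiff ℝ 1 (cutoff : E n → ℝ) := contDiff_cutoff.of_le (by exact_mod_cast le_top)
  obtain ⟨M, hM⟩ := (hη1.continuous_fderiv one_ne_zero).bounded_above_of_compact_support
    (hasCompactSupport_cutoff.fderiv ℝ)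
  obtain ⟨C, hC0, hC⟩ := exists_integral_pow_mul_det_le hn0 M
  obtain ⟨C', hC'⟩ := exists_oscIntegral_annulus_le hn
  set A : Set (E n) := annulus 0 1
  have hA0 : volume A ≠ 0 := volume_annulus_unit_pos hn0
  have hAt : volume A ≠ ⊤ := (volume_annulus_lt_top 0 1).ne
  set K : ℝ := ((volume A)⁻¹ * C').toReal
  have hK : ENNReal.ofReal K = (volume A)⁻¹ * C' := ENNReal.ofReal_toReal (by finiteness)
  have hint : ∀ {G : E n → ℝ} {a : E n} {r : ℝ}, Continuous G → IntegrableOn G (annulus a r) :=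
    fun hG => (hG.continuousOn.integrableOn_compact
      (isBounded_annulus _ _).isCompact_closure).mono_set subset_closure
  -- the unit annulus; the general case follows by scaling
  have unit : ∀ F : E n → E n, ContDiff ℝ 1 F → ∫ x, cutoff x ^ n * (fderiv ℝ F x).det
        ≤ (C * (1 + K)) * ∫ x in A, ‖fderiv ℝ F x‖ ^ n := by
    intro F hF
    obtain ⟨c, hc⟩ := exists_volume_mul_lintegral_sub_le (p := n)
      (hF.continuous.aestronglyMeasurable (μ := volume.restrict A)) hA0 hAt
    have h1 := hc.trans (hC' F hF 0 1 one_pos)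
    simp only [one_pow, ENNReal.ofReal_one, one_mul] at h1
    have i1 : IntegrableOn (fun x => ‖fderiv ℝ F x‖ ^ n) A :=
      hint ((hF.continuous_fderiv one_ne_zero).norm.pow n)
    have i2 : IntegrableOn (fun x => ‖F x - c‖ ^ n) A :=
      hint ((hF.continuous.sub continuous_const).norm.pow n)
    have h2 : ∫ x in A, ‖F x - c‖ ^ n ≤ K * ∫ x in A, ‖fderiv ℝ F x‖ ^ n := by
      have hnn : 0 ≤ ∫ x in A, ‖fderiv ℝ F x‖ ^ n := integral_nonneg fun x => by positivity
      rw [← ENNReal.ofReal_le_ofReal_iff (mul_nonneg ENNReal.toReal_nonneg hnn),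
        ENNReal.ofReal_mul ENNReal.toReal_nonneg, hK, ofReal_integral_norm_pow i1,
        ofReal_integral_norm_pow i2]
      calc ∫⁻ x in A, ‖F x - c‖ₑ ^ n
          = (volume A)⁻¹ * (volume A * ∫⁻ x in A, ‖F x - c‖ₑ ^ n) := by
            rw [← mul_assoc, ENNReal.inv_mul_cancel hA0 hAt, one_mul]
        _ ≤ _ := by rw [mul_assoc]; exact mul_le_mul' le_rfl h1
    have h3 := hC cutoff A hη1 hasCompactSupport_cutoff
      (fun x => by rw [abs_of_nonneg (cutoff_nonneg x)]; exact cutoff_le_one x) hM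
      (measurableSet_annulus 0 1) (isBounded_annulus 0 1) (fun x hx => fderiv_cutoff_eq_zero hx)
      F c hF
    calc _ ≤ _ := h3
      _ ≤ C * ((∫ x in A, ‖fderiv ℝ F x‖ ^ n) + K * ∫ x in A, ‖fderiv ℝ F x‖ ^ n) := by gcongr
      _ = _ := by ring
  refine ⟨C * (1 + K), mul_nonneg hC0 (add_nonneg zero_le_one ENNReal.toReal_nonneg), ?_⟩
  intro F hF a r hr
  have hFs : ContDiff ℝ 1 fun x => F (a + r • x) := hF.comp (by fun_prop)
  have h := unit _ hFs
  simp only [fderiv_comp_add_smul hF] at h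
  have e1 : ∫ x, cutoff x ^ n * (r • fderiv ℝ F (a + r • x)).det
      = ∫ x, cutoff (r⁻¹ • (x - a)) ^ n * (fderiv ℝ F x).det := by
    have hdet : ∀ B : E n →L[ℝ] E n, (r • B).det = r ^ n * B.det := fun B => by
      simp [ContinuousLinearMap.det, LinearMap.det_smul]
    have h1 := Measure.integral_comp_smul (volume : Measure (E n))
      (fun x => cutoff (r⁻¹ • (a + x - a)) ^ n * (fderiv ℝ F (a + x)).det) r
    have h2 := integral_add_left_eq_self (μ := (volume : Measure (E n)))
      (fun x => cutoff (r⁻¹ • (x - a)) ^ n * (fderiv ℝ F x).det) a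
    rw [h2] at h1
    simp only [add_sub_cancel_left, inv_smul_smul₀ hr.ne', finrank_euclideanSpace,
      Fintype.card_fin, smul_eq_mul] at h1
    simp_rw [hdet, mul_left_comm _ (r ^ n)]
    rw [integral_const_mul, h1, abs_of_pos (by positivity), ← mul_assoc,
      mul_inv_cancel₀ (by positivity), one_mul]
  have e2 : ∫ x in A, ‖r • fderiv ℝ F (a + r • x)‖ ^ n
      = ∫ x in annulus a r, ‖fderiv ℝ F x‖ ^ n := by
    have hcF := hF.continuous_fderiv one_ne_zero
    rw [← ENNReal.toReal_ofReal (integral_nonneg fun x => by positivity),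
      ← ENNReal.toReal_ofReal (r := ∫ x in annulus a r, ‖fderiv ℝ F x‖ ^ n)
        (integral_nonneg fun x => by positivity),
      ofReal_integral_norm_pow (hint (hcF.norm.pow n)),
      ofReal_integral_norm_pow (hint (by fun_prop)),
      setLIntegral_annulus_scale (hcF.enorm.measurable.pow_const n) a hr,
      ← lintegral_const_mul' _ _ ENNReal.ofReal_ne_top]
    congr 1
    refine lintegral_congr fun x => ?_
    rw [enorm_smul, mul_pow, Real.enorm_of_nonneg hr.le, ENNReal.ofReal_pow hr.le]
  rwa [e1, e2] at h

/-! ### Mollification of Sobolev maps -/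

section Mollification

open scoped Convolution
open ContinuousLinearMap (lsmul)

/-- One half of the generalized dominated convergence theorem, by Fatou's lemma applied to the
nonnegative functions `b j + f j`. -/
theorem eventually_lt_integral_of_dominated {α : Type*} [MeasurableSpace α] {ν : Measure α}
    {f b : ℕ → α → ℝ} {f₀ b₀ : α → ℝ} (hf : ∀ j, AEStronglyMeasurable (f j) ν)
    (hb : ∀ j, Integrable (b j) ν) (hb₀ : Integrable b₀ ν) (hfb : ∀ j, ∀ᵐ x ∂ν, |f j x| ≤ b j x)
    (hf₀ : Integrable f₀ ν)
    (hlf : ∀ᵐ x ∂ν, Tendsto (fun j => f j x) atTop (𝓝 (f₀ x)))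
    (hlb : ∀ᵐ x ∂ν, Tendsto (fun j => b j x) atTop (𝓝 (b₀ x)))
    (hib : Tendsto (fun j => ∫ x, b j x ∂ν) atTop (𝓝 (∫ x, b₀ x ∂ν)))
    {a : ℝ} (ha : a < ∫ x, f₀ x ∂ν) : ∀ᶠ j in atTop, a < ∫ x, f j x ∂ν := by
  have hfi : ∀ j, Integrable (f j) ν := fun j =>
    (hb j).mono' (hf j) ((hfb j).mono fun x hx => by simpa using hx)
  have hnn : ∀ j, 0 ≤ᵐ[ν] fun x => b j x + f j x := fun j =>
    (hfb j).mono fun x hx => show 0 ≤ b j x + f j x by have := neg_abs_le (f j x); linarith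
  have hnn₀ : 0 ≤ᵐ[ν] fun x => b₀ x + f₀ x := by
    filter_upwards [hlf, hlb, ae_all_iff.2 hnn] with x h1 h2 h3
    exact ge_of_tendsto' (h2.add h1) h3
  obtain ⟨ε, hε, hεa⟩ : ∃ ε > 0, a + 2 * ε < ∫ x, f₀ x ∂ν :=
    ⟨((∫ x, f₀ x ∂ν) - a) / 3, by linarith, by linarith⟩
  have hfatou : ENNReal.ofReal (∫ x, (b₀ x + f₀ x) ∂ν) ≤
      liminf (fun j => ENNReal.ofReal (∫ x, (b j x + f j x) ∂ν)) atTop := by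
    have e : ∀ j, ENNReal.ofReal (∫ x, (b j x + f j x) ∂ν)
        = ∫⁻ x, ENNReal.ofReal (b j x + f j x) ∂ν := fun j =>
      ofReal_integral_eq_lintegral_ofReal ((hb j).add (hfi j)) (hnn j)
    have e₀ : ENNReal.ofReal (∫ x, (b₀ x + f₀ x) ∂ν) = ∫⁻ x, ENNReal.ofReal (b₀ x + f₀ x) ∂ν :=
      ofReal_integral_eq_lintegral_ofReal (hb₀.add hf₀) hnn₀
    rw [funext e, e₀]
    refine le_trans (le_of_eq (lintegral_congr_ae ?_))
      (lintegral_liminf_le' fun j => ((hb j).add (hfi j)).aemeasurable.ennreal_ofReal)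
    filter_upwards [hlf, hlb] with x h1 h2
    exact ((ENNReal.continuous_ofReal.tendsto _).comp (h2.add h1)).liminf_eq.symm
  have hev : ∀ᶠ j in atTop, (∫ x, (b₀ x + f₀ x) ∂ν) - ε < ∫ x, (b j x + f j x) ∂ν := by
    rcases le_or_gt (∫ x, (b₀ x + f₀ x) ∂ν) 0 with h0 | h0
    · exact Eventually.of_forall fun j => by
        have := integral_nonneg_of_ae (hnn j)
        linarith
    · have hlt : ENNReal.ofReal ((∫ x, (b₀ x + f₀ x) ∂ν) - ε) <
          liminf (fun j => ENNReal.ofReal (∫ x, (b j x + f j x) ∂ν)) atTop :=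
        lt_of_lt_of_le ((ENNReal.ofReal_lt_ofReal_iff h0).2 (by linarith)) hfatou
      filter_upwards [eventually_lt_of_lt_liminf hlt] with j hj
      exact (ENNReal.ofReal_lt_ofReal_iff'.1 hj).1
  filter_upwards [hev, hib.eventually_lt_const (u := (∫ x, b₀ x ∂ν) + ε) (by linarith)] with j h1 h2
  rw [integral_add hb₀ hf₀, integral_add (hb j) (hfi j)] at h1
  linarith

/-- The generalized dominated convergence theorem: the dominating functions may vary, provided that
their integrals converge. -/
theorem tendsto_integral_of_dominated_tendsto {α : Type*} [MeasurableSpace α] {ν : Measure α}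
    {f b : ℕ → α → ℝ} {f₀ b₀ : α → ℝ} (hf : ∀ j, AEStronglyMeasurable (f j) ν)
    (hb : ∀ j, Integrable (b j) ν) (hb₀ : Integrable b₀ ν) (hfb : ∀ j, ∀ᵐ x ∂ν, |f j x| ≤ b j x)
    (hf₀ : Integrable f₀ ν)
    (hlf : ∀ᵐ x ∂ν, Tendsto (fun j => f j x) atTop (𝓝 (f₀ x)))
    (hlb : ∀ᵐ x ∂ν, Tendsto (fun j => b j x) atTop (𝓝 (b₀ x)))
    (hib : Tendsto (fun j => ∫ x, b j x ∂ν) atTop (𝓝 (∫ x, b₀ x ∂ν))) :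
    Tendsto (fun j => ∫ x, f j x ∂ν) atTop (𝓝 (∫ x, f₀ x ∂ν)) := by
  refine tendsto_order.2 ⟨fun a ha =>
    eventually_lt_integral_of_dominated hf hb hb₀ hfb hf₀ hlf hlb hib ha, fun a ha => ?_⟩
  have h := eventually_lt_integral_of_dominated (f := fun j x => -f j x) (f₀ := fun x => -f₀ x)
    (fun j => (hf j).neg) hb hb₀ (fun j => (hfb j).mono fun x hx => by rwa [abs_neg]) hf₀.neg
    (hlf.mono fun x hx => hx.neg) hlb hib (a := -a) (by rw [integral_neg]; linarith)
  filter_upwards [h] with j hj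
  rw [integral_neg] at hj
  linarith

/-- Jensen's inequality for mollifications. -/
theorem norm_convolution_pow_le {n p : ℕ} (hp : p ≠ 0) {W : Type*} [NormedAddCommGroup W]
    [NormedSpace ℝ W] (φ : ContDiffBump (0 : E n)) {g : E n → W}
    (hg : LocallyIntegrable g) (hgp : LocallyIntegrable fun x => ‖g x‖ ^ p) (x : E n) :
    ‖(φ.normed volume ⋆[lsmul ℝ ℝ] g) x‖ ^ p ≤
      (φ.normed volume ⋆[lsmul ℝ ℝ] fun x => ‖g x‖ ^ p) x := by
  have hφc : Continuous (φ.normed volume) := φ.continuous_normed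
  have hφ0 : ∀ y, 0 ≤ φ.normed volume y := φ.nonneg_normed
  set w : E n → ℝ≥0∞ := fun y => ENNReal.ofReal (φ.normed volume y) with hw
  have hwm : Measurable w := hφc.measurable.ennreal_ofReal
  have hprob : IsProbabilityMeasure (volume.withDensity w) := by
    refine ⟨?_⟩
    rw [withDensity_apply _ MeasurableSet.univ, Measure.restrict_univ, hw,
      ← ofReal_integral_eq_lintegral_ofReal φ.integrable_normed (Eventually.of_forall hφ0),
      φ.integral_normed, ENNReal.ofReal_one]
  have hgx : AEStronglyMeasurable (fun y => g (x - y)) volume :=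
    hg.aestronglyMeasurable.comp_measurePreserving (Measure.measurePreserving_sub_left volume x)
  have h1 := lintegral_enorm_pow_le (volume.withDensity w)
    (hgx.mono_ac (withDensity_absolutelyContinuous _ _)) hp
  rw [lintegral_withDensity_eq_lintegral_mul₀ hwm.aemeasurable hgx.enorm,
    lintegral_withDensity_eq_lintegral_mul₀ hwm.aemeasurable (hgx.enorm.pow_const p)] at h1
  have hint : Integrable fun y => φ.normed volume y * ‖g (x - y)‖ ^ p :=
    φ.hasCompactSupport_normed.convolutionExists_left (lsmul ℝ ℝ) hφc hgp x
  have h2 : ∫⁻ y, (w * fun y => ‖g (x - y)‖ₑ ^ p) y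
      = ENNReal.ofReal ((φ.normed volume ⋆[lsmul ℝ ℝ] fun x => ‖g x‖ ^ p) x) := by
    rw [convolution_lsmul]
    simp only [smul_eq_mul]
    rw [ofReal_integral_eq_lintegral_ofReal hint
      (Eventually.of_forall fun y => mul_nonneg (hφ0 y) (by positivity))]
    refine lintegral_congr fun y => ?_
    rw [Pi.mul_apply, ENNReal.ofReal_mul (hφ0 y), ENNReal.ofReal_pow (norm_nonneg _), ofReal_norm]
  have h3 : ‖(φ.normed volume ⋆[lsmul ℝ ℝ] g) x‖ₑ ≤ ∫⁻ y, (w * fun y => ‖g (x - y)‖ₑ) y := by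
    rw [convolution_lsmul]
    refine (enorm_integral_le_lintegral_enorm _).trans_eq (lintegral_congr fun y => ?_)
    rw [enorm_smul, Real.enorm_of_nonneg (hφ0 y), Pi.mul_apply]
  have hnn : 0 ≤ (φ.normed volume ⋆[lsmul ℝ ℝ] fun x => ‖g x‖ ^ p) x := by
    rw [convolution_lsmul]
    exact integral_nonneg fun y => smul_nonneg (hφ0 y) (by positivity)
  rw [← ENNReal.ofReal_le_ofReal_iff hnn, ENNReal.ofReal_pow (norm_nonneg _), ofReal_norm, ← h2]
  exact le_trans (by gcongr) h1

/-- The extension of `g` from `k` by zero. It is a definition of its own, rather than an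
abbreviation of `Set.indicator`, so that it stays folded in convolutions. -/
noncomputable def zeroExtend {n : ℕ} {W : Type*} [NormedAddCommGroup W] (k : Set (E n))
    (g : E n → W) : E n → W := k.indicator g

theorem zeroExtend_of_mem {n : ℕ} {W : Type*} [NormedAddCommGroup W] {k : Set (E n)} {x : E n}
    (hx : x ∈ k) (g : E n → W) : zeroExtend k g x = g x := indicator_of_mem hx g

theorem integrable_zeroExtend {n : ℕ} {W : Type*} [NormedAddCommGroup W] {k : Set (E n)}
    {g : E n → W} (hk : MeasurableSet k) (hg : IntegrableOn g k) : Integrable (zeroExtend k g) :=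
  (integrable_indicator_iff hk).2 hg

theorem memLp_zeroExtend {n : ℕ} {W : Type*} [NormedAddCommGroup W] {k : Set (E n)}
    {g : E n → W} {p : ℝ≥0∞} (hk : MeasurableSet k) (hg : MemLp g p (volume.restrict k)) :
    MemLp (zeroExtend k g) p :=
  (memLp_indicator_iff_restrict hk).2 hg

/-- Mollification commutes with weak differentiation, away from the boundary. -/
theorem hasFDerivAt_convolution_of_hasWeakFDerivOn {n : ℕ} {Ω : Set (E n)} {f : E n → E n}
    {G : E n → (E n →L[ℝ] E n)} (h : HasWeakFDerivOn Ω f G) {k : Set (E n)} (hk : IsCompact k)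
    (hkΩ : k ⊆ Ω) (φ : ContDiffBump (0 : E n)) {x : E n}
    (hx : Metric.closedBall x φ.rOut ⊆ k) :
    HasFDerivAt (φ.normed volume ⋆[lsmul ℝ ℝ] zeroExtend k f)
      ((φ.normed volume ⋆[lsmul ℝ ℝ] zeroExtend k G) x) x := by
  have hfk : Integrable (zeroExtend k f) :=
    integrable_zeroExtend hk.measurableSet (h.1.integrableOn_compact_subset hkΩ hk)
  have hGk : Integrable (zeroExtend k G) :=
    integrable_zeroExtend hk.measurableSet (h.2.1.integrableOn_compact_subset hkΩ hk)
  have hφs : ContDiff ℝ ∞ (φ.normed (volume : Measure (E n))) := φ.contDiff_normed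
  have hφ1 : ContDiff ℝ 1 (φ.normed (volume : Measure (E n))) := φ.contDiff_normed
  have hφc : HasCompactSupport (φ.normed (volume : Measure (E n))) := φ.hasCompactSupport_normed
  have h1 := hφc.hasFDerivAt_convolution_right (lsmul ℝ ℝ).flip hfk.locallyIntegrable hφ1 x
  rw [convolution_flip] at h1
  refine h1.congr_fderiv (ContinuousLinearMap.ext fun v => Eq.symm ?_)
  rw [convolution_precompR_apply _ hfk.locallyIntegrable (hφc.fderiv ℝ)
    (hφ1.continuous_fderiv one_ne_zero)]
  set ψ : E n → ℝ := fun y => φ.normed volume (x - y) with hψ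
  have hsupp : ∀ y, φ.normed volume (x - y) ≠ 0 → y ∈ k := fun y hy => by
    have : x - y ∈ Function.support (φ.normed (volume : Measure (E n))) := hy
    rw [φ.support_normed_eq, mem_ball_zero_iff] at this
    refine hx (Metric.ball_subset_closedBall ?_)
    rwa [mem_ball_iff_norm']
  have hψd : ∀ y, fderiv ℝ ψ y = -fderiv ℝ (φ.normed volume) (x - y) := fun y => by
    have h2 : HasFDerivAt ψ _ y := ((hφ1.differentiable one_ne_zero) (x - y)).hasFDerivAt.comp y
      ((hasFDerivAt_id y).const_sub x)
    rw [h2.fderiv]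
    ext v
    simp
  have hψs : tsupport ψ ⊆ Metric.closedBall x φ.rOut := by
    refine closure_minimal (fun y hy => ?_) Metric.isClosed_closedBall
    have : x - y ∈ Function.support (φ.normed (volume : Measure (E n))) := hy
    rw [φ.support_normed_eq, mem_ball_zero_iff] at this
    exact Metric.ball_subset_closedBall (by rwa [mem_ball_iff_norm'])
  -- the translated and reflected mollifier is an admissible test function
  have hweak := h.2.2 ψ (hφs.comp (by fun_prop)) (HasCompactSupport.intro
    (isCompact_closedBall x φ.rOut) fun y hy =>
      image_eq_zero_of_notMem_tsupport fun h => hy (hψs h))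
    (hψs.trans (hx.trans hkΩ)) v
  have e1 : ((φ.normed volume ⋆[lsmul ℝ ℝ] zeroExtend k G) x) v = ∫ y, ψ y • G y v := by
    rw [convolution_lsmul_swap, ContinuousLinearMap.integral_apply]
    · refine integral_congr_ae (Eventually.of_forall fun y => ?_)
      simp only [hψ, _root_.smul_apply]
      by_cases hy : φ.normed volume (x - y) = 0
      · rw [hy, zero_smul, zero_smul]
      · rw [zeroExtend_of_mem (hsupp y hy)]
    · have := hφc.convolutionExists_left (lsmul ℝ ℝ) hφ1.continuous hGk.locallyIntegrable x
      rw [← convolutionExistsAt_flip] at this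
      exact this
  have e2 : (zeroExtend k f ⋆[(lsmul ℝ ℝ).flip] fun a => fderiv ℝ (φ.normed volume) a v) x
      = -∫ y, fderiv ℝ ψ y v • f y := by
    rw [convolution_def, ← integral_neg]
    refine integral_congr_ae (Eventually.of_forall fun y => ?_)
    simp only [ContinuousLinearMap.flip_apply, ContinuousLinearMap.lsmul_apply]
    rw [hψd, _root_.neg_apply, neg_smul, neg_neg]
    by_cases hy : y ∈ k
    · rw [zeroExtend_of_mem hy]
    · have : fderiv ℝ ψ y = 0 := by
        by_contra h0
        exact hy (hx (hψs (support_fderiv_subset ℝ h0)))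
      rw [hψd, neg_eq_zero] at this
      rw [this]
      simp
  rw [e1, e2, hweak, neg_neg]

/-- Smooth approximation of `W^{1,n}` maps: `n`-homogeneously bounded continuous functionals of the
derivative converge in the mean. -/
theorem exists_smooth_approx {n : ℕ} (hn : n ≠ 0) {Ω : Set (E n)} (hΩ : IsOpen Ω) {f : E n → E n}
    {G : E n → (E n →L[ℝ] E n)} (h : MemW1Loc n Ω f G) {k : Set (E n)} (hk : IsCompact k)
    (hkΩ : k ⊆ Ω) :
    ∃ F : ℕ → E n → E n, (∀ j, ContDiff ℝ 1 (F j)) ∧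
      (∀ᵐ x ∂volume.restrict k, Tendsto (fun j => F j x) atTop (𝓝 (f x))) ∧
      ∀ (Φ : (E n →L[ℝ] E n) → ℝ) (C : ℝ) (ψ : E n → ℝ), Continuous Φ →
        (∀ A, |Φ A| ≤ C * ‖A‖ ^ n) → Measurable ψ → (∀ x, |ψ x| ≤ 1) → (∀ x ∉ k, ψ x = 0) →
        Tendsto (fun j => ∫ x, ψ x * Φ (fderiv ℝ (F j) x)) atTop (𝓝 (∫ x, ψ x * Φ (G x))) := by
  obtain ⟨δ, hδ, hδΩ⟩ := hk.exists_cthickening_subset_open hΩ hkΩ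
  set k' := Metric.cthickening δ k with hk'
  have hk'c : IsCompact k' := hk.cthickening
  set φ : ℕ → ContDiffBump (0 : E n) := fun j =>
    ⟨δ / (j + 2), 2 * (δ / (j + 2)), by positivity, by
      have : 0 < δ / (j + 2) := by positivity
      linarith⟩ with hφ
  have hφ1 : Tendsto (fun j => (φ j).rOut) atTop (𝓝 0) := by
    have h1 : Tendsto (fun j : ℕ => (j : ℝ) + 2) atTop atTop :=
      tendsto_atTop_add_const_right _ _ tendsto_natCast_atTop_atTop
    simpa using (tendsto_const_nhds (x := δ)).div_atTop h1 |>.const_mul 2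
  have hφ2 : ∀ᶠ j in atTop, (φ j).rOut ≤ 2 * (φ j).rIn := Eventually.of_forall fun j => le_rfl
  have hφ3 : ∀ j, (φ j).rOut ≤ δ := fun j => by
    change 2 * (δ / (j + 2)) ≤ δ
    rw [mul_div_assoc', div_le_iff₀ (by positivity)]
    nlinarith [(Nat.cast_nonneg j : (0 : ℝ) ≤ j)]
  set f' := zeroExtend k' f
  set G' := zeroExtend k' G
  have hf' : Integrable f' := integrable_zeroExtend hk'c.measurableSet
    (h.weakDeriv.1.integrableOn_compact_subset hδΩ hk'c)
  have hG' : Integrable G' := integrable_zeroExtend hk'c.measurableSet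
    (h.weakDeriv.2.1.integrableOn_compact_subset hδΩ hk'c)
  set H : E n → ℝ := fun x => ‖G' x‖ ^ n with hH
  have hHi : Integrable H := by
    have h1 : MemLp G' n := memLp_zeroExtend hk'c.measurableSet
      (h.memLp_deriv k' hδΩ hk'c)
    simpa using h1.integrable_norm_pow hn
  have hkk' : k ⊆ k' := Metric.self_subset_cthickening k
  have hF1 : ∀ j, ContDiff ℝ 1 ((φ j).normed volume ⋆[lsmul ℝ ℝ] f') := fun j =>
    (φ j).hasCompactSupport_normed.contDiff_convolution_left (n := 1) _ (φ j).contDiff_normed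
      hf'.locallyIntegrable
  have hFd : ∀ j, ∀ x ∈ k, fderiv ℝ ((φ j).normed volume ⋆[lsmul ℝ ℝ] f') x
      = ((φ j).normed volume ⋆[lsmul ℝ ℝ] G') x := fun j x hx =>
    (hasFDerivAt_convolution_of_hasWeakFDerivOn h.weakDeriv hk'c hδΩ (φ j)
      ((Metric.closedBall_subset_closedBall (hφ3 j)).trans
        (Metric.closedBall_subset_cthickening hx δ))).fderiv
  refine ⟨fun j => (φ j).normed volume ⋆[lsmul ℝ ℝ] f', hF1, ?_, ?_⟩
  · have h1 := ContDiffBump.ae_convolution_tendsto_right_of_locallyIntegrable hφ1 hφ2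
      hf'.locallyIntegrable
    filter_upwards [ae_restrict_of_ae h1, ae_restrict_mem hk.measurableSet] with x hx hxk
    simpa only [f', zeroExtend_of_mem (hkk' hxk)] using hx
  · intro Φ C ψ hΦ hC hψ hψ1 hψk
    have hC0 : ∀ A : E n →L[ℝ] E n, C * ‖A‖ ^ n ≤ |C| * ‖A‖ ^ n := fun A => by
      gcongr
      exact le_abs_self C
    have e1 : ∀ j, ∫ x, ψ x * Φ (fderiv ℝ ((φ j).normed volume ⋆[lsmul ℝ ℝ] f') x)
        = ∫ x, ψ x * Φ (((φ j).normed volume ⋆[lsmul ℝ ℝ] G') x) := fun j => by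
      refine integral_congr_ae (Eventually.of_forall fun x => ?_)
      by_cases hx : x ∈ k
      · simp only [hFd j x hx]
      · simp only [hψk x hx, zero_mul]
    have e2 : ∫ x, ψ x * Φ (G x) = ∫ x, ψ x * Φ (G' x) := by
      refine integral_congr_ae (Eventually.of_forall fun x => ?_)
      by_cases hx : x ∈ k
      · simp only [G', zeroExtend_of_mem (hkk' hx)]
      · simp only [hψk x hx, zero_mul]
    simp_rw [e1]
    rw [e2]
    have hbd : ∀ (x : E n) (A : E n →L[ℝ] E n), |ψ x * Φ A| ≤ |C| * ‖A‖ ^ n := fun x A => by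
      rw [abs_mul]
      calc |ψ x| * |Φ A| ≤ 1 * |Φ A| := by gcongr; exact hψ1 x
        _ ≤ |C| * ‖A‖ ^ n := by rw [one_mul]; exact (hC A).trans (hC0 A)
    have hmG : ∀ j, Integrable ((φ j).normed volume ⋆[lsmul ℝ ℝ] G') := fun j =>
      (φ j).integrable_normed.integrable_convolution _ hG'
    have hmH : ∀ j, Integrable ((φ j).normed volume ⋆[lsmul ℝ ℝ] H) := fun j =>
      (φ j).integrable_normed.integrable_convolution _ hHi
    -- by Jensen, the mollifications of `‖G‖ ^ n` dominate, and their integrals do not depend on `j`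
    refine tendsto_integral_of_dominated_tendsto
      (b := fun j x => |C| * ((φ j).normed volume ⋆[lsmul ℝ ℝ] H) x)
      (b₀ := fun x => |C| * H x) (fun j => ?_) (fun j => (hmH j).const_mul _) (hHi.const_mul _)
      (fun j => Eventually.of_forall fun x => ?_) ?_ ?_ ?_ ?_
    · exact hψ.aestronglyMeasurable.mul (hΦ.comp_aestronglyMeasurable (hmG j).aestronglyMeasurable)
    · refine (hbd x _).trans ?_
      gcongr
      exact norm_convolution_pow_le hn (φ j) hG'.locallyIntegrable hHi.locallyIntegrable x
    · exact (hHi.const_mul |C|).mono' (hψ.aestronglyMeasurable.mul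
        (hΦ.comp_aestronglyMeasurable hG'.aestronglyMeasurable))
        (Eventually.of_forall fun x => by simpa using hbd x (G' x))
    · filter_upwards [ContDiffBump.ae_convolution_tendsto_right_of_locallyIntegrable hφ1 hφ2
        hG'.locallyIntegrable] with x hx
      exact ((hΦ.tendsto _).comp hx).const_mul _
    · filter_upwards [ContDiffBump.ae_convolution_tendsto_right_of_locallyIntegrable hφ1 hφ2
        hHi.locallyIntegrable] with x hx
      exact hx.const_mul _
    · have : ∀ j, ∫ x, |C| * ((φ j).normed volume ⋆[lsmul ℝ ℝ] H) x = ∫ x, |C| * H x := fun j => by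
        rw [integral_const_mul, integral_const_mul, integral_convolution _ (φ j).integrable_normed
          hHi, (φ j).integral_normed]
        simp
      simp_rw [this]
      exact tendsto_const_nhds

end Mollification

/-! ### Passage to Sobolev maps and hole filling -/

theorem closure_cube_subset_closedBall {n : ℕ} (a : E n) {r : ℝ} (hr : 0 ≤ r) :
    closure (cube a r) ⊆ Metric.closedBall a (√n * r) :=
  closure_minimal (cube_subset_closedBall a hr) Metric.isClosed_closedBall

theorem isCompact_closure_cube {n : ℕ} (a : E n) (r : ℝ) : IsCompact (closure (cube a r)) :=
  (isBounded_cube a r).isCompact_closure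

theorem MemW1Loc.integrableOn_norm_pow {n : ℕ} (hn : n ≠ 0) {Ω : Set (E n)} {f : E n → E n}
    {G : E n → (E n →L[ℝ] E n)} (h : MemW1Loc n Ω f G) {k : Set (E n)} (hk : IsCompact k)
    (hkΩ : k ⊆ Ω) : IntegrableOn (fun x => ‖G x‖ ^ n) k := by
  simpa [IntegrableOn] using (h.memLp_deriv k hkΩ hk).integrable_norm_pow hn

theorem IntegrableOn.annulus_of_continuous {n : ℕ} {g : E n → ℝ} (hg : Continuous g) (a : E n)
    (r : ℝ) : IntegrableOn g (annulus a r) :=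
  (hg.continuousOn.integrableOn_compact (isBounded_annulus a r).isCompact_closure).mono_set
    subset_closure

theorem integral_indicator_one_mul {n : ℕ} {A : Set (E n)} (hA : MeasurableSet A) (g : E n → ℝ) :
    ∫ x, A.indicator (fun _ => (1 : ℝ)) x * g x = ∫ x in A, g x := by
  rw [← integral_indicator hA]
  refine integral_congr_ae (Eventually.of_forall fun x => ?_)
  by_cases hx : x ∈ A <;> simp [hx]

/-- The Poincaré inequality in annuli for Sobolev maps, by Fatou's lemma. -/
theorem exists_lintegral_annulus_sub_le {n : ℕ} (hn : 2 ≤ n) :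
    ∃ C : ℝ≥0, ∀ (Ω : Set (E n)) (f : E n → E n) (G : E n → (E n →L[ℝ] E n)), IsOpen Ω →
      MemW1Loc n Ω f G → ∀ (a : E n) (r : ℝ), 0 < r → closure (cube a (4 * r)) ⊆ Ω →
      ∃ c : E n, ∫⁻ x in annulus a r, ‖f x - c‖ₑ ^ n
        ≤ C * (ENNReal.ofReal (r ^ n) * ∫⁻ x in annulus a r, ‖G x‖ₑ ^ n) := by
  have hn0 : n ≠ 0 := by lia
  obtain ⟨C, hC⟩ := exists_oscIntegral_annulus_le hn
  set V : ℝ≥0∞ := volume (annulus (0 : E n) 1) with hV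
  have hV0 : V ≠ 0 := volume_annulus_unit_pos hn0
  have hVt : V ≠ ⊤ := (volume_annulus_lt_top 0 1).ne
  have hK : V⁻¹ * C ≠ ⊤ := by finiteness
  refine ⟨(V⁻¹ * C).toNNReal, fun Ω f G hΩ h a r hr ha => ?_⟩
  rw [ENNReal.coe_toNNReal hK]
  set A := annulus a r with hA
  have hAm : MeasurableSet A := measurableSet_annulus a r
  set k := closure (cube a (4 * r))
  have hk : IsCompact k := isCompact_closure_cube _ _
  have hAk : A ⊆ k := (annulus_subset_cube a r).trans subset_closure
  obtain ⟨F, hF, hFf, hFG⟩ := exists_smooth_approx hn0 hΩ h hk ha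
  set c₁ : ℝ≥0∞ := C * ENNReal.ofReal (r ^ n) ^ 2 with hc₁
  have hlim : Tendsto (fun j => ∫⁻ x in A, ‖fderiv ℝ (F j) x‖ₑ ^ n) atTop
      (𝓝 (∫⁻ x in A, ‖G x‖ₑ ^ n)) := by
    have h1 := hFG (fun B => ‖B‖ ^ n) 1 (A.indicator fun _ => 1) (by fun_prop)
      (fun B => by rw [one_mul, abs_of_nonneg (by positivity)])
      (measurable_const.indicator (measurableSet_annulus a r))
      (fun x => by by_cases hx : x ∈ A <;> simp [hx])
      (fun x hx => indicator_of_notMem (fun hxA => hx (hAk hxA)) _)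
    simp_rw [integral_indicator_one_mul hAm] at h1
    have h2 := (ENNReal.continuous_ofReal.tendsto _).comp h1
    have e3 : ENNReal.ofReal (∫ x in A, ‖G x‖ ^ n) = ∫⁻ x in A, ‖G x‖ₑ ^ n :=
      ofReal_integral_norm_pow ((h.integrableOn_norm_pow hn0 hk ha).mono_set hAk)
    rw [e3] at h2
    refine h2.congr fun j => ?_
    exact ofReal_integral_norm_pow (IntegrableOn.annulus_of_continuous
      (((hF j).continuous_fderiv one_ne_zero).norm.pow n) a r)
  have hosc : oscIntegral n f A A ≤ c₁ * ∫⁻ x in A, ‖G x‖ₑ ^ n := by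
    have hFfA : ∀ᵐ x ∂volume.restrict A, Tendsto (fun j => F j x) atTop (𝓝 (f x)) :=
      ae_restrict_of_ae_restrict_of_subset hAk hFf
    have hin : ∀ᵐ x ∂volume.restrict A, ∫⁻ y in A, ‖f x - f y‖ₑ ^ n ≤
        liminf (fun j => ∫⁻ y in A, ‖F j x - F j y‖ₑ ^ n) atTop := by
      filter_upwards [hFfA] with x hx
      refine le_trans (le_of_eq (lintegral_congr_ae ?_)) (lintegral_liminf_le fun j =>
        (continuous_const.sub (hF j).continuous).enorm.measurable.pow_const n)
      filter_upwards [hFfA] with y hy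
      exact (((ENNReal.continuous_pow n).tendsto _).comp (hx.sub hy).enorm).liminf_eq.symm
    have hmm : ∀ j, Measurable fun x => ∫⁻ y in A, ‖F j x - F j y‖ₑ ^ n := fun j =>
      Measurable.lintegral_prod_right' (f := fun q : E n × E n => ‖F j q.1 - F j q.2‖ₑ ^ n)
        ((((hF j).continuous.comp continuous_fst).sub
          ((hF j).continuous.comp continuous_snd)).enorm.measurable.pow_const n)
    calc oscIntegral n f A A
        ≤ ∫⁻ x in A, liminf (fun j => ∫⁻ y in A, ‖F j x - F j y‖ₑ ^ n) atTop :=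
          lintegral_mono_ae hin
      _ ≤ liminf (fun j => oscIntegral n (F j) A A) atTop := lintegral_liminf_le hmm
      _ ≤ liminf (fun j => c₁ * ∫⁻ x in A, ‖fderiv ℝ (F j) x‖ₑ ^ n) atTop := by
          refine liminf_le_liminf (Eventually.of_forall fun j => ?_)
          have := hC (F j) (hF j) a r hr
          rwa [← mul_assoc] at this
      _ = c₁ * ∫⁻ x in A, ‖G x‖ₑ ^ n :=
          (ENNReal.Tendsto.const_mul hlim (Or.inr (by finiteness))).liminf_eq
  have hvA : volume A = ENNReal.ofReal (r ^ n) * V := volume_annulus a hr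
  have hr0 : ENNReal.ofReal (r ^ n) ≠ 0 := by
    rw [Ne, ENNReal.ofReal_eq_zero, not_le]; positivity
  have hvA0 : volume A ≠ 0 := by rw [hvA]; exact mul_ne_zero hr0 hV0
  have hfm : AEStronglyMeasurable f (volume.restrict A) :=
    (h.memLp k ha hk).aestronglyMeasurable.mono_set hAk
  obtain ⟨c, hc⟩ := exists_volume_mul_lintegral_sub_le (p := n) hfm hvA0
    (volume_annulus_lt_top a r).ne
  refine ⟨c, ?_⟩
  have h1 := hc.trans hosc
  rw [hvA, hc₁] at h1
  have hrt : ENNReal.ofReal (r ^ n) ≠ ⊤ := ENNReal.ofReal_ne_top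
  have hinv : (ENNReal.ofReal (r ^ n) * V)⁻¹ * (ENNReal.ofReal (r ^ n) * V) = 1 :=
    ENNReal.inv_mul_cancel (mul_ne_zero hr0 hV0) (ENNReal.mul_ne_top hrt hVt)
  calc ∫⁻ x in A, ‖f x - c‖ₑ ^ n
      = (ENNReal.ofReal (r ^ n) * V)⁻¹ *
        (ENNReal.ofReal (r ^ n) * V * ∫⁻ x in A, ‖f x - c‖ₑ ^ n) := by
        rw [← mul_assoc, hinv, one_mul]
    _ ≤ (ENNReal.ofReal (r ^ n) * V)⁻¹ *
        (C * ENNReal.ofReal (r ^ n) ^ 2 * ∫⁻ x in A, ‖G x‖ₑ ^ n) := mul_le_mul' le_rfl h1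
    _ = ((ENNReal.ofReal (r ^ n))⁻¹ * ENNReal.ofReal (r ^ n)) *
        (V⁻¹ * C * (ENNReal.ofReal (r ^ n) * ∫⁻ x in A, ‖G x‖ₑ ^ n)) := by
        rw [ENNReal.mul_inv (Or.inl hr0) (Or.inl hrt)]; ring
    _ = _ := by rw [ENNReal.inv_mul_cancel hr0 hrt, one_mul]

theorem cutoff_scale_eq_zero {n : ℕ} {a x : E n} {r : ℝ} (hr : 0 < r)
    (hx : x ∉ cube a (4 * r)) : cutoff (r⁻¹ • (x - a)) = 0 := by
  by_contra h
  refine hx ?_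
  have h1 := (add_smul_mem_cube_iff (a := a) hr).2
    (tsupport_cutoff_subset_cube (subset_tsupport _ h))
  rwa [smul_inv_smul₀ hr.ne', add_sub_cancel] at h1

theorem cutoff_scale_eq_one {n : ℕ} {a x : E n} {r : ℝ} (hr : 0 < r)
    (hx : x ∈ cube a r) : cutoff (r⁻¹ • (x - a)) = 1 := by
  refine cutoff_eq_one ((add_smul_mem_cube_iff (a := a) hr).1 ?_)
  rwa [smul_inv_smul₀ hr.ne', add_sub_cancel, one_mul]

theorem continuous_cutoff_scale {n : ℕ} (a : E n) (r : ℝ) :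
    Continuous fun x : E n => cutoff (r⁻¹ • (x - a)) :=
  contDiff_cutoff.continuous.comp (by fun_prop)

/-- The Caccioppoli inequality for Sobolev maps. -/
theorem exists_integral_cutoff_pow_mul_det_le_of_memW1Loc {n : ℕ} (hn : 2 ≤ n) :
    ∃ C : ℝ, 0 ≤ C ∧ ∀ (Ω : Set (E n)) (f : E n → E n) (G : E n → (E n →L[ℝ] E n)), IsOpen Ω →
      MemW1Loc n Ω f G → ∀ (a : E n) (r : ℝ), 0 < r → closure (cube a (4 * r)) ⊆ Ω →
      ∫ x, cutoff (r⁻¹ • (x - a)) ^ n * (G x).det ≤ C * ∫ x in annulus a r, ‖G x‖ ^ n := by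
  have hn0 : n ≠ 0 := by lia
  obtain ⟨C, hC0, hC⟩ := exists_integral_cutoff_pow_mul_det_le hn
  obtain ⟨D, -, hD⟩ := exists_abs_det_le n
  refine ⟨C, hC0, fun Ω f G hΩ h a r hr ha => ?_⟩
  set A := annulus a r
  have hAm : MeasurableSet A := measurableSet_annulus a r
  have hk : IsCompact (closure (cube a (4 * r))) := isCompact_closure_cube _ _
  have hAk : A ⊆ closure (cube a (4 * r)) := (annulus_subset_cube a r).trans subset_closure
  obtain ⟨F, hF, -, hFG⟩ := exists_smooth_approx hn0 hΩ h hk ha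
  have h1 := hFG (fun B => ‖B‖ ^ n) 1 (A.indicator fun _ => 1) (by fun_prop)
    (fun B => by rw [one_mul, abs_of_nonneg (by positivity)])
    (measurable_const.indicator (measurableSet_annulus a r))
    (fun x => by by_cases hx : x ∈ A <;> simp [hx])
    (fun x hx => indicator_of_notMem (fun hxA => hx (hAk hxA)) _)
  simp_rw [integral_indicator_one_mul hAm] at h1
  have h2 := hFG (fun B => B.det) D (fun x => cutoff (r⁻¹ • (x - a)) ^ n)
    ContinuousLinearMap.continuous_det hD ((continuous_cutoff_scale a r).pow n).measurable
    (fun x => by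
      rw [abs_of_nonneg (pow_nonneg (cutoff_nonneg _) _)]
      exact pow_le_one₀ (cutoff_nonneg _) (cutoff_le_one _))
    (fun x hx => by
      rw [cutoff_scale_eq_zero hr fun h => hx (subset_closure h), zero_pow hn0])
  exact le_of_tendsto_of_tendsto' h2 (h1.const_mul C) fun j => hC (F j) (hF j) a r hr

/-- The Zygmund condition includes local integrability, as `log (e + S) ≥ 1`. -/
theorem IsZygmundSolution.integrableOn_S {n : ℕ} {μ : ℝ} (hμ : 0 ≤ μ) {Ω : Set (E n)}
    {f : E n → E n} {G : E n → (E n →L[ℝ] E n)} {K S : E n → ℝ}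
    (h : IsZygmundSolution n μ Ω f G K S) {k : Set (E n)} (hk : IsCompact k) (hkΩ : k ⊆ Ω) :
    IntegrableOn S k := by
  have h1 := h.S_zygmund.integrableOn_compact_subset hkΩ hk
  refine Integrable.mono' h1 (h.S_meas.aestronglyMeasurable.mono_set hkΩ) ?_
  filter_upwards [ae_restrict_mem hk.measurableSet] with x hx
  have h0 := h.S_nonneg x (hkΩ hx)
  rw [Real.norm_of_nonneg h0]
  have h2 : 1 ≤ Real.log (Real.exp 1 + S x) := by
    rw [Real.le_log_iff_exp_le (by positivity)]; linarith
  exact le_mul_of_one_le_right h0 (Real.one_le_rpow h2 hμ)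

/-- The distortion inequality with a constant in place of `K`. Where the determinant is negative,
it is at least `-S`, so that the error made by increasing `K` is absorbed by the inhomogeneity. -/
theorem pow_le_of_mem_distortionSet {n : ℕ} {K S M : ℝ} {A : E n →L[ℝ] E n}
    (h : A ∈ distortionSet n K S) (hK : 1 ≤ K) (hS : 0 ≤ S) (hM : K ≤ M) :
    ‖A‖ ^ n ≤ M * A.det + (1 + M) * S := by
  have h1 : ‖A‖ ^ n ≤ K * A.det + S := h
  have h0 : 0 ≤ ‖A‖ ^ n := by positivity
  rcases le_total 0 A.det with hd | hd
  · nlinarith [mul_le_mul_of_nonneg_right hM hd, mul_nonneg (by linarith : 0 ≤ M) hS]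
  · have h2 : -A.det ≤ S := by nlinarith
    nlinarith [mul_le_mul_of_nonneg_left h2 (sub_nonneg.2 hM), mul_nonneg (by linarith : 0 ≤ K) hS]

/-- The hole-filling inequality: the energy in a cube is controlled by the energy in the
surrounding annulus. -/
theorem exists_hole_filling {n : ℕ} (hn : 2 ≤ n) :
    ∃ C : ℝ, 0 ≤ C ∧ ∀ (μ : ℝ) (Ω : Set (E n)) (f : E n → E n) (G : E n → (E n →L[ℝ] E n))
      (K S : E n → ℝ), 0 ≤ μ → IsZygmundSolution n μ Ω f G K S → ∀ (M : ℝ) (a : E n) (r : ℝ),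
      0 < r → closure (cube a (4 * r)) ⊆ Ω → 0 ≤ M →
      (∀ᵐ x ∂volume.restrict (cube a (4 * r)), K x ≤ M) →
      ∫ x in cube a r, ‖G x‖ ^ n ≤
        M * (C * ∫ x in annulus a r, ‖G x‖ ^ n) + (1 + M) * ∫ x in cube a (4 * r), S x := by
  have hn0 : n ≠ 0 := by lia
  obtain ⟨C, hC0, hC⟩ := exists_integral_cutoff_pow_mul_det_le_of_memW1Loc hn
  obtain ⟨D, -, hD⟩ := exists_abs_det_le n
  refine ⟨C, hC0, fun μ Ω f G K S hμ h M a r hr ha hM hKM => ?_⟩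
  set Q := cube a (4 * r)
  have hQm : MeasurableSet Q := measurableSet_cube _ _
  have hk : IsCompact (closure Q) := isCompact_closure_cube _ _
  have hQΩ : Q ⊆ Ω := subset_closure.trans ha
  have iG : IntegrableOn (fun x => ‖G x‖ ^ n) Q :=
    (h.sobolev.integrableOn_norm_pow hn0 hk ha).mono_set subset_closure
  have iS : IntegrableOn S Q := (h.integrableOn_S hμ hk ha).mono_set subset_closure
  have hGm : AEStronglyMeasurable G (volume.restrict Q) :=
    (h.sobolev.memLp_deriv _ ha hk).aestronglyMeasurable.mono_set subset_closure
  have iD : IntegrableOn (fun x => (G x).det) Q :=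
    (iG.const_mul D).mono' (ContinuousLinearMap.continuous_det.comp_aestronglyMeasurable hGm)
      (Eventually.of_forall fun x => hD (G x))
  set ψ : E n → ℝ := fun x => cutoff (r⁻¹ • (x - a)) ^ n with hψ
  have hψ0 : ∀ x, 0 ≤ ψ x := fun x => pow_nonneg (cutoff_nonneg _) _
  have hψ1 : ∀ x, ψ x ≤ 1 := fun x => pow_le_one₀ (cutoff_nonneg _) (cutoff_le_one _)
  have hψm : AEStronglyMeasurable ψ (volume.restrict Q) :=
    ((continuous_cutoff_scale a r).pow n).aestronglyMeasurable
  have hψi : ∀ {g : E n → ℝ}, IntegrableOn g Q → IntegrableOn (fun x => ψ x * g x) Q := fun hg =>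
    hg.bdd_mul hψm (Eventually.of_forall fun x => by
      rw [Real.norm_of_nonneg (hψ0 x)]; exact hψ1 x)
  have hr4 : cube a r ⊆ Q := cube_mono a (by linarith)
  have s1 : ∫ x in cube a r, ‖G x‖ ^ n ≤ ∫ x in Q, ψ x * ‖G x‖ ^ n := by
    calc ∫ x in cube a r, ‖G x‖ ^ n = ∫ x in cube a r, ψ x * ‖G x‖ ^ n := by
          refine setIntegral_congr_fun (measurableSet_cube a r) fun x hx => ?_
          simp only [hψ, cutoff_scale_eq_one hr hx, one_pow, one_mul]
      _ ≤ _ := setIntegral_mono_set (hψi iG)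
          (Eventually.of_forall fun x => mul_nonneg (hψ0 x) (by positivity)) hr4.eventuallyLE
  have s2 : ∫ x in Q, ψ x * ‖G x‖ ^ n ≤
      ∫ x in Q, (M * (ψ x * (G x).det) + (1 + M) * S x) := by
    refine integral_mono_ae (hψi iG) (((hψi iD).const_mul M).add (iS.const_mul _)) ?_
    filter_upwards [ae_restrict_of_ae_restrict_of_subset hQΩ h.inclusion, hKM,
      ae_restrict_mem hQm] with x h1 h2 h3
    have hS := h.S_nonneg x (hQΩ h3)
    have h4 := pow_le_of_mem_distortionSet h1 (h.one_le_K x (hQΩ h3)) hS h2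
    have h5 : ψ x * S x ≤ S x := mul_le_of_le_one_left hS (hψ1 x)
    nlinarith [mul_le_mul_of_nonneg_left h4 (hψ0 x)]
  have s3 : ∫ x in Q, (M * (ψ x * (G x).det) + (1 + M) * S x)
      = M * (∫ x, ψ x * (G x).det) + (1 + M) * ∫ x in Q, S x := by
    rw [integral_add ((hψi iD).const_mul M) (iS.const_mul _), integral_const_mul,
      integral_const_mul]
    congr 2
    refine setIntegral_eq_integral_of_forall_compl_eq_zero fun x hx => ?_
    simp only [hψ, cutoff_scale_eq_zero hr hx, zero_pow hn0, zero_mul]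
  have s4 := hC Ω f G h.isOpen h.sobolev a r hr ha
  calc _ ≤ _ := s1.trans s2
    _ = _ := s3
    _ ≤ _ := by gcongr

/-! ### Decay of the energy -/

theorem exists_volume_cube_le (n : ℕ) :
    ∃ C : ℝ, 0 ≤ C ∧ ∀ (a : E n) (r : ℝ), 0 ≤ r → volume.real (cube a r) ≤ C * r ^ n := by
  refine ⟨√n ^ n * volume.real (Metric.ball (0 : E n) 1), by positivity, fun a r hr => ?_⟩
  have h := measureReal_mono (μ := volume) (cube_subset_closedBall a hr)
    (isCompact_closedBall a (√n * r)).measure_ne_top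
  rw [Measure.addHaar_real_closedBall _ _ (by positivity), finrank_euclideanSpace,
    Fintype.card_fin, mul_pow] at h
  linarith

theorem exists_half_pow_le_rpow (μ : ℝ) :
    ∃ C : ℝ, 0 ≤ C ∧ ∀ k : ℕ, 1 ≤ k → (1 / 2 : ℝ) ^ k ≤ C * (k : ℝ) ^ (-μ) := by
  obtain ⟨m, hm⟩ := exists_nat_ge μ
  have ht := tendsto_pow_const_mul_const_pow_of_abs_lt_one m
    (show |(1 / 2 : ℝ)| < 1 by rw [abs_of_pos] <;> norm_num)
  obtain ⟨C, hC⟩ := ht.bddAbove_range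
  have hC' : ∀ k : ℕ, (k : ℝ) ^ m * (1 / 2 : ℝ) ^ k ≤ C := fun k => hC ⟨k, rfl⟩
  refine ⟨C, le_trans (by positivity) (hC' 0), fun k hk => ?_⟩
  have hk1 : (1 : ℝ) ≤ k := by exact_mod_cast hk
  have hk0 : (0 : ℝ) < k := by linarith
  have h1 : (k : ℝ) ^ μ ≤ (k : ℝ) ^ m := by
    rw [← Real.rpow_natCast]; exact Real.rpow_le_rpow_of_exponent_le hk1 hm
  rw [Real.rpow_neg hk0.le, ← div_eq_mul_inv, le_div_iff₀ (by positivity)]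
  calc (1 / 2 : ℝ) ^ k * (k : ℝ) ^ μ ≤ (1 / 2 : ℝ) ^ k * (k : ℝ) ^ m := by gcongr
    _ ≤ C := by rw [mul_comm]; exact hC' k

/-- Splitting at the level `2 ^ k`: above it, the logarithm is at least `k log 2`. -/
theorem le_two_pow_add_mul_log {μ : ℝ} (hμ : 0 ≤ μ) {k : ℕ} (hk : 1 ≤ k) {s : ℝ} (hs : 0 ≤ s) :
    s ≤ 2 ^ k + ((k : ℝ) * Real.log 2) ^ (-μ) * (s * Real.log (Real.exp 1 + s) ^ μ) := by
  have hk0 : (0 : ℝ) < k * Real.log 2 :=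
    mul_pos (by exact_mod_cast hk) (Real.log_pos one_lt_two)
  have hl1 : 1 ≤ Real.log (Real.exp 1 + s) := by
    rw [Real.le_log_iff_exp_le (by positivity)]; linarith
  rcases le_total s (2 ^ k) with h | h
  · have : 0 ≤ ((k : ℝ) * Real.log 2) ^ (-μ) * (s * Real.log (Real.exp 1 + s) ^ μ) := by
      have := Real.rpow_nonneg (zero_le_one.trans hl1) μ
      positivity
    linarith
  · have hl : (k : ℝ) * Real.log 2 ≤ Real.log (Real.exp 1 + s) := by
      rw [← Real.log_pow]
      exact Real.log_le_log (by positivity) (by linarith [Real.exp_pos 1])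
    have h2 : 1 ≤ ((k : ℝ) * Real.log 2) ^ (-μ) * Real.log (Real.exp 1 + s) ^ μ := by
      rw [Real.rpow_neg hk0.le, ← div_eq_inv_mul, one_le_div (by positivity)]
      exact Real.rpow_le_rpow hk0.le hl hμ
    have h3 : s * 1 ≤ s * (((k : ℝ) * Real.log 2) ^ (-μ) * Real.log (Real.exp 1 + s) ^ μ) := by
      gcongr
    have h4 : (0 : ℝ) ≤ 2 ^ k := by positivity
    nlinarith

/-- The Zygmund condition makes the integral of `S` over cubes of size `2 ^ (-k)` decay like
`k ^ (-μ)`. -/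
theorem IsZygmundSolution.exists_setIntegral_cube_le {n : ℕ} (hn : 2 ≤ n) {μ : ℝ} (hμ : 0 ≤ μ)
    {Ω : Set (E n)} {f : E n → E n} {G : E n → (E n →L[ℝ] E n)} {K S : E n → ℝ}
    (h : IsZygmundSolution n μ Ω f G K S) {B : Set (E n)} (hB : IsCompact B) (hBΩ : B ⊆ Ω) :
    ∃ C : ℝ, 0 ≤ C ∧ ∀ (a : E n) (k : ℕ), 1 ≤ k → cube a ((1 / 2) ^ k) ⊆ B →
      ∫ x in cube a ((1 / 2) ^ k), S x ≤ C * (k : ℝ) ^ (-μ) := by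
  obtain ⟨C₁, hC₁0, hC₁⟩ := exists_volume_cube_le n
  obtain ⟨C₂, hC₂0, hC₂⟩ := exists_half_pow_le_rpow μ
  set L : E n → ℝ := fun x => S x * Real.log (Real.exp 1 + S x) ^ μ with hL
  have iL : IntegrableOn L B := h.S_zygmund.integrableOn_compact_subset hBΩ hB
  have hL0 : ∀ x ∈ B, 0 ≤ L x := fun x hx => by
    have h0 := h.S_nonneg x (hBΩ hx)
    have h2 : 1 ≤ Real.log (Real.exp 1 + S x) := by
      rw [Real.le_log_iff_exp_le (by positivity)]; linarith
    exact mul_nonneg h0 (Real.rpow_nonneg (zero_le_one.trans h2) μ)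
  have hT0 : 0 ≤ ∫ x in B, L x := setIntegral_nonneg hB.measurableSet hL0
  have hlog2 : 0 < Real.log 2 := Real.log_pos one_lt_two
  refine ⟨C₁ * C₂ + Real.log 2 ^ (-μ) * ∫ x in B, L x, by positivity, fun a k hk hkB => ?_⟩
  set Q := cube a ((1 / 2) ^ k)
  have iS : IntegrableOn S Q := (h.integrableOn_S hμ hB hBΩ).mono_set hkB
  have hv : volume.real Q ≤ C₁ * ((1 / 2) ^ k * (1 / 2) ^ k) := by
    refine (hC₁ a _ (by positivity)).trans ?_
    gcongr
    calc ((1 / 2 : ℝ) ^ k) ^ n ≤ ((1 / 2 : ℝ) ^ k) ^ 2 :=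
          pow_le_pow_of_le_one (by positivity) (pow_le_one₀ (by norm_num) (by norm_num)) hn
      _ = _ := sq _
  have iconst : Integrable (fun _ => (2 : ℝ) ^ k) (volume.restrict Q) :=
    integrableOn_const (volume_cube_lt_top a _).ne
  have hi : ∫ x in Q, S x ≤ ∫ x in Q, (2 ^ k + ((k : ℝ) * Real.log 2) ^ (-μ) * L x) := by
    refine setIntegral_mono_on iS (Integrable.add ?_ ((iL.mono_set hkB).const_mul _))
      (measurableSet_cube _ _)
      fun x hx => le_two_pow_add_mul_log hμ hk (h.S_nonneg x (hBΩ (hkB hx)))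
    exact iconst
  rw [integral_add iconst ((iL.mono_set hkB).const_mul _),
    setIntegral_const, integral_const_mul, smul_eq_mul] at hi
  have h1 : volume.real Q * 2 ^ k ≤ C₁ * (C₂ * (k : ℝ) ^ (-μ)) := by
    calc volume.real Q * 2 ^ k ≤ C₁ * ((1 / 2) ^ k * (1 / 2) ^ k) * 2 ^ k := by gcongr
      _ = C₁ * (1 / 2) ^ k * ((1 / 2) * 2) ^ k := by rw [mul_pow]; ring
      _ = C₁ * (1 / 2) ^ k := by norm_num
      _ ≤ _ := by gcongr; exact hC₂ k hk
  have h2 : ((k : ℝ) * Real.log 2) ^ (-μ) * ∫ x in Q, L x ≤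
      (k : ℝ) ^ (-μ) * Real.log 2 ^ (-μ) * ∫ x in B, L x := by
    rw [Real.mul_rpow (Nat.cast_nonneg k) hlog2.le]
    gcongr
    exact ae_restrict_of_forall_mem hB.measurableSet hL0
  linarith

/-- A contraction with a perturbation of power decay has power decay at the same rate. -/
theorem exists_rpow_decay_of_contraction {θ : ℝ} (hθ0 : 0 ≤ θ) (hθ : θ < 1) {μ : ℝ} (hμ : 0 ≤ μ)
    {C B : ℝ} (hC : 0 ≤ C) (hB : 0 ≤ B) {k₀ : ℕ} (hk₀ : 1 ≤ k₀) :
    ∃ M : ℝ, 0 ≤ M ∧ ∀ u : ℕ → ℝ, (∀ k, k₀ ≤ k → u k ≤ B) →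
      (∀ k, k₀ ≤ k → u (k + 2) ≤ θ * u k + C * (k : ℝ) ^ (-μ)) →
      ∀ k, k₀ ≤ k → u k ≤ M * (k : ℝ) ^ (-μ) := by
  have hlim : Tendsto (fun k : ℕ => θ * (((k + 2 : ℕ) : ℝ) / (k : ℝ)) ^ μ) atTop (𝓝 θ) := by
    have h1 : Tendsto (fun k : ℕ => ((k + 2 : ℕ) : ℝ) / (k : ℝ)) atTop (𝓝 1) := by
      have h2 : Tendsto (fun k : ℕ => 1 + 2 / (k : ℝ)) atTop (𝓝 (1 + 0)) :=
        tendsto_const_nhds.add (tendsto_const_nhds.div_atTop tendsto_natCast_atTop_atTop)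
      rw [add_zero] at h2
      refine h2.congr' ?_
      filter_upwards [eventually_ge_atTop 1] with k hk
      have : (k : ℝ) ≠ 0 := by positivity
      push_cast
      field_simp
    simpa using (h1.rpow_const (p := μ) (Or.inl one_ne_zero)).const_mul θ
  -- beyond `k₁`, replacing `k` by `k + 2` in `k ^ (-μ)` worsens the contraction only to
  -- `(1 + θ) / 2`
  obtain ⟨k₁, hk₁⟩ := eventually_atTop.1
    (hlim.eventually_le_const (show θ < (1 + θ) / 2 by linarith))
  set k₂ := max k₀ k₁
  set M : ℝ := max (B * ((k₂ : ℝ) + 2) ^ μ) (2 * 3 ^ μ * C / (1 - θ)) with hM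
  have hM0 : 0 ≤ M := le_trans (by positivity) (le_max_left _ _)
  refine ⟨M, hM0, fun u hu hrec k hk => ?_⟩
  induction k using Nat.strong_induction_on with
  | _ k ih =>
    have hk0 : (0 : ℝ) < k := by exact_mod_cast lt_of_lt_of_le hk₀ hk
    rcases lt_or_ge k (k₂ + 2) with hlt | hge
    · have h1 : (k : ℝ) ^ μ ≤ ((k₂ : ℝ) + 2) ^ μ :=
        Real.rpow_le_rpow hk0.le (by exact_mod_cast hlt.le) hμ
      rw [Real.rpow_neg hk0.le, ← div_eq_mul_inv, le_div_iff₀ (by positivity)]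
      calc u k * (k : ℝ) ^ μ ≤ B * ((k₂ : ℝ) + 2) ^ μ := by
            gcongr
            exact hu k hk
        _ ≤ M := le_max_left _ _
    · obtain ⟨j, rfl⟩ : ∃ j, k = j + 2 := ⟨k - 2, by lia⟩
      have hj0 : k₀ ≤ j := (le_max_left k₀ k₁).trans (by lia)
      have hj1 : k₁ ≤ j := (le_max_right k₀ k₁).trans (by lia)
      have hj : (1 : ℝ) ≤ j := by exact_mod_cast hk₀.trans hj0
      have hjp : (0 : ℝ) < j := by linarith
      have h1 := hrec j hj0
      have h2 := ih j (by lia) hj0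
      have h3 := hk₁ j hj1
      set q : ℝ := (((j + 2 : ℕ) : ℝ) / (j : ℝ)) ^ μ with hq
      have hq3 : q ≤ 3 ^ μ := by
        refine Real.rpow_le_rpow (by positivity) ?_ hμ
        rw [div_le_iff₀ hjp]; push_cast; linarith
      have hq0 : 0 ≤ q := by positivity
      have hC2 : 2 * 3 ^ μ * C ≤ M * (1 - θ) := by
        rw [← div_le_iff₀ (by linarith)]
        exact le_max_right _ _
      have e1 : (j : ℝ) ^ (-μ) = q * ((j + 2 : ℕ) : ℝ) ^ (-μ) := by
        rw [hq, Real.div_rpow (by positivity) hjp.le, Real.rpow_neg hjp.le,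
          Real.rpow_neg (by positivity)]
        have : (0 : ℝ) < ((j + 2 : ℕ) : ℝ) ^ μ := by positivity
        field_simp
      have hneg : (0 : ℝ) ≤ ((j + 2 : ℕ) : ℝ) ^ (-μ) := by positivity
      calc u (j + 2) ≤ θ * (M * (j : ℝ) ^ (-μ)) + C * (j : ℝ) ^ (-μ) := by
            refine h1.trans ?_; gcongr
        _ = (θ * q * M + q * C) * ((j + 2 : ℕ) : ℝ) ^ (-μ) := by rw [e1]; ring
        _ ≤ ((1 + θ) / 2 * M + 3 ^ μ * C) * ((j + 2 : ℕ) : ℝ) ^ (-μ) := by gcongr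
        _ ≤ M * ((j + 2 : ℕ) : ℝ) ^ (-μ) := by
            gcongr
            linarith

/-- Logarithmic decay of the energy, uniformly over the centres near a given point. -/
theorem IsZygmundSolution.exists_energy_decay {n : ℕ} (hn : 2 ≤ n) {μ : ℝ} (hμ : 0 ≤ μ)
    {Ω : Set (E n)} {f : E n → E n} {G : E n → (E n →L[ℝ] E n)} {K S : E n → ℝ}
    (h : IsZygmundSolution n μ Ω f G K S) {x₀ : E n} (hx₀ : x₀ ∈ Ω) :
    ∃ ρ : ℝ, 0 < ρ ∧ Metric.closedBall x₀ (2 * ρ) ⊆ Ω ∧ ∃ k₀ : ℕ, 1 ≤ k₀ ∧ ∃ M : ℝ, 0 ≤ M ∧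
      ∀ a ∈ Metric.ball x₀ ρ, ∀ k, k₀ ≤ k →
        closure (cube a ((1 / 2) ^ k)) ⊆ Metric.closedBall x₀ (2 * ρ) ∧
        ∫ x in cube a ((1 / 2) ^ k), ‖G x‖ ^ n ≤ M * (k : ℝ) ^ (-μ) := by
  have hn0 : n ≠ 0 := by lia
  obtain ⟨ρ', hρ', hρΩ'⟩ := Metric.nhds_basis_closedBall.mem_iff.1 (h.isOpen.mem_nhds hx₀)
  obtain ⟨ρ, hρ, rfl⟩ : ∃ ρ, 0 < ρ ∧ ρ' = 2 * ρ := ⟨ρ' / 2, by linarith, by ring⟩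
  set B := Metric.closedBall x₀ (2 * ρ)
  have hB : IsCompact B := isCompact_closedBall _ _
  obtain ⟨k₀, hk₀⟩ : ∃ k₀ : ℕ, ∀ k, k₀ ≤ k → √n * (1 / 2 : ℝ) ^ k ≤ ρ := by
    have h1 : Tendsto (fun k : ℕ => √n * (1 / 2 : ℝ) ^ k) atTop (𝓝 (√n * 0)) :=
      (tendsto_pow_atTop_nhds_zero_of_lt_one (by norm_num) (by norm_num)).const_mul _
    rw [mul_zero] at h1
    exact eventually_atTop.1 (h1.eventually_le_const hρ)
  have hsub : ∀ a ∈ Metric.ball x₀ ρ, ∀ k, k₀ ≤ k → closure (cube a ((1 / 2) ^ k)) ⊆ B := by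
    intro a ha k hk
    refine (closure_cube_subset_closedBall a (by positivity)).trans
      (Metric.closedBall_subset_closedBall' ?_)
    have := hk₀ k hk
    rw [Metric.mem_ball] at ha
    linarith
  obtain ⟨M, hM⟩ : ∃ M : ℝ, ∀ᵐ x ∂volume.restrict B, K x ≤ M := by
    have h1 := h.K_locBdd B hρΩ' hB
    refine ⟨(eLpNorm K ⊤ (volume.restrict B)).toReal, ?_⟩
    have h2 := ae_le_eLpNormEssSup (f := K) (μ := volume.restrict B)
    have hfin : eLpNormEssSup K (volume.restrict B) < ⊤ := by
      have := h1.2; rwa [eLpNorm_exponent_top] at this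
    filter_upwards [h2] with x hx
    rw [eLpNorm_exponent_top]
    have := ENNReal.toReal_mono hfin.ne hx
    rw [toReal_enorm] at this
    exact (le_abs_self _).trans this
  obtain ⟨C, hC0, hC⟩ := exists_hole_filling hn
  obtain ⟨D, hD0, hD⟩ := h.exists_setIntegral_cube_le hn hμ hB hρΩ'
  set M' := max M 0
  set c := M' * C
  have hc0 : 0 ≤ c := mul_nonneg (le_max_right _ _) hC0
  have hM'0 : 0 ≤ M' := le_max_right _ _
  have iG : IntegrableOn (fun x => ‖G x‖ ^ n) B := h.sobolev.integrableOn_norm_pow hn0 hB hρΩ'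
  have hGnn : ∀ s : Set (E n), 0 ≤ ∫ x in s, ‖G x‖ ^ n := fun s =>
    integral_nonneg fun x => by positivity
  -- `c` copies of the hole are added to both sides of the hole-filling inequality
  obtain ⟨N, hN0, hN⟩ := exists_rpow_decay_of_contraction (θ := c / (1 + c)) (by positivity)
    (by rw [div_lt_one (by positivity)]; linarith) hμ (C := (1 + M') * D)
    (B := ∫ x in B, ‖G x‖ ^ n) (by positivity) (hGnn B) (k₀ := max k₀ 1) (le_max_right _ _)
  refine ⟨ρ, hρ, hρΩ', max k₀ 1, le_max_right _ _, N, hN0, fun a ha k hk =>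
    ⟨hsub a ha k ((le_max_left _ _).trans hk), ?_⟩⟩
  refine hN (fun k => ∫ x in cube a ((1 / 2) ^ k), ‖G x‖ ^ n) (fun k hk => ?_) (fun k hk => ?_) k hk
  · exact setIntegral_mono_set iG (Eventually.of_forall fun x => by positivity)
      (subset_closure.trans (hsub a ha k ((le_max_left _ _).trans hk))).eventuallyLE
  · have hk0 : k₀ ≤ k := (le_max_left _ _).trans hk
    have e4 : 4 * (1 / 2 : ℝ) ^ (k + 2) = (1 / 2) ^ k := by rw [pow_add]; ring
    have hQB : closure (cube a ((1 / 2) ^ k)) ⊆ B := hsub a ha k hk0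
    have h1 := hC μ Ω f G K S hμ h M' a ((1 / 2) ^ (k + 2)) (by positivity)
      (by rw [e4]; exact hQB.trans hρΩ') hM'0
      (by
        rw [e4]
        filter_upwards [ae_restrict_of_ae_restrict_of_subset (subset_closure.trans hQB) hM]
          with x hx using hx.trans (le_max_left _ _))
    have h2 := hD a k ((le_max_right _ _).trans hk) (subset_closure.trans hQB)
    rw [e4] at h1
    have h3 : ∫ x in annulus a ((1 / 2) ^ (k + 2)), ‖G x‖ ^ n
        = (∫ x in cube a ((1 / 2) ^ k), ‖G x‖ ^ n)
          - ∫ x in cube a ((1 / 2) ^ (k + 2)), ‖G x‖ ^ n := by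
      rw [annulus, e4]
      exact setIntegral_sdiff (measurableSet_cube _ _) (iG.mono_set (subset_closure.trans hQB))
        (cube_mono a (by rw [← e4]; linarith [show (0 : ℝ) ≤ (1 / 2) ^ (k + 2) by positivity]))
    rw [h3] at h1
    have h4 : (1 + M') * ∫ x in cube a ((1 / 2) ^ k), S x ≤ (1 + M') * D * (k : ℝ) ^ (-μ) := by
      rw [mul_assoc]; gcongr
    set u₁ := ∫ x in cube a ((1 / 2) ^ k), ‖G x‖ ^ n
    set u₂ := ∫ x in cube a ((1 / 2) ^ (k + 2)), ‖G x‖ ^ n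
    set w := (1 + M') * D * (k : ℝ) ^ (-μ)
    have hw : 0 ≤ w := by positivity
    have h5 : (1 + c) * u₂ ≤ c * u₁ + w := by
      have : M' * (C * (u₁ - u₂)) = c * u₁ - c * u₂ := by ring
      linarith
    have h6 : u₂ ≤ (c * u₁ + w) / (1 + c) := by
      rw [le_div_iff₀ (by positivity)]; linarith
    calc u₂ ≤ (c * u₁ + w) / (1 + c) := h6
      _ = c / (1 + c) * u₁ + w / (1 + c) := by ring
      _ ≤ c / (1 + c) * u₁ + w := by
          gcongr
          exact div_le_self hw (by linarith)

/-! ### Telescoping over dyadic blocks -/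

/-- If the jumps of a sequence are controlled in the `n`-th power mean by the increments of a
sequence of decay `k ^ (-μ)`, then Hölder's inequality on the block `[k, 2 k]` bounds the
oscillation of the sequence there. -/
theorem norm_sub_le_of_block {V : Type*} [NormedAddCommGroup V] {n : ℕ} (hn : n ≠ 0) {μ C M D : ℝ}
    (hμ : 0 ≤ μ) (hC : 0 ≤ C) (hM : 0 ≤ M) (hD : 0 ≤ D) (hDn : D ^ n = C * (4 * M)) {k₀ : ℕ}
    (hk₀ : 1 ≤ k₀) {u : ℕ → ℝ} (hu0 : ∀ k, 0 ≤ u k) (hu : ∀ k, k₀ ≤ k → u k ≤ M * (k : ℝ) ^ (-μ))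
    {m : ℕ → V}
    (hm : ∀ k, k₀ ≤ k → ‖m k - m (k + 1)‖ ^ n ≤ C * ((u k - u (k + 2)) + (u (k + 1) - u (k + 3))))
    {k j : ℕ} (hk : k₀ ≤ k) (hkj : k ≤ j) (hj : j ≤ 2 * k) :
    ‖m k - m j‖ ≤ D * (k : ℝ) ^ (-((μ - n + 1) / n)) := by
  obtain ⟨N, rfl⟩ := Nat.exists_eq_add_of_le hkj
  have hk0 : (0 : ℝ) < k := by exact_mod_cast lt_of_lt_of_le hk₀ hk
  have hn0 : (n : ℝ) ≠ 0 := by exact_mod_cast hn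
  have hdist : ‖m k - m (k + N)‖ ≤ ∑ i ∈ Finset.range N, ‖m (k + i) - m (k + i + 1)‖ := by
    have := dist_le_range_sum_dist (fun i => m (k + i)) N
    simpa [dist_eq_norm, add_assoc] using this
  have hsum : ∑ i ∈ Finset.range N, ‖m (k + i) - m (k + i + 1)‖ ^ n ≤
      C * (4 * (M * (k : ℝ) ^ (-μ))) := by
    -- the bounds of the jumps telescope: the differences over two steps are sums of one-step
    -- differences
    set w : ℕ → ℝ := fun i => u (k + i) + 2 * u (k + i + 1) + u (k + i + 2) with hw
    have hle : ∀ i, u (k + i) ≤ M * (k : ℝ) ^ (-μ) := fun i => by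
      refine (hu _ (by lia)).trans ?_
      gcongr ?_ * ?_
      exact Real.rpow_le_rpow_of_nonpos hk0 (by exact_mod_cast Nat.le_add_right k i) (by linarith)
    calc ∑ i ∈ Finset.range N, ‖m (k + i) - m (k + i + 1)‖ ^ n
        ≤ ∑ i ∈ Finset.range N, C * (w i - w (i + 1)) := by
          refine Finset.sum_le_sum fun i _ => (hm (k + i) (by lia)).trans_eq ?_
          simp only [hw, ← add_assoc, add_right_comm _ i 1]
          ring_nf
      _ = C * (w 0 - w N) := by rw [← Finset.mul_sum, Finset.sum_range_sub']
      _ ≤ C * (4 * (M * (k : ℝ) ^ (-μ))) := by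
          gcongr
          have h0 := hle 0
          have h1 := hle 1
          have h2 := hle 2
          have h3 := hu0 (k + N)
          have h4 := hu0 (k + N + 1)
          have h5 := hu0 (k + N + 2)
          simp only [hw, add_zero] at h0 ⊢
          linarith
  have hpow : ‖m k - m (k + N)‖ ^ n ≤ (k : ℝ) ^ (n - 1) * (C * (4 * (M * (k : ℝ) ^ (-μ)))) := by
    rcases Nat.eq_zero_or_pos N with rfl | hN
    · rw [add_zero, sub_self, norm_zero, zero_pow hn]; positivity
    obtain ⟨p, rfl⟩ := Nat.exists_eq_succ_of_ne_zero hn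
    -- Hölder's inequality for a sum of at most `k` terms
    have h1 := pow_sum_div_card_le_sum_pow (s := Finset.range N)
      (f := fun i => ‖m (k + i) - m (k + i + 1)‖) (fun i _ => norm_nonneg _) p
    rw [Finset.card_range, div_le_iff₀' (by positivity)] at h1
    calc ‖m k - m (k + N)‖ ^ (p + 1)
        ≤ (∑ i ∈ Finset.range N, ‖m (k + i) - m (k + i + 1)‖) ^ (p + 1) := by gcongr
      _ ≤ (N : ℝ) ^ p * ∑ i ∈ Finset.range N, ‖m (k + i) - m (k + i + 1)‖ ^ (p + 1) := by
          exact h1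
      _ ≤ _ := by
          rw [Nat.succ_eq_add_one, Nat.add_sub_cancel]
          gcongr
          exact_mod_cast (by lia : N ≤ k)
  refine le_of_pow_le_pow_left₀ hn (by positivity) (hpow.trans_eq ?_)
  rw [mul_pow, hDn, ← Real.rpow_natCast (_ ^ _) n, ← Real.rpow_mul hk0.le,
    ← Real.rpow_natCast _ (n - 1), Nat.cast_sub (Nat.one_le_iff_ne_zero.2 hn)]
  have : -((μ - n + 1) / n) * n = ((n : ℝ) - (1 : ℕ)) + (-μ) := by
    field_simp; push_cast; ring
  rw [this, Real.rpow_add hk0]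
  ring

/-- Control on all blocks `[k, 2 k]` with power decay gives convergence, by a geometric series
over the scales `k, 2 k, 4 k, …`. -/
theorem exists_tendsto_of_block {V : Type*} [NormedAddCommGroup V] [CompleteSpace V] {α D : ℝ}
    (hα : 0 < α) (hD : 0 ≤ D) {k₀ : ℕ} (hk₀ : 1 ≤ k₀) {m : ℕ → V}
    (hm : ∀ k j, k₀ ≤ k → k ≤ j → j ≤ 2 * k → ‖m k - m j‖ ≤ D * (k : ℝ) ^ (-α)) :
    ∃ l, Tendsto m atTop (𝓝 l) ∧
      ∀ k, k₀ ≤ k → ‖m k - l‖ ≤ D / (1 - 2 ^ (-α)) * (k : ℝ) ^ (-α) := by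
  set q : ℝ := 2 ^ (-α) with hq
  have hq1 : q < 1 := Real.rpow_lt_one_of_one_lt_of_neg one_lt_two (by linarith)
  have hq0 : 0 ≤ q := by positivity
  set D' := D / (1 - q) with hD'
  have hDD : D + D' * q = D' := by
    have : 1 - q ≠ 0 := by linarith
    rw [hD']; field_simp; ring
  have hD'0 : 0 ≤ D' := div_nonneg hD (by linarith)
  have key : ∀ N k j, j - k ≤ N → k₀ ≤ k → k ≤ j → ‖m k - m j‖ ≤ D' * (k : ℝ) ^ (-α) := by
    intro N
    induction N using Nat.strong_induction_on with
    | _ N ih =>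
      intro k j hN hk hkj
      have hk0 : (0 : ℝ) < k := by exact_mod_cast lt_of_lt_of_le hk₀ hk
      rcases le_total j (2 * k) with h | h
      · refine (hm k j hk hkj h).trans ?_
        gcongr
        nlinarith [mul_nonneg hD'0 hq0]
      · have h1 := hm k (2 * k) hk (by lia) le_rfl
        have h2 : ‖m (2 * k) - m j‖ ≤ D' * (((2 * k : ℕ) : ℝ)) ^ (-α) := by
          rcases Nat.eq_zero_or_pos N with hN0 | hN0
          · have : 2 * k = j := by lia
            rw [this, sub_self, norm_zero]; positivity
          · exact ih (N - 1) (by lia) (2 * k) j (by lia) (by lia) h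
        have e : (((2 * k : ℕ) : ℝ)) ^ (-α) = q * (k : ℝ) ^ (-α) := by
          push_cast
          rw [Real.mul_rpow two_pos.le hk0.le]
        rw [e] at h2
        calc ‖m k - m j‖ ≤ ‖m k - m (2 * k)‖ + ‖m (2 * k) - m j‖ :=
              norm_sub_le_norm_sub_add_norm_sub _ _ _
          _ ≤ D * (k : ℝ) ^ (-α) + D' * (q * (k : ℝ) ^ (-α)) := add_le_add h1 h2
          _ = (D + D' * q) * (k : ℝ) ^ (-α) := by ring
          _ = _ := by rw [hDD]
  have hlim0 : Tendsto (fun k : ℕ => D' * (k : ℝ) ^ (-α)) atTop (𝓝 0) := by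
    have := ((tendsto_rpow_neg_atTop hα).comp tendsto_natCast_atTop_atTop).const_mul D'
    simpa using this
  have hcau : CauchySeq m := by
    refine Metric.cauchySeq_iff'.2 fun ε hε => ?_
    obtain ⟨N, hN⟩ := ((hlim0.eventually_lt_const hε).and (eventually_ge_atTop k₀)).exists
    refine ⟨N, fun j hj => ?_⟩
    rw [dist_comm, dist_eq_norm]
    exact (key (j - N) N j le_rfl hN.2 hj).trans_lt hN.1
  obtain ⟨l, hl⟩ := cauchySeq_tendsto_of_complete hcau
  refine ⟨l, hl, fun k hk => ?_⟩
  refine le_of_tendsto ((tendsto_const_nhds.sub hl).norm) ?_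
  filter_upwards [eventually_ge_atTop k] with j hj using key (j - k) k j le_rfl hk hj

/-! ### Comparison of mean values -/

/-- The thin annulus with radii `3 r / 2` and `2 r` contains a cube of side length `r / 2`. -/
theorem exists_volume_thin_annulus_ge {n : ℕ} (hn : n ≠ 0) :
    ∃ v : ℝ≥0∞, v ≠ 0 ∧ v ≠ ⊤ ∧ ∀ (a : E n) (r : ℝ), 0 < r →
      ENNReal.ofReal (r ^ n) * v ≤ volume (cube a (2 * r) \ cube a (3 / 2 * r)) := by
  refine ⟨ENNReal.ofReal ((1 / 4) ^ n) * volume (Metric.ball (0 : E n) 1),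
    mul_ne_zero (by rw [Ne, ENNReal.ofReal_eq_zero, not_le]; positivity)
      (Metric.measure_ball_pos _ _ one_pos).ne',
    ENNReal.mul_ne_top ENNReal.ofReal_ne_top measure_ball_lt_top.ne, fun a r hr => ?_⟩
  set b : E n := a + WithLp.toLp 2 fun _ => 7 / 4 * r with hb
  have hbi : ∀ i, b i = a i + 7 / 4 * r := fun i => by simp [hb]
  have hsub : Metric.ball b (r / 4) ⊆ cube a (2 * r) \ cube a (3 / 2 * r) := by
    refine (ball_subset_cube b (r / 4)).trans fun x hx => ⟨fun i => ?_, fun h => ?_⟩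
    · have h1 := abs_lt.1 (hx i)
      rw [hbi] at h1
      rw [abs_lt]
      constructor <;> linarith
    · have h1 := abs_lt.1 (hx ⟨0, Nat.pos_of_ne_zero hn⟩)
      have h2 := abs_lt.1 (h ⟨0, Nat.pos_of_ne_zero hn⟩)
      rw [hbi] at h1
      linarith
  refine le_trans (le_of_eq ?_) (measure_mono hsub)
  rw [Measure.addHaar_ball_of_pos volume b (by positivity : 0 < r / 4), finrank_euclideanSpace,
    Fintype.card_fin,
    ← mul_assoc, ← ENNReal.ofReal_mul (by positivity), ← mul_pow]
  congr 3
  ring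

theorem thin_annulus_subset {n : ℕ} (a : E n) {r : ℝ} (hr : 0 < r) :
    cube a (2 * r) \ cube a (3 / 2 * r) ⊆ annulus a r :=
  sdiff_subset_sdiff (cube_mono a (by linarith)) (cube_mono a (by linarith))

theorem thin_annulus_subset_half {n : ℕ} (a : E n) {r : ℝ} (hr : 0 < r) :
    cube a (2 * r) \ cube a (3 / 2 * r) ⊆ annulus a (r / 2) :=
  sdiff_subset_sdiff (cube_mono a (by linarith)) (cube_mono a (by linarith))

theorem thin_annulus_subset_of_close {n : ℕ} {a b : E n} {r : ℝ} (hr : 0 < r)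
    (hab : ∀ i, |a i - b i| ≤ r / 2) :
    cube a (2 * r) \ cube a (3 / 2 * r) ⊆ annulus b r := by
  rintro x ⟨hx, hx'⟩
  refine ⟨fun i => ?_, fun h => hx' fun i => ?_⟩
  · have h1 := abs_sub_le (x i) (a i) (b i)
    linarith [hx i, hab i]
  · have h1 := abs_sub_le (x i) (b i) (a i)
    rw [abs_sub_comm (b i)] at h1
    linarith [h i, hab i]

/-- Approximate mean values `c`, `c'` of `f` over two annuli that share a thin annulus are close,
in terms of bounds `e`, `e'` for the energies in the two annuli. -/
theorem exists_enorm_sub_pow_le_of_overlap {n : ℕ} (hn : n ≠ 0) (C₀ : ℝ≥0) :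
    ∃ C : ℝ≥0, ∀ (f : E n → E n) (a b : E n) (r s : ℝ) (c c' : E n) (e e' : ℝ≥0∞), 0 < s → s ≤ r →
      cube a (2 * r) \ cube a (3 / 2 * r) ⊆ annulus b s →
      AEStronglyMeasurable f (volume.restrict (annulus a r)) →
      ∫⁻ x in annulus a r, ‖f x - c‖ₑ ^ n ≤ C₀ * (ENNReal.ofReal (r ^ n) * e) →
      ∫⁻ x in annulus b s, ‖f x - c'‖ₑ ^ n ≤ C₀ * (ENNReal.ofReal (s ^ n) * e') →
      ‖c - c'‖ₑ ^ n ≤ C * (e + e') := by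
  obtain ⟨v, hv0, hvt, hv⟩ := exists_volume_thin_annulus_ge hn
  have hK : v⁻¹ * (2 ^ n * C₀) ≠ ⊤ := by finiteness
  refine ⟨(v⁻¹ * (2 ^ n * C₀)).toNNReal, fun f a b r s c c' e e' hs hsr hsub hf h1 h2 => ?_⟩
  rw [ENNReal.coe_toNNReal hK]
  have hr : 0 < r := hs.trans_le hsr
  set T := cube a (2 * r) \ cube a (3 / 2 * r)
  set R := ENNReal.ofReal (r ^ n)
  have hR0 : R ≠ 0 := by rw [Ne, ENNReal.ofReal_eq_zero, not_le]; positivity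
  have hRt : R ≠ ⊤ := ENNReal.ofReal_ne_top
  have hTa : T ⊆ annulus a r := thin_annulus_subset a hr
  have hfT : AEStronglyMeasurable f (volume.restrict T) := hf.mono_set hTa
  have hm : AEMeasurable (fun x => ‖c - f x‖ₑ ^ n) (volume.restrict T) :=
    ((aestronglyMeasurable_const.sub hfT).enorm).pow_const n
  have key : R * v * ‖c - c'‖ₑ ^ n ≤ R * (2 ^ n * C₀ * (e + e')) := by
    calc R * v * ‖c - c'‖ₑ ^ n ≤ volume T * ‖c - c'‖ₑ ^ n := by gcongr; exact hv a r hr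
      _ = ∫⁻ _ in T, ‖c - c'‖ₑ ^ n := by rw [setLIntegral_const, mul_comm]
      _ ≤ ∫⁻ x in T, 2 ^ n * (‖c - f x‖ₑ ^ n + ‖f x - c'‖ₑ ^ n) :=
          lintegral_mono fun x => enorm_sub_pow_le _ _ _ _
      _ = 2 ^ n * ((∫⁻ x in T, ‖c - f x‖ₑ ^ n) + ∫⁻ x in T, ‖f x - c'‖ₑ ^ n) := by
          rw [lintegral_const_mul' _ _ (by finiteness), lintegral_add_left' hm]
      _ ≤ 2 ^ n * (C₀ * (R * e) + C₀ * (R * e')) := by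
          refine mul_le_mul' le_rfl (add_le_add ?_ ?_)
          · refine le_trans (le_trans (le_of_eq ?_) (lintegral_mono_set hTa)) h1
            refine lintegral_congr fun x => ?_
            rw [← enorm_neg, neg_sub]
          · refine (lintegral_mono_set hsub).trans (h2.trans ?_)
            gcongr
            exact ENNReal.ofReal_le_ofReal (pow_le_pow_left₀ hs.le hsr n)
      _ = _ := by ring
  rw [mul_assoc, ENNReal.mul_le_mul_iff_right hR0 hRt] at key
  calc ‖c - c'‖ₑ ^ n = v⁻¹ * (v * ‖c - c'‖ₑ ^ n) := by
        rw [← mul_assoc, ENNReal.inv_mul_cancel hv0 hvt, one_mul]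
    _ ≤ v⁻¹ * (2 ^ n * C₀ * (e + e')) := mul_le_mul' le_rfl key
    _ = _ := by ring

/-- At a Lebesgue point, approximate mean values over shrinking annuli converge to the value
of the function. -/
theorem tendsto_center_of_tendsto_average {n : ℕ} (hn : n ≠ 0) {f : E n → E n} {x : E n}
    (hf : LocallyIntegrable f)
    (hx : Tendsto (fun s => (∫⁻ y in Metric.closedBall x s, ‖f y - f x‖ₑ)
      / volume (Metric.closedBall x s)) (𝓝[>] 0) (𝓝 0))
    {r : ℕ → ℝ} (hr : ∀ k, 0 < r k) (hr0 : Tendsto r atTop (𝓝 0)) {C₀ : ℝ≥0} {e : ℕ → ℝ≥0∞}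
    (he : Tendsto e atTop (𝓝 0)) {c : ℕ → E n}
    (hc : ∀ᶠ k in atTop, ∫⁻ y in annulus x (r k), ‖f y - c k‖ₑ ^ n
      ≤ C₀ * (ENNReal.ofReal (r k ^ n) * e k)) :
    Tendsto c atTop (𝓝 (f x)) := by
  set V : ℝ≥0∞ := volume (annulus (0 : E n) 1) with hV
  have hV0 : V ≠ 0 := volume_annulus_unit_pos hn
  have hVt : V ≠ ⊤ := (volume_annulus_lt_top 0 1).ne
  have hsn : 0 < √n * 4 := by
    have : (0 : ℝ) < n := by exact_mod_cast Nat.pos_of_ne_zero hn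
    positivity
  set W : ℝ≥0∞ := ENNReal.ofReal ((√n * 4) ^ n) * volume (Metric.ball (0 : E n) 1)
  have hWt : W ≠ ⊤ := ENNReal.mul_ne_top ENNReal.ofReal_ne_top measure_ball_lt_top.ne
  have hW0 : W ≠ 0 := mul_ne_zero (by rw [Ne, ENNReal.ofReal_eq_zero, not_le]; positivity)
      (Metric.measure_ball_pos _ _ one_pos).ne'
  set s : ℕ → ℝ := fun k => √n * (4 * r k) with hs
  have hs0 : Tendsto s atTop (𝓝[>] 0) := by
    refine tendsto_nhdsWithin_iff.2 ⟨?_, Eventually.of_forall fun k => ?_⟩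
    · simpa using (hr0.const_mul 4).const_mul √n
    · have := hr k
      change 0 < √n * (4 * r k)
      rw [← mul_assoc]; positivity
  set R : ℕ → ℝ≥0∞ := fun k => ENNReal.ofReal (r k ^ n)
  have hR0 : ∀ k, R k ≠ 0 := fun k => by
    have := hr k
    rw [Ne, ENNReal.ofReal_eq_zero, not_le]; positivity
  have hRt : ∀ k, R k ≠ ⊤ := fun k => ENNReal.ofReal_ne_top
  have hvA : ∀ k, volume (annulus x (r k)) = R k * V := fun k => volume_annulus x (hr k)
  have hvB : ∀ k, volume (Metric.closedBall x (s k)) = R k * W := fun k => by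
    have := hr k
    rw [Measure.addHaar_closedBall _ _ (by positivity), finrank_euclideanSpace, Fintype.card_fin,
      ← mul_assoc, ← ENNReal.ofReal_mul (by positivity), ← mul_pow]
    congr 3
    simp only [hs]; ring
  -- `X` and `Y` bound the mean distance of `f` in the annulus from `c k` and from `f x`
  set X : ℕ → ℝ≥0∞ := fun k => (R k * V)⁻¹ * ∫⁻ y in annulus x (r k), ‖f y - c k‖ₑ
  set Y : ℕ → ℝ≥0∞ := fun k => V⁻¹ * W *
    ((∫⁻ y in Metric.closedBall x (s k), ‖f y - f x‖ₑ) / volume (Metric.closedBall x (s k)))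
  have hY : Tendsto Y atTop (𝓝 0) := by
    have := ENNReal.Tendsto.const_mul (a := V⁻¹ * W) (hx.comp hs0)
      (Or.inr (ENNReal.mul_ne_top (ENNReal.inv_ne_top.2 hV0) hWt))
    rwa [mul_zero] at this
  have hXn : ∀ᶠ k in atTop, X k ^ n ≤ V⁻¹ * C₀ * e k := by
    filter_upwards [hc] with k hk
    have hne : R k * V ≠ 0 := mul_ne_zero (hR0 k) hV0
    have hnt : R k * V ≠ ⊤ := ENNReal.mul_ne_top (hRt k) hVt
    have hp : IsProbabilityMeasure ((R k * V)⁻¹ • volume.restrict (annulus x (r k))) := by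
      refine ⟨?_⟩
      rw [Measure.smul_apply, Measure.restrict_apply_univ, hvA, smul_eq_mul,
        ENNReal.inv_mul_cancel hne hnt]
    have hfm : AEStronglyMeasurable (fun y => f y - c k)
        ((R k * V)⁻¹ • volume.restrict (annulus x (r k))) :=
      ((hf.aestronglyMeasurable.restrict).sub aestronglyMeasurable_const).smul_measure _
    have h1 := lintegral_enorm_pow_le _ hfm hn
    rw [lintegral_smul_measure, lintegral_smul_measure, smul_eq_mul, smul_eq_mul] at h1
    refine h1.trans ((mul_le_mul' le_rfl hk).trans_eq ?_)
    calc (R k * V)⁻¹ * (C₀ * (R k * e k)) = ((R k)⁻¹ * R k) * (V⁻¹ * C₀ * e k) := by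
          rw [ENNReal.mul_inv (Or.inl (hR0 k)) (Or.inl (hRt k))]; ring
      _ = _ := by rw [ENNReal.inv_mul_cancel (hR0 k) (hRt k), one_mul]
  have hX : Tendsto X atTop (𝓝 0) := by
    have h1 : Tendsto (fun k => V⁻¹ * C₀ * e k) atTop (𝓝 0) := by
      have := ENNReal.Tendsto.const_mul (a := V⁻¹ * C₀) he
        (Or.inr (ENNReal.mul_ne_top (ENNReal.inv_ne_top.2 hV0) ENNReal.coe_ne_top))
      rwa [mul_zero] at this
    have h2 : Tendsto (fun k => X k ^ n) atTop (𝓝 0) :=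
      tendsto_of_tendsto_of_tendsto_of_le_of_le' tendsto_const_nhds h1
        (Eventually.of_forall fun _ => zero_le) hXn
    have h3 := (ENNReal.continuous_rpow_const (y := (n : ℝ)⁻¹)).tendsto 0 |>.comp h2
    rw [ENNReal.zero_rpow_of_pos (by positivity)] at h3
    refine h3.congr fun k => ?_
    simp only [Function.comp]
    rw [← ENNReal.rpow_natCast, ← ENNReal.rpow_mul, mul_inv_cancel₀ (by exact_mod_cast hn),
      ENNReal.rpow_one]
  rw [tendsto_iff_edist_tendsto_0]
  refine tendsto_of_tendsto_of_tendsto_of_le_of_le tendsto_const_nhds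
    (by simpa using hX.add hY) (fun _ => zero_le) fun k => ?_
  have hne : R k * V ≠ 0 := mul_ne_zero (hR0 k) hV0
  have hnt : R k * V ≠ ⊤ := ENNReal.mul_ne_top (hRt k) hVt
  have hsub : annulus x (r k) ⊆ Metric.closedBall x (s k) :=
    (annulus_subset_cube x (r k)).trans
      (cube_subset_closedBall x (by have := hr k; positivity))
  have hm : AEMeasurable (fun y => ‖f y - c k‖ₑ) (volume.restrict (annulus x (r k))) :=
    ((hf.aestronglyMeasurable.restrict).sub aestronglyMeasurable_const).enorm
  have h1 : R k * V * edist (c k) (f x) ≤ (∫⁻ y in annulus x (r k), ‖f y - c k‖ₑ)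
      + ∫⁻ y in Metric.closedBall x (s k), ‖f y - f x‖ₑ := by
    calc R k * V * edist (c k) (f x) = ∫⁻ _ in annulus x (r k), edist (c k) (f x) := by
          rw [setLIntegral_const, hvA, mul_comm]
      _ ≤ ∫⁻ y in annulus x (r k), (‖f y - c k‖ₑ + ‖f y - f x‖ₑ) := by
          refine lintegral_mono fun y => ?_
          simp only [← edist_eq_enorm_sub]
          exact edist_triangle_left _ _ _
      _ = (∫⁻ y in annulus x (r k), ‖f y - c k‖ₑ) + ∫⁻ y in annulus x (r k), ‖f y - f x‖ₑ :=
          lintegral_add_left' hm _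
      _ ≤ _ := by
          gcongr
  calc edist (c k) (f x) = (R k * V)⁻¹ * (R k * V * edist (c k) (f x)) := by
        rw [← mul_assoc, ENNReal.inv_mul_cancel hne hnt, one_mul]
    _ ≤ (R k * V)⁻¹ * ((∫⁻ y in annulus x (r k), ‖f y - c k‖ₑ)
      + ∫⁻ y in Metric.closedBall x (s k), ‖f y - f x‖ₑ) := mul_le_mul' le_rfl h1
    _ = X k + Y k := by
        rw [mul_add]
        congr 1
        simp only [Y]
        rw [hvB, ENNReal.mul_inv (Or.inl (hR0 k)) (Or.inl (hRt k)), div_eq_mul_inv,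
          ENNReal.mul_inv (Or.inl (hR0 k)) (Or.inl (hRt k))]
        calc (R k)⁻¹ * V⁻¹ * _ = (W * W⁻¹) * ((R k)⁻¹ * V⁻¹ *
              ∫⁻ y in Metric.closedBall x (s k), ‖f y - f x‖ₑ) := by
              rw [ENNReal.mul_inv_cancel hW0 hWt, one_mul]
          _ = _ := by ring

/-! ### The continuous representative -/

/-- The local form of the regularity theorem, in terms of approximate mean values `c a r` of `f`
over the annuli `annulus a r`: along dyadic radii they converge at the asserted rate, those with
close centres are close, and their limits are the values of `f` almost everywhere. -/
theorem IsZygmundSolution.exists_center_estimates {n : ℕ} (hn : 2 ≤ n) {μ : ℝ}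
    (hμ : (n : ℝ) - 1 < μ) {Ω : Set (E n)} {f : E n → E n} {G : E n → (E n →L[ℝ] E n)}
    {K S : E n → ℝ} (h : IsZygmundSolution n μ Ω f G K S) {C₀ : ℝ≥0} {c : E n → ℝ → E n}
    (hc : ∀ (a : E n) (r : ℝ), 0 < r → closure (cube a (4 * r)) ⊆ Ω →
      ∫⁻ x in annulus a r, ‖f x - c a r‖ₑ ^ n
        ≤ C₀ * (ENNReal.ofReal (r ^ n) * ∫⁻ x in annulus a r, ‖G x‖ₑ ^ n))
    {x₀ : E n} (hx₀ : x₀ ∈ Ω) :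
    ∃ ρ : ℝ, 0 < ρ ∧ Metric.ball x₀ ρ ⊆ Ω ∧ ∃ k₀ : ℕ, 1 ≤ k₀ ∧ ∃ D : ℝ, 0 ≤ D ∧
      (∀ a ∈ Metric.ball x₀ ρ, ∃ l, Tendsto (fun k : ℕ => c a ((1 / 2) ^ (k + 2))) atTop (𝓝 l) ∧
        ∀ k : ℕ, k₀ ≤ k → ‖c a ((1 / 2) ^ (k + 2)) - l‖ ≤ D * (k : ℝ) ^ (-((μ - n + 1) / n))) ∧
      (∀ a ∈ Metric.ball x₀ ρ, ∀ b ∈ Metric.ball x₀ ρ, ∀ k : ℕ, k₀ ≤ k →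
        (∀ i, |a i - b i| ≤ (1 / 2) ^ (k + 3)) →
        ‖c a ((1 / 2) ^ (k + 2)) - c b ((1 / 2) ^ (k + 2))‖ ≤
          D * (k : ℝ) ^ (-((μ - n + 1) / n))) ∧
      ∀ᵐ x ∂volume.restrict (Metric.ball x₀ ρ),
        Tendsto (fun k : ℕ => c x ((1 / 2) ^ (k + 2))) atTop (𝓝 (f x)) := by
  have hn0 : n ≠ 0 := by lia
  have hn2 : (2 : ℝ) ≤ n := by exact_mod_cast hn
  have hμ0 : 0 < μ := by linarith
  have hα : 0 < (μ - n + 1) / n := div_pos (by linarith) (by linarith)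
  obtain ⟨ρ, hρ, hBΩ, k₀, hk₀, M, hM0, hM⟩ := h.exists_energy_decay hn hμ0.le hx₀
  obtain ⟨C, hC⟩ := exists_enorm_sub_pow_le_of_overlap hn0 C₀
  set B := Metric.closedBall x₀ (2 * ρ) with hBdef
  have hBc : IsCompact B := isCompact_closedBall _ _
  have iG : IntegrableOn (fun x => ‖G x‖ ^ n) B := h.sobolev.integrableOn_norm_pow hn0 hBc hBΩ
  have hfB : IntegrableOn f B := h.sobolev.weakDeriv.1.integrableOn_compact_subset hBΩ hBc
  set u : E n → ℕ → ℝ := fun a k => ∫ x in cube a ((1 / 2) ^ k), ‖G x‖ ^ n with hu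
  have hu0 : ∀ a k, 0 ≤ u a k := fun a k => integral_nonneg fun x => by positivity
  have e4 : ∀ k : ℕ, 4 * (1 / 2 : ℝ) ^ (k + 2) = (1 / 2) ^ k := fun k => by rw [pow_add]; ring
  have hcubeB : ∀ a ∈ Metric.ball x₀ ρ, ∀ k, k₀ ≤ k → cube a ((1 / 2) ^ k) ⊆ B := fun a ha k hk =>
    subset_closure.trans (hM a ha k hk).1
  have hannB : ∀ a ∈ Metric.ball x₀ ρ, ∀ k, k₀ ≤ k → annulus a ((1 / 2) ^ (k + 2)) ⊆ B :=
    fun a ha k hk => by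
      have := annulus_subset_cube a ((1 / 2) ^ (k + 2))
      rw [e4] at this
      exact this.trans (hcubeB a ha k hk)
  have hE : ∀ a ∈ Metric.ball x₀ ρ, ∀ k, k₀ ≤ k →
      ∫⁻ x in annulus a ((1 / 2) ^ (k + 2)), ‖G x‖ₑ ^ n
        = ENNReal.ofReal (u a k - u a (k + 2)) := fun a ha k hk => by
    rw [← ofReal_integral_norm_pow (iG.mono_set (hannB a ha k hk)), annulus, e4]
    congr 1
    exact setIntegral_sdiff (measurableSet_cube _ _) (iG.mono_set (hcubeB a ha k hk))
      (cube_mono a (by rw [← e4 k]; linarith [show (0 : ℝ) ≤ (1 / 2) ^ (k + 2) by positivity]))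
  have hmono : ∀ a ∈ Metric.ball x₀ ρ, ∀ k, k₀ ≤ k → u a (k + 2) ≤ u a k := fun a ha k hk =>
    setIntegral_mono_set (iG.mono_set (hcubeB a ha k hk))
      (Eventually.of_forall fun x => by positivity)
      (cube_mono a (by
        rw [← e4 k]
        linarith [show (0 : ℝ) ≤ (1 / 2) ^ (k + 2) by positivity])).eventuallyLE
  have hcE : ∀ a ∈ Metric.ball x₀ ρ, ∀ k, k₀ ≤ k →
      ∫⁻ x in annulus a ((1 / 2) ^ (k + 2)), ‖f x - c a ((1 / 2) ^ (k + 2))‖ₑ ^ n ≤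
      C₀ * (ENNReal.ofReal (((1 / 2 : ℝ) ^ (k + 2)) ^ n) *
        ENNReal.ofReal (u a k - u a (k + 2))) := fun a ha k hk => by
    rw [← hE a ha k hk]
    exact hc a _ (by positivity) (by rw [e4]; exact (hM a ha k hk).1.trans hBΩ)
  have toReal : ∀ {v : E n} {e e' : ℝ}, 0 ≤ e → 0 ≤ e' →
      ‖v‖ₑ ^ n ≤ C * (ENNReal.ofReal e + ENNReal.ofReal e') → ‖v‖ ^ n ≤ C * (e + e') := by
    intro v e e' he he' hv
    rw [← ENNReal.ofReal_add he he', ← ENNReal.ofReal_coe_nnreal,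
      ← ENNReal.ofReal_mul C.coe_nonneg, ← ofReal_norm, ← ENNReal.ofReal_pow (norm_nonneg _)] at hv
    exact (ENNReal.ofReal_le_ofReal_iff (by positivity)).1 hv
  have hfm : ∀ a ∈ Metric.ball x₀ ρ, ∀ k, k₀ ≤ k →
      AEStronglyMeasurable f (volume.restrict (annulus a ((1 / 2) ^ (k + 2)))) :=
    fun a ha k hk => hfB.aestronglyMeasurable.mono_set (hannB a ha k hk)
  have hrad : ∀ a ∈ Metric.ball x₀ ρ, ∀ k, k₀ ≤ k →
      ‖c a ((1 / 2) ^ (k + 2)) - c a ((1 / 2) ^ (k + 1 + 2))‖ ^ n ≤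
        C * ((u a k - u a (k + 2)) + (u a (k + 1) - u a (k + 3))) := fun a ha k hk => by
    have hs : (1 / 2 : ℝ) ^ (k + 1 + 2) = (1 / 2) ^ (k + 2) / 2 := by ring
    refine toReal (sub_nonneg.2 (hmono a ha k hk)) (sub_nonneg.2 (hmono a ha (k + 1) (by lia)))
      (hC f a a _ _ _ _ _ _ (by positivity) ?_ ?_ (hfm a ha k hk) (hcE a ha k hk)
        (hcE a ha (k + 1) (by lia)))
    · exact pow_le_pow_of_le_one (by norm_num) (by norm_num) (by lia)
    · rw [hs]; exact thin_annulus_subset_half a (by positivity)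
  -- the constant for one block of scales; the geometric series over the blocks adds a factor
  set D : ℝ := (C * (4 * M)) ^ ((n : ℝ)⁻¹) with hD
  have hDn : D ^ n = C * (4 * M) := Real.rpow_inv_natCast_pow (by positivity) hn0
  have hD0 : 0 ≤ D := by positivity
  have hq : (2 : ℝ) ^ (-((μ - n + 1) / n)) < 1 :=
    Real.rpow_lt_one_of_one_lt_of_neg one_lt_two (by linarith)
  have hq0 : (0 : ℝ) ≤ (2 : ℝ) ^ (-((μ - n + 1) / n)) := by positivity
  have hDD : D ≤ D / (1 - 2 ^ (-((μ - n + 1) / n))) :=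
    le_div_self hD0 (by linarith) (by linarith)
  refine ⟨ρ, hρ, (Metric.ball_subset_closedBall.trans
    (Metric.closedBall_subset_closedBall (by linarith))).trans hBΩ, k₀, hk₀,
    D / (1 - 2 ^ (-((μ - n + 1) / n))), hD0.trans hDD,
    fun a ha => ?_, fun a ha b hb k hk hab => ?_, ?_⟩
  · refine exists_tendsto_of_block hα hD0 hk₀ fun k j hk hkj hj => ?_
    exact norm_sub_le_of_block (m := fun k => c a ((1 / 2) ^ (k + 2))) hn0 hμ0.le C.coe_nonneg hM0
      hD0 hDn hk₀ (hu0 a) (fun k hk => (hM a ha k hk).2) (fun k hk => hrad a ha k hk) hk hkj hj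
  · have hk1 : (1 : ℝ) ≤ k := by exact_mod_cast hk₀.trans hk
    have hk0 : (0 : ℝ) < k := by linarith
    have h1 : ‖c a ((1 / 2) ^ (k + 2)) - c b ((1 / 2) ^ (k + 2))‖ ^ n ≤
        C * ((u a k - u a (k + 2)) + (u b k - u b (k + 2))) := by
      refine toReal (sub_nonneg.2 (hmono a ha k hk)) (sub_nonneg.2 (hmono b hb k hk))
        (hC f a b _ _ _ _ _ _ (by positivity) le_rfl ?_ (hfm a ha k hk) (hcE a ha k hk)
          (hcE b hb k hk))
      refine thin_annulus_subset_of_close (by positivity) fun i => (hab i).trans (le_of_eq ?_)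
      ring
    have h2 : ‖c a ((1 / 2) ^ (k + 2)) - c b ((1 / 2) ^ (k + 2))‖ ≤
        D * (k : ℝ) ^ (-((μ - n + 1) / n)) := by
      refine le_of_pow_le_pow_left₀ hn0 (by positivity) (h1.trans ?_)
      rw [mul_pow, hDn, ← Real.rpow_natCast (_ ^ _) n, ← Real.rpow_mul hk0.le, mul_assoc]
      have e : -((μ - n + 1) / n) * n = -μ + (n - 1) := by field_simp; ring
      have h3 : (k : ℝ) ^ (-μ) ≤ (k : ℝ) ^ (-((μ - n + 1) / n) * n) :=
        Real.rpow_le_rpow_of_exponent_le hk1 (by rw [e]; linarith)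
      have h4 := (hM a ha k hk).2
      have h5 := (hM b hb k hk).2
      have h6 := hu0 a (k + 2)
      have h7 := hu0 b (k + 2)
      have h8 := mul_le_mul_of_nonneg_left h3 hM0
      have h9 : 0 ≤ M * (k : ℝ) ^ (-μ) := by positivity
      gcongr
      simp only [hu] at h6 h7 ⊢
      linarith
    exact h2.trans (by gcongr)
  · have hfe : LocallyIntegrable (zeroExtend B f) :=
      (integrable_zeroExtend hBc.measurableSet hfB).locallyIntegrable
    -- almost every point is a Lebesgue point
    have hleb :=
      (Besicovitch.vitaliFamily (volume : Measure (E n))).ae_tendsto_lintegral_enorm_sub_div hfe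
    filter_upwards [ae_restrict_of_ae hleb, ae_restrict_mem Metric.isOpen_ball.measurableSet]
      with x hx hxb
    have hxB : x ∈ B := Metric.ball_subset_closedBall.trans
      (Metric.closedBall_subset_closedBall (by linarith)) hxb
    have hx' := hx.comp (Besicovitch.tendsto_filterAt volume x)
    rw [← zeroExtend_of_mem hxB f]
    refine tendsto_center_of_tendsto_average hn0 hfe hx' (r := fun k => (1 / 2) ^ (k + 2))
      (C₀ := C₀) (e := fun k => ENNReal.ofReal (u x k - u x (k + 2)))
      (fun k => by positivity) ?_ ?_ ?_
    · exact (tendsto_pow_atTop_nhds_zero_of_lt_one (by norm_num) (by norm_num)).comp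
        (tendsto_add_atTop_nat 2)
    · have hlim0 : Tendsto (fun k : ℕ => M * (k : ℝ) ^ (-μ)) atTop (𝓝 0) := by
        have := ((tendsto_rpow_neg_atTop hμ0).comp tendsto_natCast_atTop_atTop).const_mul M
        simpa using this
      have hlim1 : Tendsto (fun k : ℕ => ENNReal.ofReal (M * (k : ℝ) ^ (-μ))) atTop (𝓝 0) := by
        have := (ENNReal.continuous_ofReal.tendsto 0).comp hlim0
        simpa [Function.comp_def] using this
      refine tendsto_of_tendsto_of_tendsto_of_le_of_le' tendsto_const_nhds hlim1
        (Eventually.of_forall fun _ => zero_le) ?_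
      filter_upwards [eventually_ge_atTop k₀] with k hk
      refine ENNReal.ofReal_le_ofReal ?_
      have h1 := (hM x hxb k hk).2
      have h2 := hu0 x (k + 2)
      simp only [hu] at h2 ⊢
      linarith
    · filter_upwards [eventually_ge_atTop k₀] with k hk
      refine le_trans (le_of_eq ?_) (hcE x hxb k hk)
      refine setLIntegral_congr_fun (measurableSet_annulus _ _) fun y hy => ?_
      rw [zeroExtend_of_mem (hannB x hxb k hk hy)]

/-- A dyadic modulus of continuity at a point is a logarithmic one. -/
theorem hasLogModulusAt_of_dyadic {n : ℕ} {Ω : Set (E n)} {g : E n → E n} {x₀ : E n} {α D ρ : ℝ}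
    (hα : 0 ≤ α) (hD : 0 ≤ D) (hρ : 0 < ρ) {k₀ : ℕ} (hk₀ : 1 ≤ k₀)
    (hg : ∀ x ∈ Metric.ball x₀ ρ, ∀ k : ℕ, k₀ ≤ k → ‖x - x₀‖ ≤ (1 / 2) ^ (k + 3) →
      ‖g x₀ - g x‖ ≤ D * (k : ℝ) ^ (-α)) :
    HasLogModulusAt Ω g x₀ α := by
  have hlog2 : 0 < Real.log 2 := Real.log_pos one_lt_two
  refine ⟨D * (5 * Real.log 2) ^ α, ?_⟩
  have hδ : 0 < min ρ ((1 / 2 : ℝ) ^ (k₀ + 3)) := lt_min hρ (by positivity)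
  filter_upwards [Ioo_mem_nhdsGT hδ] with r hr
  have hr0 : 0 < r := hr.1
  have hrρ : r < ρ := hr.2.trans_le (min_le_left _ _)
  have hrk : r < (1 / 2 : ℝ) ^ (k₀ + 3) := hr.2.trans_le (min_le_right _ _)
  have hr1 : r ≤ 1 := hrk.le.trans (pow_le_one₀ (by norm_num) (by norm_num))
  obtain ⟨N, hN1, hN2⟩ := exists_nat_pow_near_of_lt_one hr0 hr1
    (show (0 : ℝ) < 1 / 2 by norm_num) (by norm_num)
  have hNk : k₀ + 3 ≤ N := by
    have := hN1.trans hrk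
    have := (pow_lt_pow_iff_right_of_lt_one₀ (show (0 : ℝ) < 1 / 2 by norm_num)
      (by norm_num)).1 this
    lia
  obtain ⟨k, rfl⟩ : ∃ k, N = k + 3 := ⟨N - 3, by lia⟩
  have hk : k₀ ≤ k := by lia
  have hk1 : (1 : ℝ) ≤ k := by exact_mod_cast hk₀.trans hk
  have hL : Real.log (1 / r) ≤ k * (5 * Real.log 2) := by
    -- `k + 4 ≤ 5 k`
    have h1 : 1 / r ≤ 2 ^ (k + 3 + 1) := by
      rw [div_le_iff₀ hr0]
      have : (2 : ℝ) ^ (k + 3 + 1) * (1 / 2) ^ (k + 3 + 1) ≤ 2 ^ (k + 3 + 1) * r := by gcongr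
      rwa [← mul_pow, mul_one_div_cancel two_ne_zero, one_pow] at this
    have h2 := Real.log_le_log (by positivity) h1
    rw [Real.log_pow] at h2
    push_cast at h2
    nlinarith
  have hL0 : 0 < Real.log (1 / r) := by
    refine Real.log_pos ?_
    rw [lt_div_iff₀ hr0, one_mul]
    exact hrk.trans_le (pow_le_one₀ (by norm_num) (by norm_num))
  have hkα : (k : ℝ) ^ (-α) ≤ (5 * Real.log 2) ^ α * Real.log (1 / r) ^ (-α) := by
    have h5 : (0 : ℝ) < 5 * Real.log 2 := by positivity
    have h1 : (k : ℝ) ^ (-α) ≤ (Real.log (1 / r) / (5 * Real.log 2)) ^ (-α) :=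
      Real.rpow_le_rpow_of_nonpos (by positivity) (by rwa [div_le_iff₀ h5]) (by linarith)
    rw [Real.div_rpow hL0.le h5.le, Real.rpow_neg h5.le, div_inv_eq_mul, mul_comm] at h1
    exact h1
  refine iSup₂_le fun x hx => ENNReal.ofReal_le_ofReal ?_
  refine (hg x ?_ k hk (hx.2.trans hN2)).trans ?_
  · rw [mem_ball_iff_norm]; exact hx.2.trans_lt hrρ
  · rw [mul_assoc]; gcongr

/-- Existence of a continuous representative with a logarithmic modulus of continuity: the limit of
approximate mean values over shrinking annuli. -/
theorem IsZygmundSolution.exists_continuous_representative {n : ℕ} (hn : 2 ≤ n) {μ : ℝ}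
    (hμ : (n : ℝ) - 1 < μ) {Ω : Set (E n)} {f : E n → E n} {G : E n → (E n →L[ℝ] E n)}
    {K S : E n → ℝ} (h : IsZygmundSolution n μ Ω f G K S) :
    ∃ g : E n → E n, ContinuousOn g Ω ∧ f =ᵐ[volume.restrict Ω] g ∧
      ∀ x₀ ∈ Ω, HasLogModulusAt Ω g x₀ ((μ - n + 1) / n) := by
  have hn2 : (2 : ℝ) ≤ n := by exact_mod_cast hn
  set α : ℝ := (μ - n + 1) / n with hαdef
  have hα : 0 < α := div_pos (by linarith) (by linarith)
  obtain ⟨C₀, hC₀⟩ := exists_lintegral_annulus_sub_le hn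
  have hex : ∀ (a : E n) (r : ℝ), ∃ c : E n, 0 < r → closure (cube a (4 * r)) ⊆ Ω →
      ∫⁻ x in annulus a r, ‖f x - c‖ₑ ^ n
        ≤ C₀ * (ENNReal.ofReal (r ^ n) * ∫⁻ x in annulus a r, ‖G x‖ₑ ^ n) := by
    intro a r
    by_cases hr : 0 < r ∧ closure (cube a (4 * r)) ⊆ Ω
    · obtain ⟨c, hc⟩ := hC₀ Ω f G h.isOpen h.sobolev a r hr.1 hr.2
      exact ⟨c, fun _ _ => hc⟩
    · exact ⟨0, fun h1 h2 => (hr ⟨h1, h2⟩).elim⟩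
  choose c hc using hex
  set g : E n → E n := fun a => limUnder atTop fun k : ℕ => c a ((1 / 2) ^ (k + 2)) with hg
  have hlocal := fun x₀ (hx₀ : x₀ ∈ Ω) => h.exists_center_estimates hn hμ hc hx₀
  have hgl : ∀ {a l : E n}, Tendsto (fun k : ℕ => c a ((1 / 2) ^ (k + 2))) atTop (𝓝 l) → g a = l :=
    fun hl => hl.limUnder_eq
  have hmod : ∀ x₀ ∈ Ω, ∃ ρ : ℝ, 0 < ρ ∧ ∃ k₀ : ℕ, 1 ≤ k₀ ∧ ∃ D : ℝ, 0 ≤ D ∧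
      ∀ x ∈ Metric.ball x₀ ρ, ∀ k : ℕ, k₀ ≤ k → ‖x - x₀‖ ≤ (1 / 2) ^ (k + 3) →
        ‖g x₀ - g x‖ ≤ D * (k : ℝ) ^ (-α) := by
    intro x₀ hx₀
    obtain ⟨ρ, hρ, -, k₀, hk₀, D, hD, h1, h2, -⟩ := hlocal x₀ hx₀
    have hx₀b := Metric.mem_ball_self (x := x₀) hρ
    refine ⟨ρ, hρ, k₀, hk₀, 3 * D, by positivity, fun x hx k hk hxk => ?_⟩
    obtain ⟨l, hl, hl'⟩ := h1 x hx
    obtain ⟨l₀, hl₀, hl₀'⟩ := h1 x₀ hx₀b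
    rw [hgl hl, hgl hl₀]
    have b1 := hl' k hk
    have b2 := hl₀' k hk
    have b3 := h2 x₀ hx₀b x hx k hk fun i => by
      rw [abs_sub_comm]
      exact (PiLp.norm_apply_le (x - x₀) i).trans hxk
    set p := c x₀ ((1 / 2) ^ (k + 2))
    set q := c x ((1 / 2) ^ (k + 2))
    calc ‖l₀ - l‖ = ‖(p - q) - (p - l₀) + (q - l)‖ := by congr 1; abel
      _ ≤ ‖p - q‖ + ‖p - l₀‖ + ‖q - l‖ := (norm_add_le _ _).trans (by gcongr; exact norm_sub_le _ _)
      _ ≤ _ := by linarith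
  refine ⟨g, fun x₀ hx₀ => ContinuousAt.continuousWithinAt ?_, ?_, fun x₀ hx₀ => ?_⟩
  · obtain ⟨ρ, hρ, k₀, hk₀, D, hD, hb⟩ := hmod x₀ hx₀
    rw [Metric.continuousAt_iff]
    intro ε hε
    have hlim0 : Tendsto (fun k : ℕ => D * (k : ℝ) ^ (-α)) atTop (𝓝 0) := by
      have := ((tendsto_rpow_neg_atTop hα).comp tendsto_natCast_atTop_atTop).const_mul D
      simpa using this
    obtain ⟨k, hk1, hk2⟩ := ((hlim0.eventually_lt_const hε).and (eventually_ge_atTop k₀)).exists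
    refine ⟨min ρ ((1 / 2) ^ (k + 3)), lt_min hρ (by positivity), fun x hx => ?_⟩
    rw [dist_comm, dist_eq_norm]
    refine (hb x (hx.trans_le (min_le_left _ _)) k hk2 ?_).trans_lt hk1
    rw [← dist_eq_norm]
    exact hx.le.trans (min_le_right _ _)
  · rw [Filter.EventuallyEq, ae_restrict_iff' h.isOpen.measurableSet, ae_iff]
    refine measure_null_of_locally_null _ fun x₀ hx₀ => ?_
    have hx₀Ω : x₀ ∈ Ω := by
      by_contra hne
      exact hx₀ fun h => (hne h).elim
    obtain ⟨ρ, hρ, -, k₀, hk₀, D, hD, -, -, hae⟩ := hlocal x₀ hx₀Ω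
    refine ⟨{a | ¬(a ∈ Ω → f a = g a)} ∩ Metric.ball x₀ ρ,
      inter_mem_nhdsWithin _ (Metric.ball_mem_nhds x₀ hρ), ?_⟩
    rw [ae_restrict_iff' Metric.isOpen_ball.measurableSet, ae_iff] at hae
    refine measure_mono_null (fun x hx => ?_) hae
    exact fun hcon => hx.1 fun _ => (hgl (hcon hx.2)).symm
  · obtain ⟨ρ, hρ, k₀, hk₀, D, hD, hb⟩ := hmod x₀ hx₀
    exact hasLogModulusAt_of_dyadic hα.le hD hρ hk₀ hb

/-! ### The logarithmic example -/

/-- The function `t ↦ log^{-s}(1 + 1/t)` on `(0, ∞)`, which vanishes at `0` for `s ≠ 0`: there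
`1 / 0 = 0` and `log 1 = 0`. -/
noncomputable def logProfile (s t : ℝ) : ℝ := Real.log (1 + 1 / t) ^ (-s)

/-- The derivative of `logProfile s` on `(0, ∞)`. -/
noncomputable def logProfileDeriv (s t : ℝ) : ℝ := s * logProfile (s + 1) t / (t * (t + 1))

theorem log_one_add_one_div_pos {t : ℝ} (ht : 0 < t) : 0 < Real.log (1 + 1 / t) :=
  Real.log_pos (by have : 0 < 1 / t := by positivity
                   linarith)

theorem log_one_add_one_div_nonneg {t : ℝ} (ht : 0 ≤ t) : 0 ≤ Real.log (1 + 1 / t) :=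
  Real.log_nonneg (by have : 0 ≤ 1 / t := by positivity
                      linarith)

theorem logProfile_zero {s : ℝ} (hs : s ≠ 0) : logProfile s 0 = 0 := by
  simp [logProfile, Real.zero_rpow (neg_ne_zero.2 hs)]

theorem logProfile_nonneg (s : ℝ) {t : ℝ} (ht : 0 ≤ t) : 0 ≤ logProfile s t :=
  Real.rpow_nonneg (log_one_add_one_div_nonneg ht) _

theorem logProfileDeriv_nonneg {s : ℝ} (hs : 0 ≤ s) {t : ℝ} (ht : 0 ≤ t) :
    0 ≤ logProfileDeriv s t := by
  have := logProfile_nonneg (s + 1) ht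
  unfold logProfileDeriv
  positivity

theorem logProfile_le_logProfile {s : ℝ} (hs : 0 < s) {t t' : ℝ} (ht : 0 ≤ t) (h : t ≤ t') :
    logProfile s t ≤ logProfile s t' := by
  rcases ht.eq_or_lt with rfl | ht
  · rw [logProfile_zero hs.ne']
    exact logProfile_nonneg s h
  · exact Real.rpow_le_rpow_of_nonpos (log_one_add_one_div_pos (ht.trans_le h))
      (Real.log_le_log (by have : 0 < t' := ht.trans_le h
                           positivity) (by gcongr)) (by linarith)

theorem hasDerivAt_logProfile (s : ℝ) {t : ℝ} (ht : 0 < t) :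
    HasDerivAt (logProfile s) (logProfileDeriv s t) t := by
  have h1 : HasDerivAt (fun t : ℝ => 1 + 1 / t) (-(t ^ 2)⁻¹) t := by
    simpa using (hasDerivAt_inv ht.ne').const_add 1
  have h2 := (h1.log (by positivity)).rpow_const (p := -s)
    (Or.inl (log_one_add_one_div_pos ht).ne')
  refine h2.congr_deriv ?_
  rw [logProfileDeriv, logProfile, neg_add, ← sub_eq_add_neg]
  field_simp

theorem tendsto_logProfile_zero {s : ℝ} (hs : 0 < s) :
    Tendsto (logProfile s) (𝓝[>] 0) (𝓝 0) := by
  have h1 : Tendsto (fun t : ℝ => 1 + 1 / t) (𝓝[>] 0) atTop := by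
    simpa using tendsto_atTop_add_const_left _ 1 (tendsto_inv_nhdsGT_zero (𝕜 := ℝ))
  exact (tendsto_rpow_neg_atTop hs).comp (Real.tendsto_log_atTop.comp h1)

theorem continuousOn_logProfile {s : ℝ} (hs : 0 < s) : ContinuousOn (logProfile s) (Ici 0) := by
  intro t ht
  rcases (mem_Ici.1 ht).eq_or_lt with rfl | ht
  · rw [← Ioi_insert, continuousWithinAt_insert_self, ContinuousWithinAt, logProfile_zero hs.ne']
    exact tendsto_logProfile_zero hs
  · exact (hasDerivAt_logProfile s ht).continuousAt.continuousWithinAt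

theorem continuousOn_logProfileDeriv (s : ℝ) : ContinuousOn (logProfileDeriv s) (Ioi 0) := by
  refine ContinuousOn.div (continuousOn_const.mul fun t ht =>
    (hasDerivAt_logProfile (s + 1) ht).continuousAt.continuousWithinAt) (by fun_prop) fun t ht => ?_
  have : 0 < t := ht
  positivity

theorem measurable_logProfile (s : ℝ) : Measurable (logProfile s) := by
  unfold logProfile
  fun_prop

theorem measurable_logProfileDeriv (s : ℝ) : Measurable (logProfileDeriv s) := by
  unfold logProfileDeriv
  have := measurable_logProfile (s + 1)
  fun_prop

theorem logProfileDeriv_le {s : ℝ} (hs : 0 < s) {t : ℝ} (ht : 0 < t) (ht2 : t ≤ 2) :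
    logProfileDeriv s t ≤ s * logProfile (s + 1) 2 / t := by
  have h1 := logProfile_le_logProfile (show 0 < s + 1 by linarith) ht.le ht2
  have h2 := logProfile_nonneg (s + 1) zero_le_two
  unfold logProfileDeriv
  gcongr
  nlinarith

/-- `r⁻¹ log^{-1-δ}(1 + 1/r²)` is integrable near `0`: up to a bounded factor it is the derivative
of `log^{-δ}(1 + 1/r²)`. -/
theorem integrableOn_logProfile_div {δ : ℝ} (hδ : 0 < δ) :
    IntegrableOn (fun r => logProfile (δ + 1) (r ^ 2) / r) (Ioo 0 1) := by
  have h1 : IntegrableOn (fun r : ℝ => logProfileDeriv δ (r ^ 2) * (2 * r)) (Ioc 0 1) := by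
    refine intervalIntegral.integrableOn_deriv_of_nonneg (g := fun r => logProfile δ (r ^ 2))
      ((continuousOn_logProfile hδ).comp (by fun_prop) fun r _ => sq_nonneg r) (fun r hr => ?_)
      fun r hr => ?_
    · have hr2 : 0 < r ^ 2 := pow_pos hr.1 2
      have := HasDerivAt.comp (h₂ := logProfile δ) (h := fun r : ℝ => r ^ 2) r
        (hasDerivAt_logProfile δ hr2) (hasDerivAt_pow 2 r)
      simpa [Function.comp_def] using this
    · have := logProfileDeriv_nonneg hδ.le (sq_nonneg r)
      have hr0 : 0 < r := hr.1
      positivity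
  refine ((h1.mono_set Ioo_subset_Ioc_self).const_mul δ⁻¹).mono'
    (((measurable_logProfile _).comp (by fun_prop)).div measurable_id).aestronglyMeasurable ?_
  filter_upwards [ae_restrict_mem measurableSet_Ioo] with r hr
  have hr0 : 0 < r := hr.1
  have hr1 : r ^ 2 ≤ 1 := pow_le_one₀ hr0.le hr.2.le
  have hL := logProfile_nonneg (δ + 1) (sq_nonneg r)
  rw [Real.norm_of_nonneg (by positivity)]
  have e : δ⁻¹ * (logProfileDeriv δ (r ^ 2) * (2 * r))
      = logProfile (δ + 1) (r ^ 2) / r * (2 / (r ^ 2 + 1)) := by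
    unfold logProfileDeriv
    field_simp
  rw [e]
  refine le_mul_of_one_le_right (by positivity) ?_
  rw [le_div_iff₀ (by positivity)]
  linarith

/-- A linear map of rank at most one has determinant zero in dimension at least two. -/
theorem det_smulRight_eq_zero {n : ℕ} (hn : 2 ≤ n) (ℓ : E n →L[ℝ] ℝ) (i : Fin n) :
    (ℓ.smulRight (EuclideanSpace.single i (1 : ℝ)) : E n →L[ℝ] E n).det = 0 := by
  by_contra hdet
  have : Nontrivial (Fin n) := Fin.nontrivial_iff_two_le.2 hn
  obtain ⟨j, hj⟩ := exists_ne i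
  have hker : ((ℓ.smulRight (EuclideanSpace.single i (1 : ℝ)) : E n →L[ℝ] E n) :
      E n →ₗ[ℝ] E n).ker = ⊥ := by
    by_contra hne
    exact hdet (LinearMap.det_eq_zero_iff_ker_ne_bot.2 hne)
  obtain ⟨x, hx⟩ := LinearMap.injective_iff_surjective.1 (LinearMap.ker_eq_bot.1 hker)
    (EuclideanSpace.single j (1 : ℝ))
  have := congrArg (fun v : E n => v j) hx
  simp [hj] at this

/-- The map `x ↦ log^{-γ}(1 + 1/|x|²) e_i`, the example showing sharpness. -/
noncomputable def logMap {n : ℕ} (γ : ℝ) (i : Fin n) (x : E n) : E n :=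
  logProfile γ (‖x‖ ^ 2) • EuclideanSpace.single i (1 : ℝ)

/-- The derivative of `logMap γ i` away from the origin, extended by zero to the origin. -/
noncomputable def logMapDeriv {n : ℕ} (γ : ℝ) (i : Fin n) (x : E n) : E n →L[ℝ] E n :=
  ((2 * logProfileDeriv γ (‖x‖ ^ 2)) • innerSL ℝ x).smulRight (EuclideanSpace.single i (1 : ℝ))

theorem norm_logMapDeriv {n : ℕ} {γ : ℝ} (hγ : 0 ≤ γ) (i : Fin n) (x : E n) :
    ‖logMapDeriv γ i x‖ = 2 * logProfileDeriv γ (‖x‖ ^ 2) * ‖x‖ := by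
  have := logProfileDeriv_nonneg hγ (sq_nonneg ‖x‖)
  rw [logMapDeriv, ContinuousLinearMap.norm_smulRight_apply, norm_smul, innerSL_apply_norm,
    Real.norm_of_nonneg (by positivity)]
  simp

theorem norm_logMapDeriv_le {n : ℕ} {γ : ℝ} (hγ : 0 ≤ γ) (i : Fin n) (x : E n) :
    ‖logMapDeriv γ i x‖ ≤ 2 * γ * logProfile (γ + 1) (‖x‖ ^ 2) / ‖x‖ := by
  rw [norm_logMapDeriv hγ]
  rcases (norm_nonneg x).eq_or_lt with h | h
  · simp [← h]
  · have := logProfile_nonneg (γ + 1) (sq_nonneg ‖x‖)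
    have e : 2 * logProfileDeriv γ (‖x‖ ^ 2) * ‖x‖
        = 2 * γ * logProfile (γ + 1) (‖x‖ ^ 2) / ‖x‖ / (‖x‖ ^ 2 + 1) := by
      unfold logProfileDeriv
      field_simp
    rw [e]
    exact div_le_self (by positivity) (by nlinarith)

theorem continuous_logMap {n : ℕ} {γ : ℝ} (hγ : 0 < γ) (i : Fin n) :
    Continuous (logMap γ i : E n → E n) :=
  ((continuousOn_logProfile hγ).comp_continuous (by fun_prop) fun x => sq_nonneg ‖x‖).smul
    continuous_const

theorem aestronglyMeasurable_logMapDeriv {n : ℕ} {γ : ℝ} (i : Fin n) (ν : Measure (E n)) :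
    AEStronglyMeasurable (logMapDeriv γ i) ν := by
  have h1 : Continuous fun ℓ : E n →L[ℝ] ℝ =>
      ℓ.smulRight (EuclideanSpace.single i (1 : ℝ) : E n) :=
    ((ContinuousLinearMap.smulRightL ℝ (E n) (E n)).flip _).continuous
  refine h1.comp_aestronglyMeasurable (AEStronglyMeasurable.fun_smul ?_ ?_)
  · have := (measurable_logProfileDeriv γ).comp (measurable_norm.pow_const 2 : Measurable
      fun x : E n => ‖x‖ ^ 2)
    exact (this.const_mul 2).aestronglyMeasurable
  · exact (innerSL ℝ).continuous.aestronglyMeasurable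

theorem integrableOn_ball_logProfile_div {n : ℕ} (hn : n ≠ 0) {δ : ℝ} (hδ : 0 < δ) :
    IntegrableOn (fun x : E n => logProfile (δ + 1) (‖x‖ ^ 2) / ‖x‖ ^ n) (Metric.ball 0 1) := by
  have : Nontrivial (E n) :=
    Module.nontrivial_of_finrank_pos (R := ℝ) (by rw [finrank_euclideanSpace_fin]; lia)
  refine (integrableOn_fun_norm_addHaar volume
    (f := fun r : ℝ => logProfile (δ + 1) (r ^ 2) / r ^ n)).2 ?_
  refine (integrableOn_logProfile_div hδ).congr_fun (fun r hr => ?_) measurableSet_Ioo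
  have hr0 : 0 < r := hr.1
  obtain ⟨m, rfl⟩ := Nat.exists_eq_succ_of_ne_zero hn
  rw [finrank_euclideanSpace_fin, smul_eq_mul, Nat.succ_eq_add_one, Nat.add_sub_cancel, pow_succ]
  field_simp
  ring

/-- `1 / |x|` is integrable near the origin in dimension at least two. -/
theorem integrableOn_ball_inv_norm {n : ℕ} (hn : 2 ≤ n) :
    IntegrableOn (fun x : E n => ‖x‖⁻¹) (Metric.ball 0 1) := by
  have : Nontrivial (E n) :=
    Module.nontrivial_of_finrank_pos (R := ℝ) (by rw [finrank_euclideanSpace_fin]; lia)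
  refine (integrableOn_fun_norm_addHaar volume (f := fun r : ℝ => r⁻¹)).2 ?_
  have h : IntegrableOn (fun r : ℝ => r ^ (n - 2)) (Ioo 0 1) :=
    ((continuous_pow (n - 2)).integrableOn_Icc (a := 0) (b := 1)).mono_set Ioo_subset_Icc_self
  refine h.congr_fun (fun r hr => ?_) measurableSet_Ioo
  have hr0 : 0 < r := hr.1
  obtain ⟨m, rfl⟩ := Nat.exists_eq_add_of_le hn
  rw [finrank_euclideanSpace_fin, smul_eq_mul, show 2 + m - 2 = m by lia,
    show 2 + m - 1 = m + 1 by lia, pow_succ]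
  field_simp

/-- The map `logMap γ i` is weakly differentiable on the unit ball. The functions
`log^{-γ}(1 + 1/(|x|² + ε))` are smooth and satisfy the integration by parts formula, and their
gradients are bounded by a multiple of `1 / |x|`, so that one may let `ε → 0`. -/
theorem hasWeakFDerivOn_logMap {n : ℕ} (hn : 2 ≤ n) {γ : ℝ} (hγ : 0 < γ) (i : Fin n)
    (hG : LocallyIntegrableOn (logMapDeriv γ i) (Metric.ball 0 1)) :
    HasWeakFDerivOn (Metric.ball (0 : E n) 1) (logMap γ i) (logMapDeriv γ i) := by
  have : Nontrivial (E n) :=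
    Module.nontrivial_of_finrank_pos (R := ℝ) (by rw [finrank_euclideanSpace_fin]; lia)
  refine ⟨(continuous_logMap hγ i).locallyIntegrable.locallyIntegrableOn _, hG,
    fun φ hφ hφc hφs v => ?_⟩
  have hφ1 : Continuous φ := hφ.continuous
  have hφ2 : Continuous fun x => fderiv ℝ φ x v :=
    (hφ.continuous_fderiv (by simp)).clm_apply continuous_const
  have hφ0 : ∀ x, x ∉ Metric.ball (0 : E n) 1 → φ x = 0 := fun x hx =>
    image_eq_zero_of_notMem_tsupport fun h => hx (hφs h)
  have hφ0' : ∀ x, x ∉ Metric.ball (0 : E n) 1 → fderiv ℝ φ x v = 0 := fun x hx => by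
    rw [fderiv_of_notMem_tsupport ℝ fun h => hx (hφs h)]
    simp
  have hφc' : HasCompactSupport fun x => fderiv ℝ φ x v :=
    (hφc.fderiv ℝ).comp_left (g := fun A : E n →L[ℝ] ℝ => A v) (by simp)
  -- it suffices to treat the scalar profile, as both sides are multiples of a fixed vector
  suffices hs : ∫ x, fderiv ℝ φ x v * logProfile γ (‖x‖ ^ 2)
      = -∫ x, φ x * (2 * logProfileDeriv γ (‖x‖ ^ 2) * inner ℝ x v) by
    have e1 : ∀ x : E n, fderiv ℝ φ x v • logMap γ i x
        = (fderiv ℝ φ x v * logProfile γ (‖x‖ ^ 2)) • EuclideanSpace.single i (1 : ℝ) :=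
      fun x => by rw [logMap, smul_smul]
    have e2 : ∀ x : E n, φ x • logMapDeriv γ i x v
        = (φ x * (2 * logProfileDeriv γ (‖x‖ ^ 2) * inner ℝ x v)) •
          EuclideanSpace.single i (1 : ℝ) := fun x => by
      simp [logMapDeriv, smul_smul, mul_assoc]
    simp_rw [e1, e2]
    rw [integral_smul_const, integral_smul_const, hs, neg_smul]
  set ε : ℕ → ℝ := fun k => 1 / ((k : ℝ) + 1) with hε
  have hε0 : ∀ k, 0 < ε k := fun k => by positivity
  have hε1 : ∀ k, ε k ≤ 1 := fun k => by
    rw [hε, div_le_one (by positivity)]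
    linarith [show (0 : ℝ) ≤ k by positivity]
  have hεlim : Tendsto ε atTop (𝓝 0) := tendsto_one_div_add_atTop_nhds_zero_nat
  have ht0 : ∀ (x : E n) k, 0 < ‖x‖ ^ 2 + ε k := fun x k => by have := hε0 k; positivity
  have hlim : ∀ x : E n, Tendsto (fun k => ‖x‖ ^ 2 + ε k) atTop (𝓝 (‖x‖ ^ 2)) := fun x => by
    simpa using hεlim.const_add (‖x‖ ^ 2)
  have ht2 : ∀ x ∈ Metric.ball (0 : E n) 1, ∀ k, ‖x‖ ^ 2 + ε k ≤ 2 := fun x hx k => by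
    have h1 := pow_le_one₀ (n := 2) (norm_nonneg x) (mem_ball_zero_iff.1 hx).le
    linarith [hε1 k]
  have hd : ∀ k (x : E n), HasFDerivAt (fun x : E n => logProfile γ (‖x‖ ^ 2 + ε k))
      (logProfileDeriv γ (‖x‖ ^ 2 + ε k) • (2 • innerSL ℝ x)) x := fun k x =>
    HasDerivAt.comp_hasFDerivAt (h₂ := logProfile γ) (f := fun x : E n => ‖x‖ ^ 2 + ε k) x
      (hasDerivAt_logProfile γ (ht0 x k))
      ((hasStrictFDerivAt_norm_sq x).hasFDerivAt.add_const (ε k))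
  have hcu : ∀ k, Continuous fun x : E n => logProfile γ (‖x‖ ^ 2 + ε k) := fun k =>
    continuous_iff_continuousAt.2 fun x => (hd k x).continuousAt
  have hcd : ∀ k, Continuous fun x : E n =>
      2 * logProfileDeriv γ (‖x‖ ^ 2 + ε k) * inner ℝ x v := fun k =>
    (continuous_const.mul ((continuousOn_logProfileDeriv γ).comp_continuous (by fun_prop)
      fun x => ht0 x k)).mul (by fun_prop)
  have hfd : ∀ k (x : E n), fderiv ℝ (fun x : E n => logProfile γ (‖x‖ ^ 2 + ε k)) x v
      = 2 * logProfileDeriv γ (‖x‖ ^ 2 + ε k) * inner ℝ x v := fun k x => by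
    rw [(hd k x).fderiv]
    simp
    ring
  have hparts : ∀ k, ∫ x, fderiv ℝ φ x v * logProfile γ (‖x‖ ^ 2 + ε k)
      = -∫ x, φ x * (2 * logProfileDeriv γ (‖x‖ ^ 2 + ε k) * inner ℝ x v) := fun k => by
    have h := integral_mul_fderiv_eq_neg_fderiv_mul_of_integrable (μ := volume) (f := φ)
      (g := fun x : E n => logProfile γ (‖x‖ ^ 2 + ε k)) (v := v)
      ((hφ2.mul (hcu k)).integrable_of_hasCompactSupport hφc'.mul_right)
      (by simp_rw [hfd]
          exact (hφ1.mul (hcd k)).integrable_of_hasCompactSupport hφc.mul_right)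
      ((hφ1.mul (hcu k)).integrable_of_hasCompactSupport hφc.mul_right)
      (fun x _ => (hφ.differentiable (by simp)) x) (fun x _ => (hd k x).differentiableAt)
    simp_rw [hfd] at h
    rw [h, neg_neg]
  have hL : Tendsto (fun k => ∫ x, fderiv ℝ φ x v * logProfile γ (‖x‖ ^ 2 + ε k)) atTop
      (𝓝 (∫ x, fderiv ℝ φ x v * logProfile γ (‖x‖ ^ 2))) := by
    refine tendsto_integral_of_dominated_convergence
      (fun x => ‖fderiv ℝ φ x v‖ * logProfile γ 2) (fun k => (hφ2.mul (hcu k)).aestronglyMeasurable)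
      ((hφ2.integrable_of_hasCompactSupport hφc').norm.mul_const _)
      (fun k => Eventually.of_forall fun x => ?_) (Eventually.of_forall fun x => ?_)
    · by_cases hx : x ∈ Metric.ball (0 : E n) 1
      · rw [norm_mul, Real.norm_of_nonneg (logProfile_nonneg γ (ht0 x k).le)]
        gcongr
        exact logProfile_le_logProfile hγ (ht0 x k).le (ht2 x hx k)
      · simp [hφ0' x hx]
    · refine Tendsto.const_mul _ ((continuousOn_logProfile hγ _ (sq_nonneg ‖x‖)).tendsto.comp ?_)
      exact tendsto_nhdsWithin_iff.2 ⟨hlim x, Eventually.of_forall fun k => (ht0 x k).le⟩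
  have hR : Tendsto (fun k => ∫ x, φ x * (2 * logProfileDeriv γ (‖x‖ ^ 2 + ε k) * inner ℝ x v))
      atTop (𝓝 (∫ x, φ x * (2 * logProfileDeriv γ (‖x‖ ^ 2) * inner ℝ x v))) := by
    obtain ⟨M, hM⟩ := hφ1.bounded_above_of_compact_support hφc
    have hM0 : 0 ≤ M := (norm_nonneg _).trans (hM 0)
    have hP := logProfile_nonneg (γ + 1) zero_le_two
    refine tendsto_integral_of_dominated_convergence
      ((Metric.ball (0 : E n) 1).indicator fun x =>
        M * (2 * (γ * logProfile (γ + 1) 2) * ‖v‖) * ‖x‖⁻¹)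
      (fun k => (hφ1.mul (hcd k)).aestronglyMeasurable) ?_
      (fun k => Eventually.of_forall fun x => ?_) ?_
    · exact (integrable_indicator_iff measurableSet_ball).2
        ((integrableOn_ball_inv_norm hn).const_mul _)
    · by_cases hx : x ∈ Metric.ball (0 : E n) 1
      · have hD := logProfileDeriv_nonneg hγ.le (ht0 x k).le
        have hD2 : 0 ≤ 2 * logProfileDeriv γ (‖x‖ ^ 2 + ε k) := by positivity
        rw [indicator_of_mem hx, norm_mul, norm_mul, Real.norm_of_nonneg hD2, mul_assoc M]
        refine mul_le_mul (hM x) ?_ (by positivity) hM0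
        calc 2 * logProfileDeriv γ (‖x‖ ^ 2 + ε k) * ‖(inner ℝ x v : ℝ)‖
            ≤ 2 * (γ * logProfile (γ + 1) 2 / (‖x‖ ^ 2 + ε k)) * (‖x‖ * ‖v‖) := by
              gcongr
              · exact logProfileDeriv_le hγ (ht0 x k) (ht2 x hx k)
              · exact norm_inner_le_norm x v
          _ = 2 * (γ * logProfile (γ + 1) 2) * ‖v‖ * (‖x‖ / (‖x‖ ^ 2 + ε k)) := by ring
          _ ≤ _ := by
              gcongr
              rcases (norm_nonneg x).eq_or_lt with h | h
              · simp [← h]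
              · rw [div_le_iff₀ (ht0 x k)]
                have := hε0 k
                have : ‖x‖⁻¹ * (‖x‖ ^ 2 + ε k) = ‖x‖ + ‖x‖⁻¹ * ε k := by field_simp
                rw [this]
                exact le_add_of_nonneg_right (by positivity)
      · simp [hφ0 x hx, indicator_of_notMem hx]
    · filter_upwards [Measure.ae_ne volume (0 : E n)] with x hx
      have hx2 : 0 < ‖x‖ ^ 2 := by have := norm_pos_iff.2 hx; positivity
      have h1 := ((continuousOn_logProfileDeriv γ).continuousAt (Ioi_mem_nhds hx2)).tendsto.comp
        (hlim x)
      exact ((h1.const_mul 2).mul_const _).const_mul _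
  refine tendsto_nhds_unique hL ?_
  simp_rw [hparts]
  exact hR.neg

/-! ### Sharpness of the exponent -/

/-- The inhomogeneity of the sharpness example, an upper bound for `‖logMapDeriv γ i x‖ ^ n`. -/
noncomputable def logSource {n : ℕ} (γ : ℝ) (x : E n) : ℝ :=
  (2 * γ * logProfile (γ + 1) (‖x‖ ^ 2) / ‖x‖) ^ n

theorem logSource_nonneg {n : ℕ} {γ : ℝ} (hγ : 0 ≤ γ) (x : E n) : 0 ≤ logSource γ x := by
  have := logProfile_nonneg (γ + 1) (sq_nonneg ‖x‖)
  unfold logSource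
  positivity

theorem measurable_logSource {n : ℕ} (γ : ℝ) : Measurable (logSource γ : E n → ℝ) := by
  have := (measurable_logProfile (γ + 1)).comp (measurable_norm.pow_const 2 : Measurable
      fun x : E n => ‖x‖ ^ 2)
  exact ((this.const_mul (2 * γ)).div measurable_norm).pow_const n

/-- On the unit ball, `log (e + S)` is controlled by `log (1 + 1/|x|²)`. -/
theorem exists_log_logSource_le (n : ℕ) {γ : ℝ} (hγ : 0 < γ) :
    ∃ C : ℝ, 0 ≤ C ∧ ∀ x : E n, x ≠ 0 → x ∈ Metric.ball 0 1 →
      Real.log (Real.exp 1 + logSource γ x) ≤ C * Real.log (1 + 1 / ‖x‖ ^ 2) := by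
  have hp := logProfile_nonneg (γ + 1) zero_le_one
  set A : ℝ := (2 * γ * logProfile (γ + 1) 1) ^ n with hA
  have hA0 : 0 ≤ A := by positivity
  have hexp : 1 < Real.exp 1 := Real.one_lt_exp_iff.2 one_pos
  have hlogA : 0 ≤ Real.log (Real.exp 1 + A) := Real.log_nonneg (by linarith)
  have hlog2 : 0 < Real.log 2 := Real.log_pos one_lt_two
  refine ⟨Real.log (Real.exp 1 + A) / Real.log 2 + n, by positivity, fun x hx0 hx => ?_⟩
  have hr : 0 < ‖x‖ := norm_pos_iff.2 hx0
  have hr1 : ‖x‖ < 1 := mem_ball_zero_iff.1 hx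
  have hr2 : ‖x‖ ^ 2 ≤ 1 := pow_le_one₀ hr.le hr1.le
  have hP := logProfile_nonneg (γ + 1) (sq_nonneg ‖x‖)
  have hS : logSource γ x ≤ A * (1 + 1 / ‖x‖ ^ 2) ^ n := by
    rw [logSource, hA, ← mul_pow, div_eq_mul_inv]
    have h1 : ‖x‖⁻¹ ≤ 1 + 1 / ‖x‖ ^ 2 := by
      rw [one_div, ← inv_pow]
      nlinarith [sq_nonneg (‖x‖⁻¹ - 1), inv_pos.2 hr]
    have h2 := logProfile_le_logProfile (show 0 < γ + 1 by linarith) (sq_nonneg ‖x‖) hr2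
    gcongr
  have hone : 1 ≤ 1 + 1 / ‖x‖ ^ 2 := le_add_of_nonneg_right (by positivity)
  have htwo : 2 ≤ 1 + 1 / ‖x‖ ^ 2 := by
    have : 1 ≤ 1 / ‖x‖ ^ 2 := (one_le_div (by positivity)).2 hr2
    linarith
  have hsum : Real.exp 1 + logSource γ x ≤ (Real.exp 1 + A) * (1 + 1 / ‖x‖ ^ 2) ^ n := by
    have : Real.exp 1 * 1 ≤ Real.exp 1 * (1 + 1 / ‖x‖ ^ 2) ^ n := by
      gcongr
      exact one_le_pow₀ hone
    linarith
  have hS0 := logSource_nonneg hγ.le x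
  have h3 := Real.log_le_log (by linarith) hsum
  rw [Real.log_mul (by positivity) (by positivity), Real.log_pow] at h3
  have h4 : Real.log 2 ≤ Real.log (1 + 1 / ‖x‖ ^ 2) := Real.log_le_log two_pos htwo
  have h5 : Real.log (Real.exp 1 + A)
      ≤ Real.log (Real.exp 1 + A) / Real.log 2 * Real.log (1 + 1 / ‖x‖ ^ 2) := by
    rw [div_mul_eq_mul_div, le_div_iff₀ hlog2]
    gcongr
  linarith

/-- The Zygmund condition for the sharpness example: the integrand is at most a multiple of
`|x|^{-n} log^{μ - n(γ+1)}(1 + 1/|x|²)`, and `n(γ+1) - μ > 1`. -/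
theorem integrableOn_logSource_mul_log {n : ℕ} (hn : n ≠ 0) {μ γ : ℝ} (hμ : 0 ≤ μ) (hγ : 0 < γ)
    (hγμ : (μ - n + 1) / n < γ) :
    IntegrableOn (fun x : E n => logSource γ x * Real.log (Real.exp 1 + logSource γ x) ^ μ)
      (Metric.ball 0 1) := by
  have hn' : (0 : ℝ) < n := by positivity
  obtain ⟨C, hC0, hC⟩ := exists_log_logSource_le n hγ
  set δ : ℝ := n * (γ + 1) - μ - 1 with hδdef
  have hδ : 0 < δ := by
    rw [div_lt_iff₀ hn'] at hγμ
    linarith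
  have : Nontrivial (E n) :=
    Module.nontrivial_of_finrank_pos (R := ℝ) (by rw [finrank_euclideanSpace_fin]; lia)
  have hexp : 1 < Real.exp 1 := Real.one_lt_exp_iff.2 one_pos
  have hm : Measurable (logSource γ : E n → ℝ) := measurable_logSource γ
  refine ((integrableOn_ball_logProfile_div hn hδ).const_mul ((2 * γ) ^ n * C ^ μ)).mono'
    (by fun_prop : Measurable fun x : E n =>
      logSource γ x * Real.log (Real.exp 1 + logSource γ x) ^ μ).aestronglyMeasurable ?_
  filter_upwards [ae_restrict_mem measurableSet_ball,
    ae_restrict_of_ae (Measure.ae_ne volume (0 : E n))] with x hx hx0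
  have hr : 0 < ‖x‖ := norm_pos_iff.2 hx0
  have hS0 := logSource_nonneg hγ.le x
  have hL0 := log_one_add_one_div_pos (show 0 < ‖x‖ ^ 2 by positivity)
  have hl : 0 ≤ Real.log (Real.exp 1 + logSource γ x) := Real.log_nonneg (by linarith)
  rw [Real.norm_of_nonneg (by positivity)]
  have e : logProfile (γ + 1) (‖x‖ ^ 2) ^ n * Real.log (1 + 1 / ‖x‖ ^ 2) ^ μ
      = logProfile (δ + 1) (‖x‖ ^ 2) := by
    rw [logProfile, logProfile, ← Real.rpow_natCast (_ ^ _) n, ← Real.rpow_mul hL0.le,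
      ← Real.rpow_add hL0]
    congr 1
    rw [hδdef]
    ring
  calc logSource γ x * Real.log (Real.exp 1 + logSource γ x) ^ μ
      ≤ logSource γ x * (C * Real.log (1 + 1 / ‖x‖ ^ 2)) ^ μ := by
        gcongr
        exact hC x hx0 hx
    _ = (2 * γ) ^ n * C ^ μ *
        (logProfile (γ + 1) (‖x‖ ^ 2) ^ n * Real.log (1 + 1 / ‖x‖ ^ 2) ^ μ / ‖x‖ ^ n) := by
        rw [Real.mul_rpow hC0 hL0.le, logSource, div_pow, mul_pow]
        ring
    _ = _ := by rw [e]

/-- The example satisfies the hypotheses with `K = 1`: its derivative has rank one, so that the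
distortion inequality only asks for `‖Df‖ ^ n ≤ S`. -/
theorem isZygmundSolution_logMap {n : ℕ} (hn : 2 ≤ n) {μ γ : ℝ} (hμ : 0 ≤ μ) (hγ : 0 < γ)
    (hγμ : (μ - n + 1) / n < γ) (i : Fin n) :
    IsZygmundSolution n μ (Metric.ball 0 1) (logMap γ i) (logMapDeriv γ i) (fun _ => 1)
      (logSource γ) := by
  have hn0 : n ≠ 0 := by lia
  have hexp : 1 < Real.exp 1 := Real.one_lt_exp_iff.2 one_pos
  have hfin : IsFiniteMeasure (volume.restrict (Metric.ball (0 : E n) 1)) :=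
    ⟨by simpa using measure_ball_lt_top⟩
  have hZ := integrableOn_logSource_mul_log (n := n) hn0 hμ hγ hγμ
  have hG : MemLp (logMapDeriv γ i) n (volume.restrict (Metric.ball (0 : E n) 1)) := by
    rw [← integrable_norm_rpow_iff (aestronglyMeasurable_logMapDeriv i _)
      (by exact_mod_cast hn0) (ENNReal.natCast_ne_top n)]
    simp only [ENNReal.toReal_natCast, Real.rpow_natCast]
    refine hZ.mono' ((aestronglyMeasurable_logMapDeriv i _).norm.pow n)
      (Eventually.of_forall fun x => ?_)
    have hS0 := logSource_nonneg hγ.le x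
    rw [Real.norm_of_nonneg (by positivity)]
    have h1 : ‖logMapDeriv γ i x‖ ^ n ≤ logSource γ x :=
      pow_le_pow_left₀ (norm_nonneg _) (norm_logMapDeriv_le hγ.le i x) n
    refine h1.trans (le_mul_of_one_le_right hS0 (Real.one_le_rpow ?_ hμ))
    rw [Real.le_log_iff_exp_le (by linarith)]
    linarith
  have hGi : IntegrableOn (logMapDeriv γ i) (Metric.ball (0 : E n) 1) :=
    hG.integrable (by exact_mod_cast (by lia : 1 ≤ n))
  have hf := continuous_logMap hγ i
  refine
    { isOpen := Metric.isOpen_ball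
      isConnected := (convex_ball _ _).isConnected ⟨0, by simp⟩
      sobolev := ⟨hasWeakFDerivOn_logMap hn hγ i hGi.locallyIntegrableOn, fun k _ hk => ?_,
        fun k hk _ => hG.mono_measure (Measure.restrict_mono hk le_rfl)⟩
      K_meas := aemeasurable_const
      one_le_K := fun _ _ => le_rfl
      S_meas := (measurable_logSource γ).aemeasurable
      S_nonneg := fun x _ => logSource_nonneg hγ.le x
      inclusion := Eventually.of_forall fun x => ?_
      K_locBdd := fun k _ _ => memLp_top_const 1
      S_zygmund := hZ.locallyIntegrableOn }
  · obtain ⟨M, hM⟩ := hk.exists_bound_of_continuousOn hf.continuousOn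
    have : IsFiniteMeasure (volume.restrict k) := ⟨by simpa using hk.measure_lt_top⟩
    exact MemLp.of_bound hf.aestronglyMeasurable M
      ((ae_restrict_iff' hk.measurableSet).2 (Eventually.of_forall hM))
  · change ‖logMapDeriv γ i x‖ ^ n ≤ 1 * (logMapDeriv γ i x).det + logSource γ x
    rw [logMapDeriv, det_smulRight_eq_zero hn, mul_zero, zero_add]
    exact pow_le_pow_left₀ (norm_nonneg _) (norm_logMapDeriv_le hγ.le i x) n

/-- The modulus of continuity of `logMap γ i` at the origin is not better than `log^{-γ}(1/r)`. -/
theorem not_hasLogModulusAt_logMap {n : ℕ} {γ β : ℝ} (hγ : 0 < γ) (hβ : γ < β) (i : Fin n) :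
    ¬ HasLogModulusAt (Metric.ball 0 1) (logMap γ i) (0 : E n) β := by
  rintro ⟨C, hC⟩
  have hlog : Tendsto (fun r : ℝ => Real.log (1 / r)) (𝓝[>] 0) atTop :=
    Real.tendsto_log_atTop.comp (tendsto_inv_nhdsGT_zero.congr fun r => (one_div r).symm)
  have hbig := ((tendsto_rpow_atTop (sub_pos.2 hβ)).comp hlog).eventually_gt_atTop (C * 3 ^ γ)
  have hsmall : ∀ᶠ r in 𝓝[>] (0 : ℝ), r ∈ Ioo 0 (1 / 2) := Ioo_mem_nhdsGT (by norm_num)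
  obtain ⟨r, hr, hrC, hrb⟩ := (hsmall.and (hC.and hbig)).exists
  have hr0 : 0 < r := hr.1
  have hr1 : r < 1 / 2 := hr.2
  have hℓ : 0 < Real.log (1 / r) := Real.log_pos (by rw [lt_div_iff₀ hr0]; linarith)
  set x : E n := EuclideanSpace.single i r with hx
  have hxn : ‖x‖ = r := by simp [hx, abs_of_pos hr0]
  have hP := logProfile_nonneg γ (sq_nonneg r)
  have hval : ‖logMap γ i (0 : E n) - logMap γ i x‖ = logProfile γ (r ^ 2) := by
    simp [logMap, hxn, logProfile_zero hγ.ne', norm_smul, abs_of_nonneg hP]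
  have hle : ENNReal.ofReal (logProfile γ (r ^ 2))
      ≤ ENNReal.ofReal (C * Real.log (1 / r) ^ (-β)) := by
    refine le_trans ?_ hrC
    rw [← hval]
    exact le_iSup₂_of_le
      (f := fun (x : E n) (_ : x ∈ {x : E n | x ∈ Metric.ball 0 1 ∧ ‖x - 0‖ ≤ r}) =>
      ENNReal.ofReal ‖logMap γ i 0 - logMap γ i x‖) x
      ⟨by rw [mem_ball_zero_iff, hxn]; linarith, by rw [sub_zero, hxn]⟩ le_rfl
  -- for `r < 1 / 2` one has `1 + 1 / r ^ 2 ≤ 1 / r ^ 3`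
  have hlow : (3 * Real.log (1 / r)) ^ (-γ) ≤ logProfile γ (r ^ 2) := by
    refine Real.rpow_le_rpow_of_nonpos (log_one_add_one_div_pos (by positivity)) ?_ (by linarith)
    have h1 : 1 + 1 / r ^ 2 ≤ (1 / r) ^ 3 := by
      rw [one_div_pow, le_div_iff₀ (by positivity)]
      have : (1 + 1 / r ^ 2) * r ^ 3 = r ^ 3 + r := by field_simp
      rw [this]
      nlinarith [pow_le_one₀ (n := 2) hr0.le (by linarith : r ≤ 1)]
    have h2 := Real.log_le_log (by positivity) h1
    rwa [Real.log_pow] at h2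
  have hpos : 0 < (3 * Real.log (1 / r)) ^ (-γ) := by positivity
  have hreal := (ENNReal.ofReal_le_ofReal_iff' (q := C * Real.log (1 / r) ^ (-β))).1 hle
  have hreal : logProfile γ (r ^ 2) ≤ C * Real.log (1 / r) ^ (-β) :=
    hreal.resolve_right (by linarith)
  have h3 := hlow.trans hreal
  rw [Real.mul_rpow (by norm_num) hℓ.le, Real.rpow_neg (by norm_num : (0 : ℝ) ≤ 3)] at h3
  have h4 : Real.log (1 / r) ^ (β - γ) ≤ C * 3 ^ γ := by
    have h5 := mul_le_mul_of_nonneg_right h3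
      (show 0 ≤ (3 : ℝ) ^ γ * Real.log (1 / r) ^ β by positivity)
    have e1 : ((3 : ℝ) ^ γ)⁻¹ * Real.log (1 / r) ^ (-γ) * (3 ^ γ * Real.log (1 / r) ^ β)
        = Real.log (1 / r) ^ (β - γ) := by
      have : (3 : ℝ) ^ γ ≠ 0 := by positivity
      rw [sub_eq_add_neg, add_comm, Real.rpow_add hℓ]
      field_simp
    have e2 : C * Real.log (1 / r) ^ (-β) * (3 ^ γ * Real.log (1 / r) ^ β) = C * 3 ^ γ := by
      rw [Real.rpow_neg hℓ.le]
      have : Real.log (1 / r) ^ β ≠ 0 := by positivity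
      field_simp
    rwa [e1, e2] at h5
  exact absurd hrb (not_lt.2 h4)

end GenDistortion

theorem mainTheorem1 (n : ℕ) (hn : 2 ≤ n) (μ : ℝ) (hμ : (n : ℝ) - 1 < μ) :
    -- existence of a continuous representative, with a logarithmic modulus of continuity
    (∀ (Ω : Set (GenDistortion.E n)) (f : GenDistortion.E n → GenDistortion.E n)
        (Df : GenDistortion.E n → (GenDistortion.E n →L[ℝ] GenDistortion.E n))
        (K S : GenDistortion.E n → ℝ),
        GenDistortion.IsZygmundSolution n μ Ω f Df K S →
        ∃ g : GenDistortion.E n → GenDistortion.E n,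
          ContinuousOn g Ω ∧ f =ᵐ[volume.restrict Ω] g ∧
          ∀ x₀ ∈ Ω, GenDistortion.HasLogModulusAt Ω g x₀ ((μ - n + 1) / n)) ∧
    -- sharpness: no larger exponent is possible
    (∀ β : ℝ, (μ - n + 1) / n < β →
        ∃ (Ω : Set (GenDistortion.E n)) (f : GenDistortion.E n → GenDistortion.E n)
          (Df : GenDistortion.E n → (GenDistortion.E n →L[ℝ] GenDistortion.E n))
          (K S : GenDistortion.E n → ℝ),
          GenDistortion.IsZygmundSolution n μ Ω f Df K S ∧ ContinuousOn f Ω ∧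
          ∃ x₀ ∈ Ω, ¬ GenDistortion.HasLogModulusAt Ω f x₀ β) := by
  have hn0 : (0 : ℝ) < n := by positivity
  have hn2 : (2 : ℝ) ≤ n := by exact_mod_cast hn
  refine ⟨fun Ω f Df K S h => h.exists_continuous_representative hn hμ, fun β hβ => ?_⟩
  -- any exponent strictly between the optimal one and `β` gives an example
  obtain ⟨γ, hγ, hγβ⟩ := exists_between hβ
  have hγ0 : 0 < γ := (div_pos (by linarith) hn0).trans hγ
  let i : Fin n := ⟨0, by lia⟩
  exact ⟨Metric.ball 0 1, GenDistortion.logMap γ i, GenDistortion.logMapDeriv γ i, fun _ => 1,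
    GenDistortion.logSource γ,
    GenDistortion.isZygmundSolution_logMap hn (by linarith) hγ0 hγ i,
    (GenDistortion.continuous_logMap hγ0 i).continuousOn, 0, by simp,
    GenDistortion.not_hasLogModulusAt_logMap hγ0 hγβ i⟩
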